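/- Notation. All functions live on $\mathbb R^3$; $\langle v\rangle=(1+|v|^2)^{1/2}$, $m_s(f)=\int\langle v\rangle^s|f|\,dv$, $\|f\|_{L^2_s}^2=\int|f|^2\langle v\rangle^{2s}dv$, $L^1_2=\{f\in L^1:\ m_2(f)<\infty\}$, $L^2_s=\{f:\ \|f\|_{L^2_s}<\infty\}$, $H(f)=\int f\log f\,dv$, and for $\varepsilon>0$, $0\le f\le\varepsilon^{-1}$, $$S_\varepsilon(f)=-\frac1\varepsilon\int\big[\varepsilon f\log(\varepsilon f)+(1-\varepsilon f)\log(1-\varepsilon f)\big]dv,\qquad H_\varepsilon(f|g)=-S_\varepsilon(f)+S_\varepsilon(g),$$ while $H_0(f|g)=H(f)-H(g)$. Let $f_{\rm in}\ge0$, $f_{\rm in}\in L^1_2$, be such that $\int f_{\rm in}\,dv=1$, $\int f_{\rm in}v\,dv=0$, $\int f_{\rm in}|v|^2dv=3$ and $|H(f_{\rm in})|<\infty$. Either assume $0<\|f_{\rm in}\|_\infty=:\varepsilon_0^{-1}<\infty$ and $S_{\varepsilon_0}(f_{\rm in})>0$ (quantum case), or set $\varepsilon_0=0$ (classical case). Let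 $\varepsilon\in[0,\varepsilon_0]$. The class $\mathcal Y_\varepsilon(f_{\rm in})$ consists of the $f\in L^1_2$ with $0\le f\le\varepsilon^{-1}$ (just $f\ge0$ if $\varepsilon=0$) that have the same mass, momentum and energy $\int f(1,v,|v|^2)\,dv$ as $f_{\rm in}$ and satisfy $S_\varepsilon(f)\ge S_\varepsilon(f_{\rm in})$ (for $\varepsilon=0$: $H(f)\le H(f_{\rm in})$). For $\gamma\in[0,1]$ and $g\in C^1(\mathbb R^3)$ with $g>0$, $\varepsilon g<1$, let $\Pi(z)$ denote the orthogonal projection onto $(\mathbb Rz)^\perp$ and let $$D_\varepsilon(g)=\frac12\iint|v-w|^{\gamma+2}\,g(v)g(w)(1-\varepsilon g(v))(1-\varepsilon g(w))\left|\Pi(v-w)\left(\frac{\nabla g(v)}{g(v)(1-\varepsilon g(v))}-\frac{\nabla g(w)}{g(w)(1-\varepsilon g(w))}\right)\right|^2dv\,dw\in[0,\infty].$$ Let $\mathcal M_\varepsilon(v)=\dfrac{a_\varepsilon e^{-b_\varepsilon|v|^2}}{1+\varepsilon a_\varepsilon e^{-b_\varepsilon|v|^2}}$, where $a_\varepsilon,b_\varepsilon>0$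 are such that $\mathcal M_\varepsilon$ has mass $1$, momentum $0$ and energy $\int\mathcal M_\varepsilon|v|^2dv=3$. **Corollary 4.5.** For all $\kappa_0>0$ and all real $m,\ell$ there is a constant $C_0>0$, depending only on $\kappa_0,m,\ell$, such that the following holds. Let $\gamma\in[0,1]$, let $f_{\rm in},\varepsilon_0,\varepsilon$ be as above, and let $g\in\mathcal Y_\varepsilon(f_{\rm in})\cap L^2_{2+\gamma}$ be positive and of class $C^1$ with $$\inf_{v}(1-\varepsilon g(v))\ge\kappa_0,\qquad m_{2+\gamma}(g)\le m,\qquad\|g\|_{L^2_{2+\gamma}}\le\ell .$$ Then parameters $a_\varepsilon,b_\varepsilon$ as above exist, and $$D_\varepsilon(g)\ \ge\ C_0\left[b_\varepsilon-\frac{12\,\varepsilon^2}{\kappa_0^4}\max\big(\|g\|_\infty^2,\|\mathcal M_\varepsilon\|_\infty^2\big)\right]H_\varepsilon(g|\mathcal M_\varepsilon),$$ where for $\varepsilon=0$ the term carrying the factor $\varepsilon^2$ is read as $0$. -/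

import Mathlib

open MeasureTheory
open scoped ENNReal

noncomputable section

namespace LFD

/-- Velocity space `ℝ³` with its Euclidean structure. -/
abbrev Vel : Type := EuclideanSpace ℝ (Fin 3)

/-- The weight `⟨v⟩ = (1 + |v|²)^{1/2}`. -/
def bracket (v : Vel) : ℝ := Real.sqrt (1 + ‖v‖ ^ 2)

/-- The moment `m_s(f) = ∫ ⟨v⟩^s |f(v)| dv`, with values in `[0, ∞]`. -/
def moment (s : ℝ) (f : Vel → ℝ) : ℝ≥0∞ :=
  ∫⁻ v, ENNReal.ofReal (bracket v ^ s * |f v|)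

/-- The weighted norm `‖f‖_{L²_s} = (∫ |f(v)|² ⟨v⟩^{2s} dv)^{1/2}`, with values in `[0, ∞]`. -/
def weightedL2Norm (s : ℝ) (f : Vel → ℝ) : ℝ≥0∞ :=
  (∫⁻ v, ENNReal.ofReal (|f v| ^ 2 * bracket v ^ (2 * s))) ^ (1 / 2 : ℝ)

/-- `f ∈ L¹_s(ℝ³)`. -/
def MemL1 (s : ℝ) (f : Vel → ℝ) : Prop :=
  Integrable f ∧ moment s f < ∞

/-- `f ∈ L²_s(ℝ³)`. -/
def MemL2 (s : ℝ) (f : Vel → ℝ) : Prop :=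
  AEStronglyMeasurable f ∧ weightedL2Norm s f < ∞

/-- The Boltzmann entropy `H(f) = ∫ f log f dv` (used where `f log f` is integrable). -/
def boltzmannH (f : Vel → ℝ) : ℝ :=
  ∫ v, f v * Real.log (f v)

/-- The Fermi-Dirac entropy, for `ε > 0`,
`S_ε(f) = -ε⁻¹ ∫ [ε f log (ε f) + (1 - ε f) log (1 - ε f)] dv`.
The integrand is integrable for every `f ∈ L¹_2` with `0 ≤ f ≤ ε⁻¹`. -/
def fdEntropy (ε : ℝ) (f : Vel → ℝ) : ℝ :=
  -(1 / ε) * ∫ v, (ε * f v * Real.log (ε * f v) + (1 - ε * f v) * Real.log (1 - ε * f v))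

/-- The relative entropy: `H_ε(f|g) = -S_ε(f) + S_ε(g)` for `ε ≠ 0`, and
`H_0(f|g) = H(f) - H(g)` in the classical case. -/
def relEntropy (ε : ℝ) (f g : Vel → ℝ) : ℝ :=
  if ε = 0 then boltzmannH f - boltzmannH g else -fdEntropy ε f + fdEntropy ε g

/-- The standing assumptions on the initial datum: `0 ≤ f_in ∈ L¹_2`, `|H(f_in)| < ∞` and, in the
quantum case `ε₀ > 0`, also `‖f_in‖_∞ = ε₀⁻¹` and `S_{ε₀}(f_in) > 0`. The value `ε₀ = 0` stands for
the classical case, where the last two conditions are dropped. -/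
structure IsInitialDatum (ε₀ : ℝ) (fin : Vel → ℝ) : Prop where
  nonneg_param : 0 ≤ ε₀
  nonneg : ∀ᵐ v, 0 ≤ fin v
  memL1 : MemL1 2 fin
  finite_entropy : Integrable (fun v => fin v * Real.log (fin v))
  sup_norm : 0 < ε₀ → eLpNorm fin ∞ volume = ENNReal.ofReal ε₀⁻¹
  entropy_pos : 0 < ε₀ → 0 < fdEntropy ε₀ fin

/-- The normalization `ϱ_in = E_in = 1`, `u_in = 0`. -/
structure IsNormalized (f : Vel → ℝ) : Prop where
  mass : ∫ v, f v = 1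
  momentum : ∫ v, f v • v = 0
  energy : ∫ v, f v * ‖v‖ ^ 2 = 3

/-- The class `Y_ε(f_in)`: `f ∈ L¹_2` with `0 ≤ f ≤ ε⁻¹` (no upper bound if `ε = 0`), the same mass,
momentum and energy as `f_in`, and `S_ε(f) ≥ S_ε(f_in)`; for `ε = 0` the last condition reads
`H(f) ≤ H(f_in)` (in particular `H(f)` is finite). -/
structure MemY (ε : ℝ) (fin f : Vel → ℝ) : Prop where
  memL1 : MemL1 2 f
  nonneg : ∀ᵐ v, 0 ≤ f v
  pauli : ∀ᵐ v, ε * f v ≤ 1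
  mass : ∫ v, f v = ∫ v, fin v
  momentum : ∫ v, f v • v = ∫ v, fin v • v
  energy : ∫ v, f v * ‖v‖ ^ 2 = ∫ v, fin v * ‖v‖ ^ 2
  entropy : 0 < ε → fdEntropy ε fin ≤ fdEntropy ε f
  entropy_classical : ε = 0 →
    Integrable (fun v => f v * Real.log (f v)) ∧ boltzmannH f ≤ boltzmannH fin

/-- The orthogonal projection `Π(z) y = y - (z · y / |z|²) z` onto `(ℝ z)^⊥`. -/
def projPerp (z y : Vel) : Vel := y - (inner ℝ z y / ‖z‖ ^ 2) • z

/-- `Ξ_ε[g](v,w) = g g_* (1 - ε g)(1 - ε g_*)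
  |Π(v - w) (∇g / (g (1 - ε g)) - ∇g_* / (g_* (1 - ε g_*)))|²`, with `g = g(v)`, `g_* = g(w)`. -/
def xi (ε : ℝ) (g : Vel → ℝ) (v w : Vel) : ℝ :=
  g v * g w * (1 - ε * g v) * (1 - ε * g w) *
    ‖projPerp (v - w) ((g v * (1 - ε * g v))⁻¹ • gradient g v
      - (g w * (1 - ε * g w))⁻¹ • gradient g w)‖ ^ 2

/-- The entropy production `D_ε(g) = ½ ∬ |v - w|^{γ+2} Ξ_ε[g](v,w) dv dw`, with values in `[0, ∞]`,
for continuously differentiable `g` with `0 < g < ε⁻¹` (the integrand is then nonnegative). -/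
def entropyProduction (γ ε : ℝ) (g : Vel → ℝ) : ℝ≥0∞ :=
  (1 / 2) * ∫⁻ p : Vel × Vel, ENNReal.ofReal (‖p.1 - p.2‖ ^ (γ + 2) * xi ε g p.1 p.2)

/-- The function `v ↦ a e^{-b|v|²} / (1 + ε a e^{-b|v|²})`. -/
def fermiDirac (ε a b : ℝ) (v : Vel) : ℝ :=
  a * Real.exp (-b * ‖v‖ ^ 2) / (1 + ε * (a * Real.exp (-b * ‖v‖ ^ 2)))

/-- `a, b > 0` are the parameters `a_ε, b_ε` of the Fermi-Dirac statistics of unit mass, zero momentum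
and energy `3`. -/
structure IsFermiDiracParams (ε a b : ℝ) : Prop where
  a_pos : 0 < a
  b_pos : 0 < b
  normalized : IsNormalized (fermiDirac ε a b)

/-- The `L^∞` norm as a real number. -/
def supNorm (f : Vel → ℝ) : ℝ := (eLpNorm f ∞ volume).toReal

end LFD

end

open MeasureTheory
open scoped ENNReal

noncomputable section

namespace LFD

open Filter Topology Set

/-! The bracket is at most `b_ε`, because the term subtracted from it is nonnegative. It therefore
suffices to bound `b_ε` by a constant `B(κ₀)` and to prove `H_ε(g|M_ε) ≤ C · D_ε(g)`, with `C`
depending only on `κ₀` and `ℓ`. The bridge between entropy and entropy production is a relative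
Fisher information with respect to a Gaussian of freely chosen temperature.

Entropy below Fisher information. The logarithm of a Gaussian is affine in `|v|²`, and `g` and `M_ε`
share mass and energy. So the relative entropy is the difference of their Fermi-Dirac divergences
from any Gaussian `N`, and is at most the divergence of `g`. Pointwise that divergence is at most
the Boltzmann divergence between `u = g/(1-εg)` and `N` (`fdBregman_le_bregman`,
`relEntropy_fermiDirac`). The Gaussian logarithmic Sobolev inequality (`logSobolev`) bounds the
latter by a Fisher information of `u`, whose logarithmic gradient is exactly the field `P =
∇g/(g(1-εg))` of the entropy production. The inequality is proved on the line by monotone transport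
and tensorized by subadditivity of relative entropy.

Fisher information below entropy production. Write `F = g(1-εg)`. Integrating the component of
`(v-w) ∧ (P(v)-P(w))` along `a ∧ b`, for orthonormal `a`, `b`, against `F(w) (w-μ)·a` and
integrating by parts in `w` leaves only `C_a P(v)·b + v·b`. Here `μ` is the centroid of `F`, `C_a`
is its variance along `a`, and the basis diagonalizes the covariance. Cauchy-Schwarz bounds the
weighted square of this expression by the entropy production (`lintegral_direction_le`). The
weighted `L²` bound controls the singular kernel `|v-w|^{-γ}` and keeps the variances away from
zero. Comparing two different `a` with the same `b` shows that the variances are nearly equal, which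
supplies the missing diagonal terms (`lintegral_isotropic_le`, `exists_fisher_le`).

Parameters. After scaling only `A = εa` matters. A very degenerate profile is close to the indicator
of a ball, hence has less energy than any density of the same mass obeying the strict Pauli bound
(`exists_degenerate`). This caps `A` and then `b_ε`, and it gives one sign for the intermediate
value argument that produces `a_ε`, `b_ε`; the nearly classical regime gives the other. -/

/-! ### Pointwise entropy divergences -/

/-- The Bregman divergence of `x ↦ x log x`. -/
def bregman (x y : ℝ) : ℝ := x * Real.log (x / y) - x + y

lemma bregman_nonneg {x y : ℝ} (hx : 0 < x) (hy : 0 < y) : 0 ≤ bregman x y := by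
  have h := Real.one_sub_inv_le_log_of_pos (div_pos hx hy)
  have h2 := mul_le_mul_of_nonneg_left h hx.le
  have h3 : x * (1 - (x / y)⁻¹) = x - y := by field_simp
  unfold bregman
  linarith

/-- The Bregman divergence between `x` and `n / (1 + ε n)` for the Fermi-Dirac entropy density. -/
def fdBregman (ε x n : ℝ) : ℝ :=
  (1 / ε) * (ε * x * Real.log (ε * x) + (1 - ε * x) * Real.log (1 - ε * x))
    - x * Real.log (ε * n) + (1 / ε) * Real.log (1 + ε * n)

/-- Multiplied by `ε`, the divergence is the relative entropy of the two-point law `(εx, 1-εx)` with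
respect to `(εn, 1)/(1+εn)`, so this is Gibbs' inequality. -/
lemma fdBregman_nonneg {ε x n : ℝ} (hε : 0 < ε) (hx : 0 < x) (hx1 : ε * x < 1) (hn : 0 < n) :
    0 ≤ fdBregman ε x n := by
  have hex : 0 < ε * x := mul_pos hε hx
  have hen : 0 < ε * n := mul_pos hε hn
  have h1x : 0 < 1 - ε * x := by linarith
  have h1n : 0 < 1 + ε * n := by linarith
  have h1 := Real.one_sub_inv_le_log_of_pos (show 0 < ε * x * (1 + ε * n) / (ε * n) by positivity)
  have h2 := Real.one_sub_inv_le_log_of_pos (show 0 < (1 - ε * x) * (1 + ε * n) by positivity)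
  rw [Real.log_div (by positivity) hen.ne', Real.log_mul hex.ne' h1n.ne'] at h1
  rw [Real.log_mul h1x.ne' h1n.ne'] at h2
  have h1' := mul_le_mul_of_nonneg_left h1 hex.le
  have h2' := mul_le_mul_of_nonneg_left h2 h1x.le
  have e1 : ε * x * (1 - (ε * x * (1 + ε * n) / (ε * n))⁻¹) = ε * x - ε * n / (1 + ε * n) := by
    field_simp
  have e2 : (1 - ε * x) * (1 - ((1 - ε * x) * (1 + ε * n))⁻¹)
      = (1 - ε * x) - 1 / (1 + ε * n) := by
    field_simp
  have e3 : ε * n / (1 + ε * n) + 1 / (1 + ε * n) = 1 := by field_simp; ring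
  have key : 0 ≤ ε * fdBregman ε x n := by
    have : ε * fdBregman ε x n = ε * x * Real.log (ε * x) + (1 - ε * x) * Real.log (1 - ε * x)
      - ε * x * Real.log (ε * n) + Real.log (1 + ε * n) := by
      unfold fdBregman; field_simp
    rw [this]; linarith
  exact nonneg_of_mul_nonneg_right key hε

/-- Put `y = x/(1-εx)`. After multiplication by `ε`, apply `1 - 1/t ≤ log t` at `t = y/n` with
weight `ε²xy`, and at `t = 1/((1-εx)(1+εn))`. The resulting lower bound for the difference vanishes
identically because `y - x = εxy`. The lemma trades quantum for classical entropy. -/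
lemma fdBregman_le_bregman {ε x n : ℝ} (hε : 0 < ε) (hx : 0 < x) (hx1 : ε * x < 1) (hn : 0 < n) :
    fdBregman ε x n ≤ bregman (x / (1 - ε * x)) n := by
  have hex : 0 < ε * x := mul_pos hε hx
  have hen : 0 < ε * n := mul_pos hε hn
  have h1x : 0 < 1 - ε * x := by linarith
  have h1n : 0 < 1 + ε * n := by linarith
  obtain ⟨y, hy⟩ : ∃ y, y = x / (1 - ε * x) := ⟨_, rfl⟩
  have hy0 : 0 < y := hy ▸ div_pos hx h1x
  have hyx : y - x = ε * x * y := by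
    have : y * (1 - ε * x) = x := by rw [hy]; exact div_mul_cancel₀ _ h1x.ne'
    linarith
  have l1 : Real.log (y / n) = Real.log (ε * x) - Real.log (1 - ε * x) - Real.log (ε * n) := by
    rw [hy, Real.log_div (by positivity) hn.ne', Real.log_div hx.ne' h1x.ne',
      Real.log_mul hε.ne' hx.ne', Real.log_mul hε.ne' hn.ne']
    ring
  have h1 := Real.one_sub_inv_le_log_of_pos (div_pos hy0 hn)
  have h2 := Real.one_sub_inv_le_log_of_pos (show 0 < ((1 - ε * x) * (1 + ε * n))⁻¹ by positivity)
  rw [Real.log_inv, Real.log_mul h1x.ne' h1n.ne', inv_inv] at h2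
  have h1' := mul_le_mul_of_nonneg_left h1 (show 0 ≤ ε * (ε * x * y) by positivity)
  have e1 : ε * (ε * x * y) * (1 - (y / n)⁻¹) = ε * (ε * x * y) - ε * (ε * x * n) := by
    field_simp
  rw [← hy]
  have e2 : ε * fdBregman ε x n = ε * x * Real.log (y / n)
      + (Real.log (1 - ε * x) + Real.log (1 + ε * n)) := by
    rw [l1]; unfold fdBregman; field_simp; ring
  have e3 : ε * bregman y n = ε * x * Real.log (y / n)
      + ε * (ε * x * y) * Real.log (y / n) - ε * y + ε * n := by
    unfold bregman
    have : y = x + ε * x * y := by linarith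
    have : ε * y * Real.log (y / n) = ε * (x + ε * x * y) * Real.log (y / n) := by rw [← this]
    linarith
  have e4 : ε * y = ε * x + ε * (ε * x * y) := by rw [← hyx]; ring
  refine le_of_mul_le_mul_left ?_ hε
  rw [e2, e3]
  linarith

lemma bregman_measurable {α : Type*} [MeasurableSpace α] {f g : α → ℝ} (hf : Measurable f)
    (hg : Measurable g) : Measurable fun x => bregman (f x) (g x) := by
  unfold bregman; fun_prop

lemma fdBregman_measurable {α : Type*} [MeasurableSpace α] (ε : ℝ) {f g : α → ℝ}
    (hf : Measurable f) (hg : Measurable g) : Measurable fun x => fdBregman ε (f x) (g x) := by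
  unfold fdBregman; fun_prop

/-! ### Gaussians and their moments -/

/-- The Gaussian `v ↦ A e^{-β|v|²}`. -/
def gauss (A β : ℝ) (v : Vel) : ℝ := A * Real.exp (-β * ‖v‖ ^ 2)

lemma gauss_pos {A β : ℝ} (hA : 0 < A) (v : Vel) : 0 < gauss A β v :=
  mul_pos hA (Real.exp_pos _)

lemma continuous_gauss (A β : ℝ) : Continuous (gauss A β) := by
  unfold gauss; fun_prop

lemma integrable_gauss (A : ℝ) {β : ℝ} (hβ : 0 < β) : Integrable (gauss A β) := by
  have := GaussianFourier.integrable_cexp_neg_mul_sq_norm_add (V := Vel) (b := (β : ℂ))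
    (by simpa using hβ) 0 0
  have h2 := this.norm
  refine (h2.const_mul A).congr (Filter.Eventually.of_forall fun v => ?_)
  simp only [gauss, Complex.norm_exp]
  congr 2
  simp
  left
  norm_cast

lemma integrable_gauss_mul_sq (A : ℝ) {β : ℝ} (hβ : 0 < β) :
    Integrable (fun v => gauss A β v * ‖v‖ ^ 2) := by
  -- Half of the Gaussian decay absorbs the weight, by `|v|² ≤ (2/β) e^{β|v|²/2}`.
  refine ((integrable_gauss (|A| * (2 / β)) (half_pos hβ))).mono'
    ((continuous_gauss A β).mul (by fun_prop)).aestronglyMeasurable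
    (Filter.Eventually.of_forall fun v => ?_)
  have h1 : β / 2 * ‖v‖ ^ 2 ≤ Real.exp (β / 2 * ‖v‖ ^ 2) := by
    have := Real.add_one_le_exp (β / 2 * ‖v‖ ^ 2); linarith
  have h2 : ‖v‖ ^ 2 ≤ 2 / β * Real.exp (β / 2 * ‖v‖ ^ 2) := by
    have := mul_le_mul_of_nonneg_left h1 (show 0 ≤ 2 / β by positivity)
    have e : 2 / β * (β / 2 * ‖v‖ ^ 2) = ‖v‖ ^ 2 := by field_simp
    linarith
  simp only [gauss, norm_mul, Real.norm_eq_abs, Real.abs_exp, abs_pow, abs_norm]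
  calc |A| * Real.exp (-β * ‖v‖ ^ 2) * ‖v‖ ^ 2
      ≤ |A| * Real.exp (-β * ‖v‖ ^ 2) * (2 / β * Real.exp (β / 2 * ‖v‖ ^ 2)) := by gcongr
    _ = |A| * (2 / β) * (Real.exp (-β * ‖v‖ ^ 2) * Real.exp (β / 2 * ‖v‖ ^ 2)) := by ring
    _ = |A| * (2 / β) * Real.exp (-(β / 2) * ‖v‖ ^ 2) := by
        rw [← Real.exp_add]; congr 2; ring

lemma log_mul_gauss {c A β : ℝ} (hc : 0 < c) (hA : 0 < A) (v : Vel) :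
    Real.log (c * gauss A β v) = Real.log (c * A) - β * ‖v‖ ^ 2 := by
  unfold gauss
  rw [← mul_assoc, Real.log_mul (by positivity) (Real.exp_ne_zero _), Real.log_exp]
  ring

/-! ### Entropies as divergences from a Gaussian -/

section Quantum

variable {ε A β : ℝ} {f : Vel → ℝ}

/-- The Fermi-Dirac entropy density is nonpositive and `log(1+t) ≤ t`, so the nonnegative divergence
is dominated by a combination of `f`, `f|v|²` and the Gaussian. -/
lemma integrable_fdBregman (hε : 0 < ε) (hA : 0 < A) (hβ : 0 < β) (hm : Measurable f)
    (h0 : ∀ v, 0 < f v) (h1 : ∀ v, ε * f v < 1) (hi : Integrable f)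
    (he : Integrable fun v => f v * ‖v‖ ^ 2) :
    Integrable fun v => fdBregman ε (f v) (gauss A β v) := by
  have hd : Integrable fun v => (-Real.log (ε * A)) * f v + β * (f v * ‖v‖ ^ 2) + gauss A β v :=
    ((hi.const_mul _).add (he.const_mul _)).add (integrable_gauss A hβ)
  refine hd.mono' (fdBregman_measurable ε hm (continuous_gauss A β).measurable).aestronglyMeasurable
    (Filter.Eventually.of_forall fun v => ?_)
  have hN := gauss_pos (β := β) hA v
  rw [Real.norm_of_nonneg (fdBregman_nonneg hε (h0 v) (h1 v) hN)]
  have hx : 0 < ε * f v := mul_pos hε (h0 v)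
  have l1 : ε * f v * Real.log (ε * f v) ≤ 0 :=
    mul_nonpos_of_nonneg_of_nonpos hx.le (Real.log_nonpos hx.le (h1 v).le)
  have l2 : (1 - ε * f v) * Real.log (1 - ε * f v) ≤ 0 :=
    mul_nonpos_of_nonneg_of_nonpos (by linarith [h1 v])
      (Real.log_nonpos (by linarith [h1 v]) (by linarith))
  have l3 : (1 / ε) * (ε * f v * Real.log (ε * f v) + (1 - ε * f v) * Real.log (1 - ε * f v)) ≤ 0 :=
    mul_nonpos_of_nonneg_of_nonpos (by positivity) (by linarith)
  have l4 : (1 / ε) * Real.log (1 + ε * gauss A β v) ≤ gauss A β v := by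
    have h := Real.log_le_sub_one_of_pos (show 0 < 1 + ε * gauss A β v by positivity)
    have h' := mul_le_mul_of_nonneg_left h (show 0 ≤ 1 / ε by positivity)
    have e : 1 / ε * (1 + ε * gauss A β v - 1) = gauss A β v := by field_simp; ring
    linarith
  unfold fdBregman
  rw [log_mul_gauss hε hA]
  nlinarith

/-- Since the logarithm of the Gaussian is affine in `|v|²`, `f` enters through its entropy, mass
and energy only. Two densities with equal mass and energy thus have entropies that differ exactly by
the difference of these integrals, whatever `A` and `β` are. -/
lemma integral_fdBregman (hε : 0 < ε) (hA : 0 < A) (hβ : 0 < β) (hm : Measurable f)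
    (h0 : ∀ v, 0 < f v) (h1 : ∀ v, ε * f v < 1) (hi : Integrable f)
    (he : Integrable fun v => f v * ‖v‖ ^ 2) :
    ∫ v, fdBregman ε (f v) (gauss A β v) = -fdEntropy ε f - Real.log (ε * A) * (∫ v, f v)
      + β * (∫ v, f v * ‖v‖ ^ 2) + ∫ v, (1 / ε) * Real.log (1 + ε * gauss A β v) := by
  have hB := integrable_fdBregman hε hA hβ hm h0 h1 hi he
  have hL : Integrable fun v => (1 / ε) * Real.log (1 + ε * gauss A β v) := by
    refine (integrable_gauss A hβ).mono' (Measurable.aestronglyMeasurable ?_)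
      (Filter.Eventually.of_forall fun v => ?_)
    · have := (continuous_gauss A β).measurable; fun_prop
    · have hN := gauss_pos (β := β) hA v
      have h := Real.log_le_sub_one_of_pos (show 0 < 1 + ε * gauss A β v by positivity)
      have h' := mul_le_mul_of_nonneg_left h (show 0 ≤ 1 / ε by positivity)
      have e : 1 / ε * (1 + ε * gauss A β v - 1) = gauss A β v := by field_simp; ring
      rw [Real.norm_of_nonneg]
      · linarith
      · exact mul_nonneg (by positivity) (Real.log_nonneg (by nlinarith))
  have hc : Integrable fun v => Real.log (ε * A) * f v - β * (f v * ‖v‖ ^ 2) :=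
    (hi.const_mul (Real.log (ε * A))).sub (he.const_mul β)
  have hBc : Integrable fun v => fdBregman ε (f v) (gauss A β v)
      + (Real.log (ε * A) * f v - β * (f v * ‖v‖ ^ 2)) := hB.add hc
  have e : (fun v => (1 / ε) * (ε * f v * Real.log (ε * f v)
      + (1 - ε * f v) * Real.log (1 - ε * f v)))
      = fun v => fdBregman ε (f v) (gauss A β v)
        + (Real.log (ε * A) * f v - β * (f v * ‖v‖ ^ 2))
        - (1 / ε) * Real.log (1 + ε * gauss A β v) := by
    funext v
    unfold fdBregman
    rw [log_mul_gauss hε hA]; ring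
  have e2 : -fdEntropy ε f = ∫ v, (1 / ε) * (ε * f v * Real.log (ε * f v)
      + (1 - ε * f v) * Real.log (1 - ε * f v)) := by
    rw [integral_const_mul]; unfold fdEntropy; ring
  rw [e2, e, integral_sub hBc hL, integral_add hB hc,
    integral_sub (hi.const_mul _) (he.const_mul _), integral_const_mul, integral_const_mul]
  ring

end Quantum

/-- The classical counterpart: again only entropy, mass and energy of `f` survive. -/
lemma integrable_bregman_gauss {A β : ℝ} (hA : 0 < A) (hβ : 0 < β) {f : Vel → ℝ}
    (h0 : ∀ v, 0 < f v) (hi : Integrable f) (he : Integrable fun v => f v * ‖v‖ ^ 2)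
    (hl : Integrable fun v => f v * Real.log (f v)) :
    Integrable (fun v => bregman (f v) (gauss A β v)) ∧
    ∫ v, bregman (f v) (gauss A β v) = boltzmannH f - (Real.log A + 1) * (∫ v, f v)
      + β * (∫ v, f v * ‖v‖ ^ 2) + ∫ v, gauss A β v := by
  have e : (fun v => bregman (f v) (gauss A β v)) = fun v => f v * Real.log (f v)
      - (Real.log A + 1) * f v + β * (f v * ‖v‖ ^ 2) + gauss A β v := by
    funext v
    have := log_mul_gauss (β := β) one_pos hA v
    rw [one_mul, one_mul] at this
    unfold bregman
    rw [Real.log_div (h0 v).ne' (gauss_pos hA v).ne', this]; ring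
  have i1 : Integrable fun v => f v * Real.log (f v) - (Real.log A + 1) * f v :=
    hl.sub (hi.const_mul (Real.log A + 1))
  have i2 : Integrable fun v => f v * Real.log (f v) - (Real.log A + 1) * f v
      + β * (f v * ‖v‖ ^ 2) := i1.add (he.const_mul β)
  have i3 := integrable_gauss A hβ
  rw [e]
  refine ⟨i2.add i3, ?_⟩
  rw [integral_add i2 i3, integral_add i1 (he.const_mul β), integral_sub hl (hi.const_mul _),
    integral_const_mul, integral_const_mul]
  rfl

/-! ### Fermi-Dirac profiles and the relative entropy -/

lemma fermiDirac_eq (ε a b : ℝ) (v : Vel) :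
    fermiDirac ε a b v = gauss a b v / (1 + ε * gauss a b v) := rfl

section FermiDirac

variable {ε a b : ℝ}

lemma fermiDirac_pos (hε : 0 ≤ ε) (ha : 0 < a) (v : Vel) : 0 < fermiDirac ε a b v := by
  have := gauss_pos (β := b) ha v
  rw [fermiDirac_eq]; positivity

lemma mul_fermiDirac_lt_one (hε : 0 ≤ ε) (ha : 0 < a) (v : Vel) : ε * fermiDirac ε a b v < 1 := by
  have := gauss_pos (β := b) ha v
  rw [fermiDirac_eq, ← mul_div_assoc, div_lt_one (by positivity)]
  linarith

lemma continuous_fermiDirac (hε : 0 ≤ ε) (ha : 0 < a) : Continuous (fermiDirac ε a b) := by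
  have h := continuous_gauss a b
  have e : fermiDirac ε a b = fun v => gauss a b v / (1 + ε * gauss a b v) := rfl
  rw [e]
  refine h.div (by fun_prop) fun v => ?_
  have := gauss_pos (β := b) ha v
  positivity

lemma fermiDirac_le_gauss (hε : 0 ≤ ε) (ha : 0 < a) (v : Vel) :
    fermiDirac ε a b v ≤ gauss a b v := by
  have := gauss_pos (β := b) ha v
  rw [fermiDirac_eq]
  exact div_le_self this.le (by nlinarith)

lemma integrable_fermiDirac (hε : 0 ≤ ε) (ha : 0 < a) (hb : 0 < b) :
    Integrable (fermiDirac ε a b) :=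
  (integrable_gauss a hb).mono' (continuous_fermiDirac hε ha).aestronglyMeasurable
    (Filter.Eventually.of_forall fun v => by
      rw [Real.norm_of_nonneg (fermiDirac_pos hε ha v).le]; exact fermiDirac_le_gauss hε ha v)

lemma integrable_fermiDirac_mul_sq (hε : 0 ≤ ε) (ha : 0 < a) (hb : 0 < b) :
    Integrable fun v => fermiDirac ε a b v * ‖v‖ ^ 2 :=
  (integrable_gauss_mul_sq a hb).mono'
    ((continuous_fermiDirac hε ha).mul (by fun_prop)).aestronglyMeasurable
    (Filter.Eventually.of_forall fun v => by
      rw [Real.norm_of_nonneg (mul_nonneg (fermiDirac_pos hε ha v).le (by positivity))]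
      exact mul_le_mul_of_nonneg_right (fermiDirac_le_gauss hε ha v) (by positivity))

/-- This is the equality case of Gibbs' inequality: at `x = n/(1+εn)` the two two-point laws
coincide. -/
lemma fdBregman_fermiDirac (hε : 0 < ε) (ha : 0 < a) (v : Vel) :
    fdBregman ε (fermiDirac ε a b v) (gauss a b v) = 0 := by
  have hN := gauss_pos (β := b) ha v
  rw [fermiDirac_eq]
  generalize gauss a b v = n at hN ⊢
  have h1 : 0 < 1 + ε * n := by positivity
  have e1 : ε * (n / (1 + ε * n)) = ε * n / (1 + ε * n) := by ring
  have e2 : 1 - ε * n / (1 + ε * n) = (1 + ε * n)⁻¹ := by field_simp; ring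
  unfold fdBregman
  rw [e1, e2, Real.log_div (by positivity) h1.ne', Real.log_inv]
  field_simp
  ring

lemma gauss_mul_log (ha : 0 < a) (hb : 0 < b) :
    Integrable fun v => gauss a b v * Real.log (gauss a b v) := by
  have e : (fun v => gauss a b v * Real.log (gauss a b v))
      = fun v => Real.log a * gauss a b v - b * (gauss a b v * ‖v‖ ^ 2) := by
    funext v
    have := log_mul_gauss (β := b) one_pos ha v
    rw [one_mul, one_mul] at this
    rw [this]; ring
  rw [e]
  exact ((integrable_gauss a hb).const_mul _).sub ((integrable_gauss_mul_sq a hb).const_mul _)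

/-- The relative entropy to the Fermi-Dirac statistics is nonnegative and, for every Gaussian,
controlled by the relative Boltzmann entropy of `g / (1 - ε g)` with respect to that Gaussian. -/
theorem relEntropy_fermiDirac {g : Vel → ℝ} (hε : 0 ≤ ε) (hm : Measurable g) (h0 : ∀ v, 0 < g v)
    (h1 : ∀ v, ε * g v < 1) (hi : Integrable g) (he : Integrable fun v => g v * ‖v‖ ^ 2)
    (hl : ε = 0 → Integrable fun v => g v * Real.log (g v)) (hab : IsFermiDiracParams ε a b)
    (hmass : ∫ v, g v = 1) (hen : ∫ v, g v * ‖v‖ ^ 2 = 3) :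
    0 ≤ relEntropy ε g (fermiDirac ε a b) ∧ ∀ A β : ℝ, 0 < A → 0 < β →
      ENNReal.ofReal (relEntropy ε g (fermiDirac ε a b))
        ≤ ∫⁻ v, ENNReal.ofReal (bregman (g v / (1 - ε * g v)) (gauss A β v)) := by
  obtain ⟨ha, hb, hM1, -, hM3⟩ := hab
  have hMm := (continuous_fermiDirac (b := b) hε ha).measurable
  rcases hε.eq_or_lt with rfl | hε
  · have hM : fermiDirac 0 a b = gauss a b := by funext v; simp [fermiDirac_eq]
    rw [hM] at hM1 hM3 ⊢
    -- Equal mass and energy cancel all affine terms, which leaves `A`, `β` free. Nonnegativity uses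
    -- the profile's own Gaussian, whose divergence term vanishes; the upper bound discards the
    -- nonnegative second integral.
    have key : ∀ A β : ℝ, 0 < A → 0 < β → relEntropy 0 g (gauss a b)
        = (∫ v, bregman (g v) (gauss A β v)) - ∫ v, bregman (gauss a b v) (gauss A β v) := by
      intro A β hA hβ
      rw [(integrable_bregman_gauss hA hβ h0 hi he (hl rfl)).2,
        (integrable_bregman_gauss hA hβ (gauss_pos ha) (integrable_gauss a hb)
          (integrable_gauss_mul_sq a hb) (gauss_mul_log ha hb)).2, hmass, hen, hM1, hM3]
      simp [relEntropy]
    constructor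
    · rw [key a b ha hb]
      have : (fun v => bregman (gauss a b v) (gauss a b v)) = fun _ => 0 := by
        funext v
        have := gauss_pos (β := b) ha v
        simp [bregman, this.ne']
      rw [this, integral_zero, sub_zero]
      exact integral_nonneg fun v => bregman_nonneg (h0 v) (gauss_pos ha v)
    · intro A β hA hβ
      simp only [zero_mul, sub_zero, div_one]
      rw [← ofReal_integral_eq_lintegral_ofReal
        (integrable_bregman_gauss hA hβ h0 hi he (hl rfl)).1
        (Filter.Eventually.of_forall fun v => bregman_nonneg (h0 v) (gauss_pos hA v)), key A β hA hβ]
      apply ENNReal.ofReal_le_ofReal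
      have : 0 ≤ ∫ v, bregman (gauss a b v) (gauss A β v) :=
        integral_nonneg fun v => bregman_nonneg (gauss_pos ha v) (gauss_pos hA v)
      linarith
  · have hF0 := fermiDirac_pos (b := b) hε.le ha
    have hF1 := mul_fermiDirac_lt_one (b := b) hε.le ha
    have hFi := integrable_fermiDirac hε.le ha hb
    have hFe := integrable_fermiDirac_mul_sq hε.le ha hb
    -- The same cancellation for the Fermi-Dirac entropy; the terms that depend on the Gaussian
    -- alone cancel as well.
    have key : ∀ A β : ℝ, 0 < A → 0 < β → relEntropy ε g (fermiDirac ε a b)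
        = (∫ v, fdBregman ε (g v) (gauss A β v))
          - ∫ v, fdBregman ε (fermiDirac ε a b v) (gauss A β v) := by
      intro A β hA hβ
      rw [integral_fdBregman hε hA hβ hm h0 h1 hi he,
        integral_fdBregman hε hA hβ hMm hF0 hF1 hFi hFe, hmass, hen, hM1, hM3]
      simp only [relEntropy, hε.ne', if_false]
      ring
    constructor
    · rw [key a b ha hb]
      simp only [fdBregman_fermiDirac hε ha, integral_zero, sub_zero]
      exact integral_nonneg fun v => fdBregman_nonneg hε (h0 v) (h1 v) (gauss_pos ha v)
    · intro A β hA hβ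
      calc ENNReal.ofReal (relEntropy ε g (fermiDirac ε a b))
          ≤ ENNReal.ofReal (∫ v, fdBregman ε (g v) (gauss A β v)) := by
            apply ENNReal.ofReal_le_ofReal
            rw [key A β hA hβ]
            have : 0 ≤ ∫ v, fdBregman ε (fermiDirac ε a b v) (gauss A β v) :=
              integral_nonneg fun v => fdBregman_nonneg hε (hF0 v) (hF1 v) (gauss_pos hA v)
            linarith
        _ = ∫⁻ v, ENNReal.ofReal (fdBregman ε (g v) (gauss A β v)) :=
            ofReal_integral_eq_lintegral_ofReal (integrable_fdBregman hε hA hβ hm h0 h1 hi he)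
              (Filter.Eventually.of_forall fun v =>
                fdBregman_nonneg hε (h0 v) (h1 v) (gauss_pos hA v))
        _ ≤ _ := lintegral_mono fun v => ENNReal.ofReal_le_ofReal
            (fdBregman_le_bregman hε (h0 v) (h1 v) (gauss_pos hA v))

end FermiDirac

/-! ### Monotone transport on the line -/

section Transport

variable {f : ℝ → ℝ}

lemma hasDerivAt_integral_Iic (hf : Continuous f) (hi : Integrable f) (x : ℝ) :
    HasDerivAt (fun y => ∫ t in Iic y, f t) (f x) x := by
  have e : (fun y => ∫ t in Iic y, f t) = fun y => (∫ t in Iic x, f t) + ∫ t in x..y, f t := by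
    funext y
    rw [← intervalIntegral.integral_Iic_sub_Iic hi.integrableOn hi.integrableOn]; ring
  rw [e]
  exact (intervalIntegral.integral_hasDerivAt_right (hf.intervalIntegrable _ _)
    hf.stronglyMeasurable.stronglyMeasurableAtFilter hf.continuousAt).const_add _

lemma strictMono_integral_Iic (hf : Continuous f) (hi : Integrable f) (h0 : ∀ x, 0 < f x) :
    StrictMono fun y => ∫ t in Iic y, f t :=
  strictMono_of_hasDerivAt_pos (hasDerivAt_integral_Iic hf hi) h0

lemma tendsto_integral_Iic_atTop (hi : Integrable f) :
    Tendsto (fun y => ∫ t in Iic y, f t) atTop (𝓝 (∫ t, f t)) :=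
  (aecover_Iic tendsto_id).integral_tendsto_of_countably_generated hi

lemma tendsto_integral_Iic_atBot : Tendsto (fun y => ∫ t in Iic y, f t) atBot (𝓝 0) :=
  tendsto_integral_Iic_zero tendsto_id

lemma range_integral_Iic (hf : Continuous f) (hi : Integrable f) (h0 : ∀ x, 0 < f x) :
    range (fun y => ∫ t in Iic y, f t) = Ioo 0 (∫ t, f t) := by
  have hm := strictMono_integral_Iic hf hi h0
  have hc : Continuous fun y => ∫ t in Iic y, f t :=
    continuous_iff_continuousAt.2 fun x => (hasDerivAt_integral_Iic hf hi x).continuousAt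
  apply Subset.antisymm
  · rintro _ ⟨x, rfl⟩
    constructor
    · refine lt_of_le_of_lt ?_ (hm (show x - 1 < x by linarith))
      exact setIntegral_nonneg measurableSet_Iic fun t _ => (h0 t).le
    · refine lt_of_lt_of_le (hm (show x < x + 1 by linarith)) ?_
      exact hm.monotone.ge_of_tendsto (tendsto_integral_Iic_atTop hi) _
  · intro p hp
    exact mem_range_of_exists_le_of_exists_ge hc
      ((tendsto_integral_Iic_atBot.eventually (ge_mem_nhds hp.1)).exists)
      (((tendsto_integral_Iic_atTop hi).eventually (le_mem_nhds hp.2)).exists)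

/-- Monotone transport between two positive continuous probability densities on the line. -/
theorem exists_transport {f g : ℝ → ℝ} (hf : Continuous f) (hfi : Integrable f)
    (hf0 : ∀ x, 0 < f x) (hg : Continuous g) (hgi : Integrable g) (hg0 : ∀ x, 0 < g x)
    (hfg : ∫ t, f t = ∫ t, g t) :
    ∃ T : ℝ → ℝ, ∀ x, HasDerivAt T (f x / g (T x)) x := by
  have hmf := strictMono_integral_Iic hf hfi hf0
  have hmg := strictMono_integral_Iic hg hgi hg0
  have hrf := range_integral_Iic hf hfi hf0
  have hrg := range_integral_Iic hg hgi hg0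
  set U := fun y => ∫ t in Iic y, f t with hU
  set V := fun y => ∫ t in Iic y, g t with hV
  -- The quantile function of `g`. Outside `(0, ∫ g)` the value is arbitrary and never used, since
  -- `U` takes its values in that interval.
  have hex : ∀ p : ℝ, ∃ y, p ∈ Ioo 0 (∫ t, g t) → V y = p := by
    intro p
    by_cases hp : p ∈ Ioo 0 (∫ t, g t)
    · obtain ⟨y, hy⟩ := hrg.symm ▸ hp
      exact ⟨y, fun _ => hy⟩
    · exact ⟨0, fun h => absurd h hp⟩
  choose Ψ hΨ using hex
  have hΨV : ∀ y, Ψ (V y) = y := fun y =>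
    hmg.injective (hΨ _ (by rw [← hrg]; exact mem_range_self y))
  have hmono : StrictMonoOn Ψ (Ioo 0 (∫ t, g t)) := by
    intro p hp q hq hpq
    rw [← hmg.lt_iff_lt, hΨ p hp, hΨ q hq]; exact hpq
  have himg : Ψ '' (Ioo 0 (∫ t, g t)) = univ := by
    rw [eq_univ_iff_forall]
    exact fun y => ⟨V y, by rw [← hrg]; exact mem_range_self y, hΨV y⟩
  have hmem : ∀ x, U x ∈ Ioo 0 (∫ t, g t) := fun x => by
    rw [← hfg, ← hrf]; exact mem_range_self x
  refine ⟨fun x => Ψ (U x), fun x => ?_⟩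
  have hn : Ioo 0 (∫ t, g t) ∈ 𝓝 (U x) := isOpen_Ioo.mem_nhds (hmem x)
  -- A strictly monotone map onto the whole line is continuous; the derivative of the inverse then
  -- comes from that of `V`.
  have hc : ContinuousAt Ψ (U x) :=
    hmono.continuousAt_of_image_mem_nhds hn (by rw [himg]; exact univ_mem)
  have hd := HasDerivAt.of_local_left_inverse hc (hasDerivAt_integral_Iic hg hgi (Ψ (U x)))
    (hg0 _).ne' (by filter_upwards [hn] with p hp using hΨ p hp)
  have := hd.comp x (hasDerivAt_integral_Iic hf hfi x)
  rwa [inv_mul_eq_div] at this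

end Transport

/-! ### Logarithmic Sobolev inequality on the line -/

/-- Supplies endpoints along which the boundary terms of an integration by parts tend to zero, with
no pointwise decay assumed. -/
lemma exists_ge_lt_of_integrable {h : ℝ → ℝ} (hi : Integrable h)
    {δ : ℝ} (hδ : 0 < δ) (N : ℝ) : ∃ x, N ≤ x ∧ h x < δ := by
  by_contra! H
  have h1 : Integrable (fun _ : ℝ => δ) (volume.restrict (Ici N)) := by
    refine (hi.integrableOn (s := Ici N)).mono' aestronglyMeasurable_const ?_
    filter_upwards [ae_restrict_mem measurableSet_Ici] with x hx
    rw [Real.norm_of_nonneg hδ.le]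
    exact H x hx
  rw [integrable_const_iff] at h1
  rcases h1 with h1 | h1
  · exact hδ.ne' h1
  · rw [isFiniteMeasure_restrict] at h1
    exact h1 Real.volume_Ici

/-- The centred one-dimensional Gaussian density proportional to `e^{-βx²}`. -/
def gaussLine (β x : ℝ) : ℝ := Real.sqrt (β / Real.pi) * Real.exp (-β * x ^ 2)

lemma gaussLine_pos {β : ℝ} (hβ : 0 < β) (x : ℝ) : 0 < gaussLine β x := by
  unfold gaussLine; have := Real.pi_pos; positivity

lemma continuous_gaussLine (β : ℝ) : Continuous (gaussLine β) := by
  unfold gaussLine; fun_prop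

lemma integrable_gaussLine {β : ℝ} (hβ : 0 < β) : Integrable (gaussLine β) :=
  (integrable_exp_neg_mul_sq hβ).const_mul _

lemma integral_gaussLine {β : ℝ} (hβ : 0 < β) : ∫ x, gaussLine β x = 1 := by
  unfold gaussLine
  rw [integral_const_mul, integral_gaussian, ← Real.sqrt_mul (by have := Real.pi_pos; positivity)]
  have := Real.pi_pos
  rw [show β / Real.pi * (Real.pi / β) = 1 by field_simp, Real.sqrt_one]

lemma integrable_sq_mul_gaussLine {β : ℝ} (hβ : 0 < β) :
    Integrable fun x => x ^ 2 * gaussLine β x := by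
  have := (integrable_rpow_mul_exp_neg_mul_sq hβ (s := 2) (by norm_num)).const_mul
    (Real.sqrt (β / Real.pi))
  refine this.congr (Eventually.of_forall fun x => ?_)
  simp only [gaussLine, Real.rpow_two]
  ring

/-- The pointwise estimate behind the transport proof of the logarithmic Sobolev inequality. -/
lemma bregman_le_of_transport {β c u u' x T t' : ℝ} (hβ : 0 < β) (hc : 0 < c) (hu : 0 < u)
    (ht : t' = u / c / gaussLine β T) :
    bregman u (c * gaussLine β x) ≤ (u' * (T - x) + u * (t' - 1))
      + 1 / (4 * β) * u * (2 * β * x + u' / u) ^ 2 - u + c * gaussLine β x := by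
  have hT := gaussLine_pos hβ T
  have hx := gaussLine_pos hβ x
  have ht0 : 0 < t' := by rw [ht]; positivity
  have hs : 0 < Real.sqrt (β / Real.pi) := by have := Real.pi_pos; positivity
  have h1 : Real.log (u / (c * gaussLine β x)) = Real.log t' - β * (T ^ 2 - x ^ 2) := by
    have e : u / (c * gaussLine β x) = t' * (gaussLine β T / gaussLine β x) := by
      rw [ht]; field_simp
    rw [e, Real.log_mul ht0.ne' (by positivity), Real.log_div hT.ne' hx.ne']
    unfold gaussLine
    rw [Real.log_mul hs.ne' (Real.exp_ne_zero _), Real.log_mul hs.ne' (Real.exp_ne_zero _),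
      Real.log_exp, Real.log_exp]
    ring
  have h2 := Real.log_le_sub_one_of_pos ht0
  unfold bregman
  rw [h1]
  obtain ⟨q, hq⟩ : ∃ q, q = 2 * β * x + u' / u := ⟨_, rfl⟩
  have hu' : u' = u * (q - 2 * β * x) := by rw [hq]; field_simp; ring
  rw [← hq, hu']
  -- Completing the square: `-q(T-x) - β(T-x)² ≤ q²/(4β)`. This is where the constant `1/(4β)` comes
  -- from, the quadratic gain being the remainder in `T² - x² = 2x(T-x) + (T-x)²`.
  have h3 : 0 ≤ u * (1 / (4 * β) * (q + 2 * β * (T - x)) ^ 2) := by positivity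
  have e3 : u * (1 / (4 * β) * (q + 2 * β * (T - x)) ^ 2)
      = 1 / (4 * β) * u * q ^ 2 + u * (q * (T - x)) + u * (β * (T - x) ^ 2) := by
    field_simp; ring
  have h4 := mul_le_mul_of_nonneg_left h2 hu.le
  nlinarith

/-- The logarithmic Sobolev inequality for Gaussian measures on the line. -/
theorem logSobolev_line {u u' : ℝ → ℝ} {β : ℝ} (hβ : 0 < β) (hu : ∀ x, HasDerivAt u (u' x) x)
    (hu'c : Continuous u') (h0 : ∀ x, 0 < u x) (hi : Integrable u)
    (h2 : Integrable fun x => x ^ 2 * u x) :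
    ∫⁻ x, ENNReal.ofReal (bregman (u x) ((∫ t, u t) * gaussLine β x))
      ≤ ∫⁻ x, ENNReal.ofReal (1 / (4 * β) * u x * (2 * β * x + u' x / u x) ^ 2) := by
  set c := ∫ t, u t with hc
  have huc : Continuous u := continuous_iff_continuousAt.2 fun x => (hu x).continuousAt
  have hgc := continuous_gaussLine β
  have hc0 : 0 < c := by
    rw [hc, integral_pos_iff_support_of_nonneg (fun x => (h0 x).le) hi]
    have : Function.support u = univ := by
      ext x; simp [(h0 x).ne']
    rw [this]; simp
  obtain ⟨T, hT⟩ := exists_transport (f := fun x => u x / c) (by fun_prop) (hi.div_const c)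
    (fun x => div_pos (h0 x) hc0) hgc (integrable_gaussLine hβ) (gaussLine_pos hβ)
    (by rw [integral_div, integral_gaussLine hβ, ← hc, div_self hc0.ne'])
  have hTc : Continuous T := continuous_iff_continuousAt.2 fun x => (hT x).continuousAt
  have hT'c : Continuous fun x => u x / c / gaussLine β (T x) :=
    (huc.div_const c).div (hgc.comp hTc) fun x => (gaussLine_pos hβ _).ne'
  have hTmono : Monotone T := monotone_of_hasDerivAt_nonneg hT fun x =>
    (div_pos (div_pos (h0 x) hc0) (gaussLine_pos hβ _)).le
  set R := fun x => 1 / (4 * β) * u x * (2 * β * x + u' x / u x) ^ 2 with hR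
  have hRc : Continuous R := by
    have : Continuous fun x => u' x / u x := hu'c.div huc fun x => (h0 x).ne'
    fun_prop
  have hR0 : ∀ x, 0 ≤ R x := fun x => by have := h0 x; positivity
  -- `T` pushes `u/c` to the Gaussian, so substituting `y = T x` on bounded intervals bounds this
  -- integral by `c` times the Gaussian second moment.
  have hTsq : Integrable fun x => u x * T x ^ 2 := by
    refine integrable_of_intervalIntegral_norm_bounded (μ := volume) (l := atTop)
      (a := fun n : ℕ => -(n : ℝ)) (b := fun n : ℕ => (n : ℝ))
      (c * ∫ x, x ^ 2 * gaussLine β x) (fun n => ?_)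
      (tendsto_neg_atTop_atBot.comp tendsto_natCast_atTop_atTop) tendsto_natCast_atTop_atTop
      (Eventually.of_forall fun n => ?_)
    · exact (Continuous.integrableOn_Icc (by fun_prop)).mono_set Ioc_subset_Icc_self
    · have hn : -(n : ℝ) ≤ n := by have : (0 : ℝ) ≤ n := n.cast_nonneg; linarith
      have e : ∀ x, ‖u x * T x ^ 2‖ = c * (((fun y => y ^ 2 * gaussLine β y) ∘ T) x
          * (u x / c / gaussLine β (T x))) := by
        intro x
        have := gaussLine_pos hβ (T x)
        rw [Real.norm_of_nonneg (by have := h0 x; positivity)]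
        simp only [Function.comp]
        field_simp
      simp_rw [e]
      rw [intervalIntegral.integral_const_mul,
        intervalIntegral.integral_comp_mul_deriv (fun x _ => hT x) hT'c.continuousOn (by fun_prop),
        intervalIntegral.integral_of_le (hTmono hn)]
      refine mul_le_mul_of_nonneg_left (setIntegral_le_integral (integrable_sq_mul_gaussLine hβ)
        (Eventually.of_forall fun x => ?_)) hc0.le
      have := gaussLine_pos hβ x
      positivity
  have hS : Integrable fun x => u x * |T x - x| := by
    refine ((hi.add hTsq).add h2).mono' (by fun_prop) (Eventually.of_forall fun x => ?_)
    have := h0 x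
    rw [Real.norm_of_nonneg (by positivity)]
    have h3 : |T x - x| ≤ 1 + T x ^ 2 + x ^ 2 := by
      rw [abs_le]; constructor <;> nlinarith [sq_nonneg (T x - 1), sq_nonneg (x - 1),
        sq_nonneg (T x + 1), sq_nonneg (x + 1)]
    calc u x * |T x - x| ≤ u x * (1 + T x ^ 2 + x ^ 2) := by gcongr
      _ = _ := by simp only [Pi.add_apply]; ring
  -- Adding the reflection lets one point `x` control the boundary terms at both `x` and `-x`.
  have hSs := hS.add hS.comp_neg
  have hseq : ∀ n : ℕ, ∃ x : ℝ, (n : ℝ) ≤ x ∧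
      u x * |T x - x| + u (-x) * |T (-x) - -x| < 1 / ((n : ℝ) + 1) := fun n =>
    exists_ge_lt_of_integrable hSs
      Nat.one_div_pos_of_nat n
  choose X hXn hX using hseq
  have hXtop : Tendsto X atTop atTop := tendsto_atTop_mono hXn tendsto_natCast_atTop_atTop
  have hXbot : Tendsto (fun n => -X n) atTop atBot := tendsto_neg_atTop_atBot.comp hXtop
  by_cases hRi : Integrable R
  swap
  · have : ∫⁻ x, ENNReal.ofReal (R x) = ⊤ := by
      by_contra hne
      exact hRi ((lintegral_ofReal_ne_top_iff_integrable hRc.aestronglyMeasurable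
        (Eventually.of_forall hR0)).1 hne)
    rw [this]; exact le_top
  have hBc : Continuous fun x => bregman (u x) (c * gaussLine β x) := by
    unfold bregman
    refine ((huc.mul (Continuous.log (huc.div (by fun_prop) fun x => ?_) fun x => ?_)).sub huc).add
      (by fun_prop)
    · exact (mul_pos hc0 (gaussLine_pos hβ x)).ne'
    · exact (div_pos (h0 x) (mul_pos hc0 (gaussLine_pos hβ x))).ne'
  have hB0 : ∀ x, 0 ≤ bregman (u x) (c * gaussLine β x) := fun x =>
    bregman_nonneg (h0 x) (mul_pos hc0 (gaussLine_pos hβ x))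
  have hlim := (aecover_Ioc (μ := volume) hXbot hXtop).lintegral_tendsto_of_countably_generated
    (f := fun x => ENNReal.ofReal (bregman (u x) (c * gaussLine β x)))
    hBc.measurable.ennreal_ofReal.aemeasurable
  -- Integrate the pointwise estimate over `[-X n, X n]`. Its first bracket is the derivative of `u
  -- (T - x)`, so it contributes only boundary terms, together less than `1/(n+1)`. In the limit the
  -- two mass terms `-c` and `+c` cancel.
  have hbound : ∀ n, ∫⁻ x in Ioc (-X n) (X n), ENNReal.ofReal (bregman (u x) (c * gaussLine β x))
      ≤ ENNReal.ofReal (1 / ((n : ℝ) + 1) + (∫ x, R x) - (∫ x in (-X n)..(X n), u x)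
        + c * ∫ x in (-X n)..(X n), gaussLine β x) := by
    intro n
    have hn : -X n ≤ X n := by
      have := hXn n; have : (0 : ℝ) ≤ n := n.cast_nonneg; linarith
    rw [← ofReal_integral_eq_lintegral_ofReal
      ((hBc.integrableOn_Icc).mono_set Ioc_subset_Icc_self) (Eventually.of_forall hB0),
      ← intervalIntegral.integral_of_le hn]
    apply ENNReal.ofReal_le_ofReal
    have hD : ∀ x, HasDerivAt (fun x => u x * (T x - x))
        (u' x * (T x - x) + u x * (u x / c / gaussLine β (T x) - 1)) x := fun x =>
      (hu x).mul ((hT x).sub (hasDerivAt_id x))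
    have hDc : Continuous fun x => u' x * (T x - x) + u x * (u x / c / gaussLine β (T x) - 1) := by
      fun_prop
    calc ∫ x in (-X n)..(X n), bregman (u x) (c * gaussLine β x)
        ≤ ∫ x in (-X n)..(X n), ((u' x * (T x - x) + u x * (u x / c / gaussLine β (T x) - 1))
            + R x - u x + c * gaussLine β x) := by
          refine intervalIntegral.integral_mono_on hn (hBc.intervalIntegrable _ _)
            (Continuous.intervalIntegrable (by fun_prop) _ _) fun x _ => ?_
          exact bregman_le_of_transport hβ hc0 (h0 x) rfl
      _ = (∫ x in (-X n)..(X n), (u' x * (T x - x) + u x * (u x / c / gaussLine β (T x) - 1)))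
            + (∫ x in (-X n)..(X n), R x) - (∫ x in (-X n)..(X n), u x)
            + c * ∫ x in (-X n)..(X n), gaussLine β x := by
          rw [intervalIntegral.integral_add (Continuous.intervalIntegrable (by fun_prop) _ _)
            (Continuous.intervalIntegrable (by fun_prop) _ _),
            intervalIntegral.integral_sub (Continuous.intervalIntegrable (by fun_prop) _ _)
            (Continuous.intervalIntegrable (by fun_prop) _ _),
            intervalIntegral.integral_add (Continuous.intervalIntegrable (by fun_prop) _ _)
            (Continuous.intervalIntegrable (by fun_prop) _ _), intervalIntegral.integral_const_mul]
      _ ≤ _ := by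
          rw [intervalIntegral.integral_eq_sub_of_hasDerivAt (fun x _ => hD x)
            (hDc.intervalIntegrable _ _)]
          have hx := hX n
          have b1 : u (X n) * (T (X n) - X n) ≤ u (X n) * |T (X n) - X n| :=
            mul_le_mul_of_nonneg_left (le_abs_self _) (h0 _).le
          have b2 : -(u (-X n) * (T (-X n) - -X n)) ≤ u (-X n) * |T (-X n) - -X n| := by
            rw [← mul_neg]
            exact mul_le_mul_of_nonneg_left (neg_le_abs _) (h0 _).le
          have b3 : ∫ x in (-X n)..(X n), R x ≤ ∫ x, R x := by
            rw [intervalIntegral.integral_of_le hn]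
            exact setIntegral_le_integral hRi (Eventually.of_forall hR0)
          linarith
  refine (le_of_tendsto_of_tendsto' hlim
    ((ENNReal.continuous_ofReal.tendsto _).comp
      (((tendsto_one_div_add_atTop_nhds_zero_nat.add_const (∫ x, R x)).sub
        (intervalIntegral_tendsto_integral hi hXbot hXtop)).add
        ((intervalIntegral_tendsto_integral (integrable_gaussLine hβ) hXbot hXtop).const_mul c)))
    hbound).trans ?_
  rw [integral_gaussLine hβ, ← hc, ← ofReal_integral_eq_lintegral_ofReal hRi
    (Eventually.of_forall hR0)]
  apply ENNReal.ofReal_le_ofReal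
  linarith

/-! ### Subadditivity of relative entropy -/

section Tensorization

variable {X Y : Type*} [MeasurableSpace X] [MeasurableSpace Y] {μ : Measure X} {ν : Measure Y}

lemma ofReal_le_lintegral_of_le {f h : X → ℝ} (hf : Integrable f μ) (hm : AEStronglyMeasurable h μ)
    (h0 : ∀ᵐ x ∂μ, 0 ≤ h x) (hfh : ∀ᵐ x ∂μ, f x ≤ h x) :
    ENNReal.ofReal (∫ x, f x ∂μ) ≤ ∫⁻ x, ENNReal.ofReal (h x) ∂μ := by
  by_cases hi : Integrable h μ
  · rw [← ofReal_integral_eq_lintegral_ofReal hi h0]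
    exact ENNReal.ofReal_le_ofReal (integral_mono_ae hf hi hfh)
  · have : ∫⁻ x, ENNReal.ofReal (h x) ∂μ = ⊤ := by
      by_contra hne
      exact hi ((lintegral_ofReal_ne_top_iff_integrable hm h0).1 hne)
    rw [this]; exact le_top

/-- The chain rule: changing the total mass of the reference density from `p` to `k` alters the
divergence by `log(p/k) f + (k-p) α`, which integrates to `bregman p k`. -/
lemma lintegral_bregman_le_add {f α : X → ℝ} {k : ℝ} (hfm : Measurable f) (hαm : Measurable α)
    (hf0 : ∀ x, 0 < f x) (hα0 : ∀ x, 0 < α x) (hfi : Integrable f μ) (hαi : Integrable α μ)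
    (hα1 : ∫ x, α x ∂μ = 1) (hp : 0 < ∫ x, f x ∂μ) (hk : 0 < k) :
    ∫⁻ x, ENNReal.ofReal (bregman (f x) (k * α x)) ∂μ
      ≤ ∫⁻ x, ENNReal.ofReal (bregman (f x) ((∫ t, f t ∂μ) * α x)) ∂μ
        + ENNReal.ofReal (bregman (∫ t, f t ∂μ) k) := by
  set p := ∫ t, f t ∂μ with hpd
  have hB0 : ∀ k : ℝ, 0 < k → ∀ x, 0 ≤ bregman (f x) (k * α x) := fun k hk x =>
    bregman_nonneg (hf0 x) (mul_pos hk (hα0 x))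
  have hBm : ∀ k : ℝ, AEStronglyMeasurable (fun x => bregman (f x) (k * α x)) μ := fun k =>
    (bregman_measurable hfm (hαm.const_mul k)).aestronglyMeasurable
  by_cases hi : Integrable (fun x => bregman (f x) (p * α x)) μ
  · have e : ∀ x, bregman (f x) (k * α x)
        = bregman (f x) (p * α x) + (Real.log (p / k) * f x + (k - p) * α x) := by
      intro x
      have h1 : f x / (k * α x) = (f x / (p * α x)) * (p / k) := by
        have := hα0 x; field_simp
      unfold bregman
      rw [h1, Real.log_mul (div_pos (hf0 x) (mul_pos hp (hα0 x))).ne' (div_pos hp hk).ne']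
      ring
    have hi2 : Integrable (fun x => Real.log (p / k) * f x + (k - p) * α x) μ :=
      (hfi.const_mul _).add (hαi.const_mul _)
    have hi3 : Integrable (fun x => bregman (f x) (k * α x)) μ := by
      simp_rw [e]; exact hi.add hi2
    rw [← ofReal_integral_eq_lintegral_ofReal hi3 (Eventually.of_forall (hB0 k hk)),
      ← ofReal_integral_eq_lintegral_ofReal hi (Eventually.of_forall (hB0 p hp)),
      ← ENNReal.ofReal_add (integral_nonneg (hB0 p hp)) (bregman_nonneg hp hk)]
    apply ENNReal.ofReal_le_ofReal
    simp_rw [e]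
    rw [integral_add hi hi2, integral_add (hfi.const_mul _) (hαi.const_mul _), integral_const_mul,
      integral_const_mul, hα1, ← hpd]
    unfold bregman
    linarith
  · have : ∫⁻ x, ENNReal.ofReal (bregman (f x) (p * α x)) ∂μ = ⊤ := by
      by_contra hne
      exact hi ((lintegral_ofReal_ne_top_iff_integrable (hBm p)
        (Eventually.of_forall (hB0 p hp))).1 hne)
    rw [this, top_add]; exact le_top

/-- Jensen's inequality for the jointly convex function `bregman`. -/
lemma bregman_integral_le {f q : X → ℝ} {b : ℝ} (hfm : Measurable f) (hqm : Measurable q)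
    (hf0 : ∀ x, 0 < f x) (hq0 : ∀ᵐ x ∂μ, 0 < q x) (hfi : Integrable f μ) (hqi : Integrable q μ)
    (hp : 0 < ∫ x, f x ∂μ) (hc : 0 < ∫ x, q x ∂μ) (hb : 0 < b) :
    ENNReal.ofReal (bregman (∫ x, f x ∂μ) ((∫ x, q x ∂μ) * b))
      ≤ ∫⁻ x, ENNReal.ofReal (bregman (f x) (q x * b)) ∂μ := by
  set p := ∫ x, f x ∂μ with hpd
  set c := ∫ x, q x ∂μ with hcd
  -- `r` is the slope ratio of the supporting plane at the averaged point. The affine form `log r ·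
  -- f + (b - br) q` has integral exactly `bregman p (c b)`, and it lies below the integrand because
  -- the divergence of `f` from `q b r` is nonnegative.
  set r := p / (c * b) with hr
  have hr0 : 0 < r := by positivity
  have e : bregman p (c * b) = ∫ x, (Real.log r * f x + (b - b * r) * q x) ∂μ := by
    rw [integral_add (hfi.const_mul _) (hqi.const_mul _), integral_const_mul, integral_const_mul,
      ← hpd, ← hcd]
    have : c * b * r = p := by rw [hr]; field_simp
    unfold bregman
    rw [← hr]
    linear_combination this
  rw [e]
  refine ofReal_le_lintegral_of_le ((hfi.const_mul _).add (hqi.const_mul _))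
    (bregman_measurable hfm (hqm.mul_const b)).aestronglyMeasurable ?_ ?_
  · filter_upwards [hq0] with x hx using bregman_nonneg (hf0 x) (mul_pos hx hb)
  · filter_upwards [hq0] with x hx
    have h1 := bregman_nonneg (hf0 x) (mul_pos (mul_pos hx hb) hr0)
    unfold bregman at h1 ⊢
    rw [← div_div, Real.log_div (div_pos (hf0 x) (mul_pos hx hb)).ne' hr0.ne'] at h1
    linarith

lemma integral_pos_of_pos {f : X → ℝ} (hμ : μ ≠ 0) (hf0 : ∀ x, 0 < f x) (hfi : Integrable f μ) :
    0 < ∫ x, f x ∂μ := by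
  rw [integral_pos_iff_support_of_nonneg (fun x => (hf0 x).le) hfi]
  have : Function.support f = univ := by
    ext x; simp [(hf0 x).ne']
  rw [this]
  exact Measure.measure_univ_pos.2 hμ

/-- Subadditivity of the relative entropy with respect to product densities. -/
theorem lintegral_bregman_prod_le [SFinite μ] [SFinite ν] {f : X × Y → ℝ} {α : X → ℝ} {β : Y → ℝ}
    (hfm : Measurable f) (hαm : Measurable α) (hβm : Measurable β)
    (hf0 : ∀ x, 0 < f x) (hα0 : ∀ x, 0 < α x) (hβ0 : ∀ x, 0 < β x)
    (hfi : Integrable f (μ.prod ν)) (hαi : Integrable α μ)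
    (hα1 : ∫ x, α x ∂μ = 1) (hβ1 : ∫ x, β x ∂ν = 1) :
    ∫⁻ z, ENNReal.ofReal (bregman (f z) ((∫ t, f t ∂(μ.prod ν)) * (α z.1 * β z.2))) ∂(μ.prod ν)
      ≤ ∫⁻ y, ∫⁻ x, ENNReal.ofReal (bregman (f (x, y)) ((∫ t, f (t, y) ∂μ) * α x)) ∂μ ∂ν
        + ∫⁻ x, ∫⁻ y, ENNReal.ofReal (bregman (f (x, y)) ((∫ t, f (x, t) ∂ν) * β y)) ∂ν ∂μ := by
  have hμ : μ ≠ 0 := by rintro rfl; simp at hα1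
  have hν : ν ≠ 0 := by rintro rfl; simp at hβ1
  set c := ∫ t, f t ∂(μ.prod ν) with hc
  have hpm : Measurable fun y => ∫ t, f (t, y) ∂μ :=
    (hfm.stronglyMeasurable.integral_prod_left' (μ := μ)).measurable
  have hqm : Measurable fun x => ∫ t, f (x, t) ∂ν :=
    (hfm.stronglyMeasurable.integral_prod_right' (ν := ν)).measurable
  have hqi : Integrable (fun x => ∫ t, f (x, t) ∂ν) μ := hfi.integral_prod_left
  have hq1 : ∫ x, ∫ t, f (x, t) ∂ν ∂μ = c := (integral_prod _ hfi).symm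
  have hq0 : ∀ᵐ x ∂μ, 0 < ∫ t, f (x, t) ∂ν := by
    filter_upwards [hfi.prod_right_ae] with x hx
    exact integral_pos_of_pos hν (fun y => hf0 (x, y)) hx
  have hne : μ.prod ν ≠ 0 := by
    rw [← Measure.measure_univ_ne_zero, ← univ_prod_univ, Measure.prod_prod]
    exact mul_ne_zero (Measure.measure_univ_ne_zero.2 hμ) (Measure.measure_univ_ne_zero.2 hν)
  have hc0 : 0 < c := integral_pos_of_pos hne hf0 hfi
  have m1 : Measurable fun z : X × Y =>
      ENNReal.ofReal (bregman (f z) (c * (α z.1 * β z.2))) :=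
    (bregman_measurable hfm (by fun_prop)).ennreal_ofReal
  have m2 : Measurable fun z : X × Y =>
      ENNReal.ofReal (bregman (f z) ((∫ t, f (t, z.2) ∂μ) * α z.1)) :=
    (bregman_measurable hfm ((hpm.comp measurable_snd).mul
      (hαm.comp measurable_fst))).ennreal_ofReal
  have m3 : Measurable fun z : X × Y =>
      ENNReal.ofReal (bregman (f z) ((∫ t, f (z.1, t) ∂ν) * β z.2)) :=
    (bregman_measurable hfm ((hqm.comp measurable_fst).mul
      (hβm.comp measurable_snd))).ennreal_ofReal
  rw [lintegral_prod_symm' _ m1, lintegral_lintegral_swap (μ := μ) (ν := ν)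
    (f := fun x y => ENNReal.ofReal (bregman (f (x, y)) ((∫ t, f (x, t) ∂ν) * β y)))
    m3.aemeasurable, ← lintegral_add_left m2.lintegral_prod_left']
  apply lintegral_mono_ae
  filter_upwards [hfi.prod_left_ae] with y hy
  have hp0 : 0 < ∫ t, f (t, y) ∂μ := integral_pos_of_pos hμ (fun x => hf0 (x, y)) hy
  have hfy : Measurable fun x => f (x, y) := hfm.comp (by fun_prop)
  -- At fixed `y`, the chain rule splits off the divergence of the marginal `p(y)` from `c β(y)`.
  -- Jensen bounds that by the average over `x` of the divergence of `f(x,y)` from `q(x) β(y)`,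
  -- which is the second term of the claim.
  have h1 := lintegral_bregman_le_add hfy hαm (fun x => hf0 (x, y)) hα0 hy hαi hα1 hp0
    (mul_pos hc0 (hβ0 y))
  have h2 := bregman_integral_le hfy hqm (fun x => hf0 (x, y)) hq0 hy hqi hp0
    (by rw [hq1]; exact hc0) (hβ0 y)
  rw [hq1] at h2
  calc _ = ∫⁻ x, ENNReal.ofReal (bregman (f (x, y)) (c * β y * α x)) ∂μ := by
        congr 1 with x; congr 2; ring
    _ ≤ _ := h1
    _ ≤ _ := by gcongr

end Tensorization

/-! ### Logarithmic Sobolev inequality in three dimensions -/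

/-- The logarithmic Sobolev inequality for Gaussian measures on `ℝ × ℝ × ℝ`. -/
theorem logSobolev_prod {f d₁ d₂ d₃ : ℝ × ℝ × ℝ → ℝ} {β : ℝ} (hβ : 0 < β) (hf : Continuous f)
    (hc₁ : Continuous d₁) (hc₂ : Continuous d₂) (hc₃ : Continuous d₃)
    (hd₁ : ∀ x y z, HasDerivAt (fun t => f (t, y, z)) (d₁ (x, y, z)) x)
    (hd₂ : ∀ x y z, HasDerivAt (fun t => f (x, t, z)) (d₂ (x, y, z)) y)
    (hd₃ : ∀ x y z, HasDerivAt (fun t => f (x, y, t)) (d₃ (x, y, z)) z)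
    (h0 : ∀ p, 0 < f p) (hi : Integrable f) (hi₁ : Integrable fun p => p.1 ^ 2 * f p)
    (hi₂ : Integrable fun p => p.2.1 ^ 2 * f p) (hi₃ : Integrable fun p => p.2.2 ^ 2 * f p) :
    ∫⁻ p, ENNReal.ofReal (bregman (f p)
        ((∫ t, f t) * (gaussLine β p.1 * (gaussLine β p.2.1 * gaussLine β p.2.2))))
      ≤ ∫⁻ p, ENNReal.ofReal (1 / (4 * β) * f p * ((2 * β * p.1 + d₁ p / f p) ^ 2
        + (2 * β * p.2.1 + d₂ p / f p) ^ 2 + (2 * β * p.2.2 + d₃ p / f p) ^ 2)) := by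
  have hg := continuous_gaussLine β
  have hgm := hg.measurable
  have hg0 := gaussLine_pos hβ
  have hgi := integrable_gaussLine hβ
  have hg1 := integral_gaussLine hβ
  have hnn : ∀ (s : ℝ) (p : ℝ × ℝ × ℝ), 0 ≤ 1 / (4 * β) * f p * s ^ 2 := fun s p => by
    have := h0 p; positivity
  have hq : ∀ d : ℝ × ℝ × ℝ → ℝ, Continuous d → Continuous fun p => d p / f p := fun d hd =>
    hd.div hf fun p => (h0 p).ne'
  have hq₁ := hq _ hc₁
  have hq₂ := hq _ hc₂
  have hq₃ := hq _ hc₃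
  have m₁ : Measurable fun p : ℝ × ℝ × ℝ =>
      ENNReal.ofReal (1 / (4 * β) * f p * (2 * β * p.1 + d₁ p / f p) ^ 2) :=
    (Continuous.measurable (by fun_prop)).ennreal_ofReal
  have m₂ : Measurable fun p : ℝ × ℝ × ℝ =>
      ENNReal.ofReal (1 / (4 * β) * f p * (2 * β * p.2.1 + d₂ p / f p) ^ 2) :=
    (Continuous.measurable (by fun_prop)).ennreal_ofReal
  have m₃ : Measurable fun p : ℝ × ℝ × ℝ =>
      ENNReal.ofReal (1 / (4 * β) * f p * (2 * β * p.2.2 + d₃ p / f p) ^ 2) :=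
    (Continuous.measurable (by fun_prop)).ennreal_ofReal
  have split : ∫⁻ p, ENNReal.ofReal (1 / (4 * β) * f p * ((2 * β * p.1 + d₁ p / f p) ^ 2
        + (2 * β * p.2.1 + d₂ p / f p) ^ 2 + (2 * β * p.2.2 + d₃ p / f p) ^ 2))
      = (∫⁻ p : ℝ × ℝ × ℝ, ENNReal.ofReal (1 / (4 * β) * f p * (2 * β * p.1 + d₁ p / f p) ^ 2))
      + ((∫⁻ p : ℝ × ℝ × ℝ, ENNReal.ofReal (1 / (4 * β) * f p * (2 * β * p.2.1 + d₂ p / f p) ^ 2))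
      + ∫⁻ p : ℝ × ℝ × ℝ,
          ENNReal.ofReal (1 / (4 * β) * f p * (2 * β * p.2.2 + d₃ p / f p) ^ 2)) := by
    rw [← lintegral_add_left m₂, ← lintegral_add_left m₁]
    congr 1 with p
    rw [mul_add, mul_add, ENNReal.ofReal_add (add_nonneg (hnn _ p) (hnn _ p)) (hnn _ p),
      ENNReal.ofReal_add (hnn _ p) (hnn _ p), add_assoc]
  have hβ2 : ∫ w : ℝ × ℝ, gaussLine β w.1 * gaussLine β w.2 = 1 := by
    have := integral_prod_mul (μ := volume) (ν := volume) (gaussLine β) (gaussLine β)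
    rw [hg1, one_mul] at this
    exact this
  have step := lintegral_bregman_prod_le (μ := volume) (ν := (volume : Measure (ℝ × ℝ)))
    (f := f) (α := gaussLine β) (β := fun w => gaussLine β w.1 * gaussLine β w.2)
    hf.measurable hgm (by fun_prop) h0 hg0 (fun w => mul_pos (hg0 _) (hg0 _)) hi hgi hg1 hβ2
  rw [split]
  refine step.trans (add_le_add ?_ ?_)
  · calc _ ≤ ∫⁻ w : ℝ × ℝ, ∫⁻ x, ENNReal.ofReal
          (1 / (4 * β) * f (x, w) * (2 * β * x + d₁ (x, w) / f (x, w)) ^ 2) := by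
          apply lintegral_mono_ae
          filter_upwards [Integrable.prod_left_ae (μ := volume) (ν := (volume : Measure (ℝ × ℝ))) hi,
            Integrable.prod_left_ae (μ := volume) (ν := (volume : Measure (ℝ × ℝ))) hi₁] with w h1 h2
          exact logSobolev_line (u := fun x => f (x, w)) (u' := fun x => d₁ (x, w)) hβ
            (fun x => hd₁ x w.1 w.2) (by fun_prop) (fun x => h0 _) h1 h2
      _ = _ := (lintegral_prod_symm' (μ := volume) (ν := (volume : Measure (ℝ × ℝ))) _ m₁).symm
  · have hh₂ : ∀ᵐ x : ℝ, ∀ᵐ z : ℝ, Integrable (fun y => f (x, y, z)) ∧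
        Integrable fun y => y ^ 2 * f (x, y, z) := by
      filter_upwards [Integrable.prod_right_ae (μ := volume) (ν := (volume : Measure (ℝ × ℝ))) hi,
        Integrable.prod_right_ae (μ := volume) (ν := (volume : Measure (ℝ × ℝ))) hi₂] with x h1 h2
      filter_upwards [Integrable.prod_left_ae (μ := volume) (ν := (volume : Measure ℝ)) h1,
        Integrable.prod_left_ae (μ := volume) (ν := (volume : Measure ℝ)) h2] with z h3 h4
      exact ⟨h3, h4⟩
    have hh₃ : ∀ᵐ x : ℝ, ∀ᵐ y : ℝ, Integrable (fun z => f (x, y, z)) ∧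
        Integrable fun z => z ^ 2 * f (x, y, z) := by
      filter_upwards [Integrable.prod_right_ae (μ := volume) (ν := (volume : Measure (ℝ × ℝ))) hi,
        Integrable.prod_right_ae (μ := volume) (ν := (volume : Measure (ℝ × ℝ))) hi₃] with x h1 h2
      filter_upwards [Integrable.prod_right_ae (μ := volume) (ν := (volume : Measure ℝ)) h1,
        Integrable.prod_right_ae (μ := volume) (ν := (volume : Measure ℝ)) h2] with z h3 h4
      exact ⟨h3, h4⟩
    have e₂ := lintegral_prod (μ := volume) (ν := (volume : Measure (ℝ × ℝ))) _ m₂.aemeasurable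
    have e₃ := lintegral_prod (μ := volume) (ν := (volume : Measure (ℝ × ℝ))) _ m₃.aemeasurable
    rw [Measure.volume_eq_prod ℝ (ℝ × ℝ), e₂, e₃, ← lintegral_add_left m₂.lintegral_prod_right']
    apply lintegral_mono_ae
    filter_upwards [Integrable.prod_right_ae (μ := volume) (ν := (volume : Measure (ℝ × ℝ))) hi,
      hh₂, hh₃] with x hx h₂ h₃
    -- Second splitting, inside the slice at fixed `x`, so that each coordinate is treated
    -- separately.
    have step2 := lintegral_bregman_prod_le (μ := volume) (ν := (volume : Measure ℝ))
      (f := fun w => f (x, w)) (α := gaussLine β) (β := gaussLine β)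
      (Continuous.measurable (by fun_prop)) hgm hgm (fun w => h0 _) hg0 hg0 hx hgi hg1 hg1
    refine step2.trans (add_le_add ?_ ?_)
    · calc _ ≤ ∫⁻ z : ℝ, ∫⁻ y : ℝ, ENNReal.ofReal
            (1 / (4 * β) * f (x, y, z) * (2 * β * y + d₂ (x, y, z) / f (x, y, z)) ^ 2) := by
            apply lintegral_mono_ae
            filter_upwards [h₂] with z hz
            exact logSobolev_line (u := fun y => f (x, y, z)) (u' := fun y => d₂ (x, y, z)) hβ
              (fun y => hd₂ x y z) (by fun_prop) (fun y => h0 _) hz.1 hz.2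
        _ = _ := (lintegral_prod_symm' (μ := volume) (ν := (volume : Measure ℝ)) _
            (m₂.comp (measurable_prodMk_left (x := x)))).symm
    · calc _ ≤ ∫⁻ y : ℝ, ∫⁻ z : ℝ, ENNReal.ofReal
            (1 / (4 * β) * f (x, y, z) * (2 * β * z + d₃ (x, y, z) / f (x, y, z)) ^ 2) := by
            apply lintegral_mono_ae
            filter_upwards [h₃] with y hy
            exact logSobolev_line (u := fun z => f (x, y, z)) (u' := fun z => d₃ (x, y, z)) hβ
              (fun z => hd₃ x y z) (by fun_prop) (fun z => h0 _) hy.1 hy.2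
        _ = _ := (lintegral_prod (μ := volume) (ν := (volume : Measure ℝ)) _
            (m₃.comp (measurable_prodMk_left (x := x))).aemeasurable).symm

/-- The point of `Vel` with given coordinates. -/
def ofCoords (p : ℝ × ℝ × ℝ) : Vel := !₂[p.1, p.2.1, p.2.2]

/-- Coordinates as a measurable equivalence. -/
def coordsEquiv : ℝ × ℝ × ℝ ≃ᵐ Vel :=
  (((MeasurableEquiv.refl ℝ).prodCongr (MeasurableEquiv.finTwoArrow (α := ℝ)).symm).trans
    (MeasurableEquiv.piFinSuccAbove (fun _ : Fin 3 => ℝ) 0).symm).trans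
    (MeasurableEquiv.toLp 2 (Fin 3 → ℝ))

lemma coordsEquiv_apply (p : ℝ × ℝ × ℝ) : coordsEquiv p = ofCoords p := by
  ext i
  fin_cases i <;> rfl

lemma measurePreserving_ofCoords : MeasurePreserving ofCoords := by
  have h1 : MeasurePreserving (MeasurableEquiv.finTwoArrow (α := ℝ)).symm :=
    (volume_preserving_finTwoArrow ℝ).symm _
  have h2 := (volume_preserving_piFinSuccAbove (fun _ : Fin 3 => ℝ) 0).symm _
  have h3 := (PiLp.volume_preserving_toLp (Fin 3))
  have h := h3.comp (h2.comp ((MeasurePreserving.id (volume : Measure ℝ)).prod h1))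
  have e : ofCoords = (@WithLp.toLp 2 (Fin 3 → ℝ)) ∘
      ((MeasurableEquiv.piFinSuccAbove (fun _ : Fin 3 => ℝ) 0).symm ∘
        Prod.map id (MeasurableEquiv.finTwoArrow (α := ℝ)).symm) := by
    funext p
    ext i
    fin_cases i <;> rfl
  rw [e]
  exact h

lemma measurableEmbedding_ofCoords : MeasurableEmbedding ofCoords := by
  have : ofCoords = coordsEquiv := (funext coordsEquiv_apply).symm
  rw [this]
  exact coordsEquiv.measurableEmbedding

lemma continuous_ofCoords : Continuous ofCoords := by
  unfold ofCoords
  refine (PiLp.continuous_toLp 2 _).comp (continuous_pi fun i => ?_)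
  fin_cases i <;> simp <;> fun_prop

lemma norm_sq_ofCoords (p : ℝ × ℝ × ℝ) :
    ‖ofCoords p‖ ^ 2 = p.1 ^ 2 + p.2.1 ^ 2 + p.2.2 ^ 2 := by
  rw [EuclideanSpace.real_norm_sq_eq, Fin.sum_univ_three]
  rfl

lemma hasDerivAt_line {u : Vel → ℝ} (hu : ContDiff ℝ 1 u) {l : ℝ → Vel} {i : Fin 3} {t : ℝ}
    (hl : ∀ s, l s = l t + (s - t) • EuclideanSpace.single i (1 : ℝ)) :
    HasDerivAt (fun s => u (l s)) (gradient u (l t) i) t := by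
  have h1 : HasDerivAt l (EuclideanSpace.single i (1 : ℝ)) t := by
    have : HasDerivAt (fun s => l t + (s - t) • EuclideanSpace.single i (1 : ℝ))
        ((1 : ℝ) • EuclideanSpace.single i (1 : ℝ)) t :=
      (((hasDerivAt_id t).sub_const t).smul_const _).const_add _
    rw [one_smul] at this
    exact this.congr_of_eventuallyEq (Eventually.of_forall hl)
  have h2 := ((hu.differentiable one_ne_zero) (l t)).hasFDerivAt.comp_hasDerivAt t h1
  have e : fderiv ℝ u (l t) (EuclideanSpace.single i (1 : ℝ)) = gradient u (l t) i := by
    rw [← inner_gradient_left, EuclideanSpace.inner_single_right]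
    simp
  rwa [e] at h2

lemma continuous_gradient {u : Vel → ℝ} (hu : ContDiff ℝ 1 u) : Continuous (gradient u) :=
  (InnerProductSpace.toDual ℝ Vel).symm.continuous.comp (hu.continuous_fderiv one_ne_zero)

/-- The logarithmic Sobolev inequality for isotropic Gaussian measures on `Vel`. -/
theorem logSobolev {u : Vel → ℝ} {β : ℝ} (hβ : 0 < β) (hu : ContDiff ℝ 1 u) (h0 : ∀ v, 0 < u v)
    (hi : Integrable u) (h2 : Integrable fun v => u v * ‖v‖ ^ 2) :
    ∃ A : ℝ, 0 < A ∧ ∫⁻ v, ENNReal.ofReal (bregman (u v) (gauss A β v))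
      ≤ ∫⁻ v, ENNReal.ofReal
        (1 / (4 * β) * u v * ‖(2 * β) • v + (u v)⁻¹ • gradient u v‖ ^ 2) := by
  have hmp := measurePreserving_ofCoords
  have hme := measurableEmbedding_ofCoords
  have hcont := continuous_ofCoords
  have hgc := continuous_gradient hu
  have hc0 : 0 < ∫ v, u v := integral_pos_of_pos (NeZero.ne _) h0 hi
  have hs : 0 < Real.sqrt (β / Real.pi) := by have := Real.pi_pos; positivity
  have hcoord : ∀ i : Fin 3, Continuous fun p => gradient u (ofCoords p) i := fun i =>
    (PiLp.continuous_apply 2 _ i).comp (hgc.comp hcont)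
  have hi' : Integrable fun p => u (ofCoords p) := hmp.integrable_comp_of_integrable hi
  have h2' : Integrable fun p => u (ofCoords p) * ‖ofCoords p‖ ^ 2 :=
    hmp.integrable_comp_of_integrable h2
  have hsq : ∀ s : ℝ × ℝ × ℝ → ℝ, Continuous s → (∀ p, s p ^ 2 ≤ ‖ofCoords p‖ ^ 2) →
      Integrable fun p => s p ^ 2 * u (ofCoords p) := by
    intro s hsc hsn
    have huc := hu.continuous.comp hcont
    refine h2'.mono' ((hsc.pow 2).mul huc).aestronglyMeasurable (Eventually.of_forall fun p => ?_)
    have := h0 (ofCoords p)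
    rw [Real.norm_of_nonneg (by positivity), mul_comm]
    exact mul_le_mul_of_nonneg_left (hsn p) this.le
  have main := logSobolev_prod (f := fun p => u (ofCoords p))
    (d₁ := fun p => gradient u (ofCoords p) 0) (d₂ := fun p => gradient u (ofCoords p) 1)
    (d₃ := fun p => gradient u (ofCoords p) 2) hβ (hu.continuous.comp hcont)
    (hcoord 0) (hcoord 1) (hcoord 2)
    (fun x y z => hasDerivAt_line hu (l := fun t => ofCoords (t, y, z)) fun s => by
      ext i; fin_cases i <;> simp [ofCoords])
    (fun x y z => hasDerivAt_line hu (l := fun t => ofCoords (x, t, z)) fun s => by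
      ext i; fin_cases i <;> simp [ofCoords])
    (fun x y z => hasDerivAt_line hu (l := fun t => ofCoords (x, y, t)) fun s => by
      ext i; fin_cases i <;> simp [ofCoords])
    (fun p => h0 _) hi'
    (hsq _ (by fun_prop) fun p => by rw [norm_sq_ofCoords]; nlinarith [sq_nonneg p.2.1, sq_nonneg p.2.2])
    (hsq _ (by fun_prop) fun p => by rw [norm_sq_ofCoords]; nlinarith [sq_nonneg p.1, sq_nonneg p.2.2])
    (hsq _ (by fun_prop) fun p => by rw [norm_sq_ofCoords]; nlinarith [sq_nonneg p.1, sq_nonneg p.2.1])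
  -- The amplitude that gives the Gaussian the mass of `u`: three one-dimensional normalizing
  -- factors times `∫ u`.
  refine ⟨(∫ v, u v) * Real.sqrt (β / Real.pi) ^ 3, by positivity, ?_⟩
  rw [← hmp.lintegral_comp_emb hme, ← hmp.lintegral_comp_emb hme]
  rw [hmp.integral_comp hme u] at main
  refine le_of_eq_of_le (lintegral_congr fun p => ?_) (main.trans_eq (lintegral_congr fun p => ?_))
  · congr 2
    simp only [gauss, gaussLine, norm_sq_ofCoords]
    rw [show -β * (p.1 ^ 2 + p.2.1 ^ 2 + p.2.2 ^ 2) = -β * p.1 ^ 2 + (-β * p.2.1 ^ 2 + -β * p.2.2 ^ 2)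
      by ring, Real.exp_add, Real.exp_add]
    ring
  · congr 2
    rw [EuclideanSpace.real_norm_sq_eq, Fin.sum_univ_three]
    simp [ofCoords, div_eq_inv_mul]

/-! ### Testing the entropy production with linear functions -/

/-- Rescaling one bump to radius `n+1` makes the gradient of order `1/n` on a ball of radius
`2(n+1)`. Hence `(1+|w|)|∇χ|` stays bounded, as is needed when `χ` truncates a function of linear
growth. -/
lemma exists_cutoff : ∃ (χ : ℕ → Vel → ℝ) (C : ℝ), (∀ n, ContDiff ℝ 1 (χ n)) ∧
    (∀ n, HasCompactSupport (χ n)) ∧ (∀ n w, 0 ≤ χ n w) ∧ (∀ n w, χ n w ≤ 1) ∧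
    (∀ w, Tendsto (fun n => χ n w) atTop (𝓝 1)) ∧
    (∀ w e, Tendsto (fun n => fderiv ℝ (χ n) w e) atTop (𝓝 0)) ∧
    ∀ n w e, (1 + ‖w‖) * |fderiv ℝ (χ n) w e| ≤ C * ‖e‖ := by
  let f : ContDiffBump (0 : Vel) := ⟨1, 2, one_pos, one_lt_two⟩
  have hf : ContDiff ℝ 1 f := f.contDiff
  have hfc : Continuous (fderiv ℝ f) := hf.continuous_fderiv one_ne_zero
  obtain ⟨B, hB⟩ := (f.hasCompactSupport.fderiv (𝕜 := ℝ)).exists_bound_of_continuous hfc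
  have hB0 : 0 ≤ B := (norm_nonneg _).trans (hB 0)
  have hpos : ∀ n : ℕ, 0 < ((n : ℝ) + 1)⁻¹ := fun n => by positivity
  have hd : ∀ (n : ℕ) (w e : Vel), fderiv ℝ (fun w => f (((n : ℝ) + 1)⁻¹ • w)) w e
      = ((n : ℝ) + 1)⁻¹ * fderiv ℝ f (((n : ℝ) + 1)⁻¹ • w) e := by
    intro n w e
    have h1 : HasFDerivAt (fun w : Vel => ((n : ℝ) + 1)⁻¹ • w)
        (((n : ℝ) + 1)⁻¹ • ContinuousLinearMap.id ℝ Vel) w :=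
      (((n : ℝ) + 1)⁻¹ • ContinuousLinearMap.id ℝ Vel).hasFDerivAt
    have h2 := ((hf.differentiable one_ne_zero) (((n : ℝ) + 1)⁻¹ • w)).hasFDerivAt.comp w h1
    have h3 := h2.fderiv
    simp only [Function.comp_def] at h3
    rw [h3]
    simp
  have hev : ∀ w : Vel, ∀ᶠ n : ℕ in atTop, ‖w‖ < (n : ℝ) + 1 := fun w => by
    filter_upwards [tendsto_natCast_atTop_atTop.eventually (eventually_ge_atTop ‖w‖)] with n hn
    linarith
  have hball : ∀ (n : ℕ) (w : Vel), ‖w‖ < (n : ℝ) + 1 →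
      f =ᶠ[𝓝 (((n : ℝ) + 1)⁻¹ • w)] 1 := by
    intro n w hw
    apply f.eventuallyEq_one_of_mem_ball
    rw [mem_ball_zero_iff, norm_smul, Real.norm_of_nonneg (hpos n).le, inv_mul_lt_iff₀ (by positivity)]
    simpa [f] using hw
  -- The factor 3 comes from `1 + |w| ≤ 1 + 2(n+1) ≤ 3(n+1)` on the support, and `B` bounds the
  -- gradient of the original bump.
  refine ⟨fun n w => f (((n : ℝ) + 1)⁻¹ • w), 3 * B, fun n => hf.comp (contDiff_const_smul _),
    fun n => f.hasCompactSupport.comp_smul (hpos n).ne', fun n w => f.nonneg, fun n w => f.le_one,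
    fun w => ?_, fun w e => ?_, fun n w e => ?_⟩
  · refine tendsto_const_nhds.congr' ?_
    filter_upwards [hev w] with n hn using ((hball n w hn).eq_of_nhds).symm
  · refine tendsto_const_nhds.congr' ?_
    filter_upwards [hev w] with n hn
    rw [hd, (hball n w hn).fderiv_eq, Pi.one_def]
    simp
  · rw [hd, abs_mul, abs_of_pos (hpos n)]
    by_cases hw : ‖((n : ℝ) + 1)⁻¹ • w‖ ≤ 2
    · rw [norm_smul, Real.norm_of_nonneg (hpos n).le, inv_mul_le_iff₀ (by positivity)] at hw
      have h1 : |fderiv ℝ f (((n : ℝ) + 1)⁻¹ • w) e| ≤ B * ‖e‖ :=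
        ((fderiv ℝ f _).le_opNorm e).trans (by gcongr; exact hB _)
      have h2 : (1 + ‖w‖) * ((n : ℝ) + 1)⁻¹ ≤ 3 := by
        rw [mul_inv_le_iff₀ (by positivity)]
        have : (0 : ℝ) ≤ n := n.cast_nonneg
        linarith
      calc (1 + ‖w‖) * (((n : ℝ) + 1)⁻¹ * |fderiv ℝ f (((n : ℝ) + 1)⁻¹ • w) e|)
          = ((1 + ‖w‖) * ((n : ℝ) + 1)⁻¹) * |fderiv ℝ f (((n : ℝ) + 1)⁻¹ • w) e| := by ring
        _ ≤ 3 * (B * ‖e‖) := by gcongr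
        _ = _ := by ring
    · have : fderiv ℝ f (((n : ℝ) + 1)⁻¹ • w) = 0 := by
        have h1 : ((n : ℝ) + 1)⁻¹ • w ∉ tsupport (fderiv ℝ f) := fun h => hw (by
          have := tsupport_fderiv_subset ℝ h
          rw [f.tsupport_eq] at this
          simpa using this)
        exact image_eq_zero_of_notMem_tsupport h1
      rw [this]
      simp only [zero_apply, abs_zero, mul_zero]
      positivity

/-- The component of `z ∧ y` along `a ∧ b`. -/
def wedge (a b z y : Vel) : ℝ := inner ℝ z a * inner ℝ y b - inner ℝ z b * inner ℝ y a

/-- The quantity is the pairing of `y` with `x = (z·a) b - (z·b) a`. This `x` is orthogonal to `z`,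
so it sees only the projection of `y`, and `|x| ≤ |z|` by Bessel's inequality. -/
lemma wedge_sq_le {a b : Vel} (ha : ‖a‖ = 1) (hb : ‖b‖ = 1) (hab : inner ℝ a b = 0) (z y : Vel) :
    wedge a b z y ^ 2 ≤ ‖z‖ ^ 2 * ‖projPerp z y‖ ^ 2 := by
  have hba : inner ℝ b a = 0 := by rw [real_inner_comm]; exact hab
  have haa : inner ℝ a a = 1 := by rw [real_inner_self_eq_norm_sq, ha]; norm_num
  have hbb : inner ℝ b b = 1 := by rw [real_inner_self_eq_norm_sq, hb]; norm_num
  set x := inner ℝ z a • b - inner ℝ z b • a with hx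
  have hxx : ‖x‖ ^ 2 = inner ℝ z a ^ 2 + inner ℝ z b ^ 2 := by
    rw [← real_inner_self_eq_norm_sq, hx]
    simp only [inner_sub_left, inner_sub_right, real_inner_smul_left, real_inner_smul_right,
      haa, hbb, hab, hba]
    ring
  have hz : ‖x‖ ^ 2 ≤ ‖z‖ ^ 2 := by
    have h : 0 ≤ ‖z - inner ℝ z a • a - inner ℝ z b • b‖ ^ 2 := sq_nonneg _
    rw [← real_inner_self_eq_norm_sq] at h
    simp only [inner_sub_left, inner_sub_right, real_inner_smul_left, real_inner_smul_right,
      haa, hbb, hab, hba, real_inner_comm z a, real_inner_comm z b,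
      real_inner_self_eq_norm_sq z] at h
    rw [hxx]
    simp only [real_inner_comm a z, real_inner_comm b z] at h ⊢
    nlinarith
  have hw : wedge a b z y = inner ℝ x (projPerp z y) := by
    have h0 : inner ℝ x z = 0 := by
      rw [hx, inner_sub_left, real_inner_smul_left, real_inner_smul_left, real_inner_comm z b,
        real_inner_comm z a]
      ring
    unfold projPerp
    rw [inner_sub_right, real_inner_smul_right, h0, mul_zero, sub_zero, hx, inner_sub_left,
      real_inner_smul_left, real_inner_smul_left, real_inner_comm y b, real_inner_comm y a]
    rfl
  rw [hw, ← sq_abs]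
  calc |inner ℝ x (projPerp z y)| ^ 2 ≤ (‖x‖ * ‖projPerp z y‖) ^ 2 := by
        gcongr; exact abs_real_inner_le_norm _ _
    _ = ‖x‖ ^ 2 * ‖projPerp z y‖ ^ 2 := by ring
    _ ≤ _ := by gcongr

lemma continuous_wedge (a b : Vel) : Continuous fun p : Vel × Vel => wedge a b p.1 p.2 := by
  unfold wedge; fun_prop

lemma wedge_zero (a b y : Vel) : wedge a b 0 y = 0 := by simp [wedge]

/-- The density `g (1 - ε g)`. -/
def fermiDensity (ε : ℝ) (g : Vel → ℝ) (v : Vel) : ℝ := g v * (1 - ε * g v)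

/-- The gradient of `log (g / (1 - ε g))`. -/
def scoreField (ε : ℝ) (g : Vel → ℝ) (v : Vel) : Vel := (g v * (1 - ε * g v))⁻¹ • gradient g v

section Dissipation

variable {ε γ : ℝ} {g : Vel → ℝ}

lemma fermiDensity_pos (h0 : ∀ v, 0 < g v) (h1 : ∀ v, ε * g v < 1) (v : Vel) :
    0 < fermiDensity ε g v := mul_pos (h0 v) (by linarith [h1 v])

lemma continuous_fermiDensity (hg : ContDiff ℝ 1 g) : Continuous (fermiDensity ε g) := by
  have := hg.continuous
  unfold fermiDensity; fun_prop

lemma continuous_scoreField (hg : ContDiff ℝ 1 g) (h0 : ∀ v, 0 < g v) (h1 : ∀ v, ε * g v < 1) :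
    Continuous (scoreField ε g) :=
  ((continuous_fermiDensity hg).inv₀ fun v => (fermiDensity_pos h0 h1 v).ne').smul
    (continuous_gradient hg)

/-- The weight cancels the denominator of the score, so the integration by parts falls on `g` itself
and brings in its known mass and momentum. -/
lemma fermiDensity_mul_inner_scoreField (h0 : ∀ v, 0 < g v) (h1 : ∀ v, ε * g v < 1) (v e : Vel) :
    fermiDensity ε g v * inner ℝ (scoreField ε g v) e = fderiv ℝ g v e := by
  have := (fermiDensity_pos h0 h1 v).ne'
  unfold scoreField
  rw [real_inner_smul_left, inner_gradient_left]
  unfold fermiDensity at *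
  rw [← mul_assoc, mul_inv_cancel₀ this, one_mul]

/-- With `v` frozen, only the score at `w` is integrated by parts. The derivative along `b` meets
the factor `(v-w)·a` and conversely, so orthogonality of `a` and `b` leaves derivatives of `φ`
alone. -/
lemma integral_wedge_eq (hg : ContDiff ℝ 1 g) (h0 : ∀ v, 0 < g v) (h1 : ∀ v, ε * g v < 1)
    {a b : Vel} (hab : inner ℝ a b = 0) {φ : Vel → ℝ} (hφ : ContDiff ℝ 1 φ)
    (hφc : HasCompactSupport φ) (v : Vel) :
    ∫ w, fermiDensity ε g w * φ w * wedge a b (v - w) (scoreField ε g v - scoreField ε g w)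
      = inner ℝ (scoreField ε g v) b * (∫ w, fermiDensity ε g w * φ w * inner ℝ (v - w) a)
        - inner ℝ (scoreField ε g v) a * (∫ w, fermiDensity ε g w * φ w * inner ℝ (v - w) b)
        + ∫ w, g w * (fderiv ℝ φ w b * inner ℝ (v - w) a - fderiv ℝ φ w a * inner ℝ (v - w) b) := by
  have hba : inner ℝ b a = 0 := by rw [real_inner_comm]; exact hab
  have hgc := hg.continuous
  have hFc := continuous_fermiDensity (ε := ε) hg
  have hφ' := hφ.continuous
  have hdg : ∀ e, Continuous fun w => fderiv ℝ g w e := fun e =>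
    (hg.continuous_fderiv one_ne_zero).clm_apply continuous_const
  have hdφ : ∀ e, Continuous fun w => fderiv ℝ φ w e := fun e =>
    (hφ.continuous_fderiv one_ne_zero).clm_apply continuous_const
  have hcd : ∀ e, HasCompactSupport fun w => fderiv ℝ φ w e := fun e =>
    hφc.fderiv_apply ℝ e
  have key : ∀ x y : Vel, inner ℝ y x = 0 → ∫ w, φ w * inner ℝ (v - w) x * fderiv ℝ g w y
      = - ∫ w, g w * (fderiv ℝ φ w y * inner ℝ (v - w) x) := by
    intro x y hyx
    have hl : ∀ w, HasFDerivAt (fun w => inner ℝ (v - w) x) (-(innerSL ℝ x)) w := by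
      intro w
      have h : (fun w : Vel => inner ℝ (v - w) x) = fun w => inner ℝ v x - innerSL ℝ x w := by
        funext w; rw [inner_sub_left, innerSL_apply_apply, real_inner_comm w x]
      rw [h]
      exact (innerSL ℝ x).hasFDerivAt.const_sub _
    have hd : ∀ w, fderiv ℝ (fun w => φ w * inner ℝ (v - w) x) w y
        = fderiv ℝ φ w y * inner ℝ (v - w) x := by
      intro w
      have h3 : HasFDerivAt (fun w => φ w * inner ℝ (v - w) x) _ w :=
        ((hφ.differentiable one_ne_zero) w).hasFDerivAt.mul (hl w)
      rw [h3.fderiv]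
      simp only [add_apply, smul_apply,
        neg_apply, innerSL_apply_apply, smul_eq_mul]
      rw [real_inner_comm x y] at *
      rw [hyx]; ring
    rw [integral_mul_fderiv_eq_neg_fderiv_mul_of_integrable
      (f := fun w => φ w * inner ℝ (v - w) x) (g := g)]
    · congr 1; congr 1 with w; rw [hd]; ring
    · simp_rw [hd]
      exact Continuous.integrable_of_hasCompactSupport (by have := hdφ y; fun_prop)
        (((hcd y).mul_right).mul_right)
    · exact Continuous.integrable_of_hasCompactSupport (by have := hdg y; fun_prop)
        ((hφc.mul_right).mul_right)
    · exact Continuous.integrable_of_hasCompactSupport (by fun_prop)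
        ((hφc.mul_right).mul_right)
    · exact fun w _ => ((hφ.differentiable one_ne_zero) w).mul (hl w).differentiableAt
    · exact fun w _ => (hg.differentiable one_ne_zero) w
  have i1 : ∀ x, Integrable fun w => fermiDensity ε g w * φ w * inner ℝ (v - w) x := fun x =>
    Continuous.integrable_of_hasCompactSupport (by fun_prop) ((hφc.mul_left).mul_right)
  have i2 : ∀ x y, Integrable fun w => φ w * inner ℝ (v - w) x * fderiv ℝ g w y := fun x y =>
    Continuous.integrable_of_hasCompactSupport (by have := hdg y; fun_prop)
      ((hφc.mul_right).mul_right)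
  have i3 : ∀ x y, Integrable fun w => g w * (fderiv ℝ φ w y * inner ℝ (v - w) x) := fun x y =>
    Continuous.integrable_of_hasCompactSupport (by have := hdφ y; fun_prop)
      (((hcd y).mul_right).mul_left)
  have e : ∀ w, fermiDensity ε g w * φ w
        * wedge a b (v - w) (scoreField ε g v - scoreField ε g w)
      = (inner ℝ (scoreField ε g v) b * (fermiDensity ε g w * φ w * inner ℝ (v - w) a)
        - inner ℝ (scoreField ε g v) a * (fermiDensity ε g w * φ w * inner ℝ (v - w) b))
        - (φ w * inner ℝ (v - w) a * fderiv ℝ g w b - φ w * inner ℝ (v - w) b * fderiv ℝ g w a) := by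
    intro w
    rw [← fermiDensity_mul_inner_scoreField h0 h1 w b,
      ← fermiDensity_mul_inner_scoreField h0 h1 w a]
    unfold wedge
    rw [inner_sub_left (scoreField ε g v), inner_sub_left (scoreField ε g v)]
    ring
  have i4 : Integrable fun w => inner ℝ (scoreField ε g v) b
      * (fermiDensity ε g w * φ w * inner ℝ (v - w) a)
      - inner ℝ (scoreField ε g v) a * (fermiDensity ε g w * φ w * inner ℝ (v - w) b) :=
    ((i1 a).const_mul _).sub ((i1 b).const_mul _)
  have i5 : Integrable fun w => φ w * inner ℝ (v - w) a * fderiv ℝ g w b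
      - φ w * inner ℝ (v - w) b * fderiv ℝ g w a := (i2 a b).sub (i2 b a)
  simp_rw [e]
  rw [integral_sub i4 i5, integral_sub ((i1 a).const_mul _) ((i1 b).const_mul _), integral_const_mul, integral_const_mul,
    integral_sub (i2 a b) (i2 b a), key a b hba, key b a hab]
  simp_rw [mul_sub]
  rw [integral_sub (i3 a b) (i3 b a)]
  ring

lemma wedge_le_xi (h0 : ∀ v, 0 < g v) (h1 : ∀ v, ε * g v < 1) {a b : Vel} (ha : ‖a‖ = 1)
    (hb : ‖b‖ = 1) (hab : inner ℝ a b = 0) (v w : Vel) :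
    fermiDensity ε g v * fermiDensity ε g w * ‖v - w‖ ^ γ
        * wedge a b (v - w) (scoreField ε g v - scoreField ε g w) ^ 2
      ≤ ‖v - w‖ ^ (γ + 2) * xi ε g v w := by
  have hv := fermiDensity_pos h0 h1 v
  have hw := fermiDensity_pos h0 h1 w
  have hxi : xi ε g v w = fermiDensity ε g v * fermiDensity ε g w
      * ‖projPerp (v - w) (scoreField ε g v - scoreField ε g w)‖ ^ 2 := by
    unfold xi fermiDensity scoreField; ring
  rw [hxi]
  rcases eq_or_ne (v - w) 0 with h | h
  · have hx : 0 ≤ ‖v - w‖ ^ (γ + 2) := by positivity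
    rw [h, wedge_zero] at *
    have := mul_nonneg hx (mul_nonneg (mul_pos hv hw).le
      (sq_nonneg ‖projPerp 0 (scoreField ε g v - scoreField ε g w)‖))
    simpa using this
  · rw [Real.rpow_add (norm_pos_iff.2 h), Real.rpow_two]
    have := wedge_sq_le ha hb hab (v - w) (scoreField ε g v - scoreField ε g w)
    calc _ ≤ fermiDensity ε g v * fermiDensity ε g w * ‖v - w‖ ^ γ * (‖v - w‖ ^ 2
          * ‖projPerp (v - w) (scoreField ε g v - scoreField ε g w)‖ ^ 2) := by gcongr
      _ = _ := by ring

end Dissipation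

lemma ofReal_sq_integral_mul_le {f h : Vel → ℝ} (hf : Measurable f) (hh : Measurable h) :
    ENNReal.ofReal ((∫ w, f w * h w) ^ 2)
      ≤ (∫⁻ w, ENNReal.ofReal (f w ^ 2)) * ∫⁻ w, ENNReal.ofReal (h w ^ 2) := by
  have e : ∀ x : ℝ, ENNReal.ofReal (x ^ 2) = ‖x‖ₑ ^ (2 : ℝ) := fun x => by
    rw [← sq_abs, ENNReal.ofReal_pow (abs_nonneg x), ← Real.norm_eq_abs, ofReal_norm,
      ENNReal.rpow_two]
  simp_rw [e]
  have h1 : ‖∫ w, f w * h w‖ₑ ≤ ∫⁻ w, ((fun w => ‖f w‖ₑ) * fun w => ‖h w‖ₑ) w :=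
    (enorm_integral_le_lintegral_enorm _).trans_eq (by simp [enorm_mul])
  have h2 := h1.trans (ENNReal.lintegral_mul_le_Lp_mul_Lq volume Real.HolderConjugate.two_two
    hf.enorm.aemeasurable hh.enorm.aemeasurable)
  calc ‖∫ w, f w * h w‖ₑ ^ (2 : ℝ) ≤ _ := ENNReal.rpow_le_rpow h2 (by norm_num)
    _ = _ := by
      rw [ENNReal.mul_rpow_of_nonneg _ _ (by norm_num), ← ENNReal.rpow_mul, ← ENNReal.rpow_mul]
      norm_num

section Dissipation

variable {ε γ : ℝ} {g : Vel → ℝ}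

/-- Cauchy-Schwarz in `w`, with the weight split as `|v-w|^{-γ/2} |v-w|^{γ/2}`: the first factor is
at most `K` uniformly in `v`, and the second integrates against `F(v)` to at most twice the entropy
production. The majorant `ψ` keeps `K` independent of the cutoff inside `φ`. -/
lemma lintegral_test_le (hγ : 0 ≤ γ) (hg : ContDiff ℝ 1 g) (h0 : ∀ v, 0 < g v)
    (h1 : ∀ v, ε * g v < 1) {a b : Vel} (ha : ‖a‖ = 1) (hb : ‖b‖ = 1) (hab : inner ℝ a b = 0)
    {φ ψ : Vel → ℝ} (hφ : Continuous φ) (hφψ : ∀ w, φ w ^ 2 ≤ ψ w) {K : ℝ≥0∞}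
    (hK : ∀ v, ∫⁻ w, ENNReal.ofReal (fermiDensity ε g w * ψ w * ‖v - w‖ ^ (-γ)) ≤ K) :
    ∫⁻ v, ENNReal.ofReal (fermiDensity ε g v * (∫ w, fermiDensity ε g w * φ w
        * wedge a b (v - w) (scoreField ε g v - scoreField ε g w)) ^ 2)
      ≤ K * (2 * entropyProduction γ ε g) := by
  set F := fermiDensity ε g with hF
  set P := scoreField ε g with hP
  have hF0 : ∀ v, 0 < F v := fermiDensity_pos h0 h1
  have hFc : Continuous F := continuous_fermiDensity hg
  have hPc : Continuous P := continuous_scoreField hg h0 h1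
  have hpow : Continuous fun p : Vel × Vel => ‖p.1 - p.2‖ ^ γ :=
    Continuous.rpow_const (by fun_prop) fun _ => Or.inr hγ
  have hqc : Continuous fun p : Vel × Vel => wedge a b (p.1 - p.2) (P p.1 - P p.2) :=
    (continuous_wedge a b).comp (by fun_prop : Continuous fun p : Vel × Vel =>
      (p.1 - p.2, P p.1 - P p.2))
  set H := fun p : Vel × Vel => F p.1 * F p.2 * ‖p.1 - p.2‖ ^ γ
    * wedge a b (p.1 - p.2) (P p.1 - P p.2) ^ 2 with hH
  have hHm : Measurable fun p => ENNReal.ofReal (H p) :=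
    (Continuous.measurable (by fun_prop)).ennreal_ofReal
  have hpt : ∀ v, ENNReal.ofReal (F v * (∫ w, F w * φ w * wedge a b (v - w) (P v - P w)) ^ 2)
      ≤ K * ∫⁻ w, ENNReal.ofReal (H (v, w)) := by
    intro v
    have hnm : Measurable fun w : Vel => ‖v - w‖ := by fun_prop
    have hqm : Measurable fun w => wedge a b (v - w) (P v - P w) :=
      (hqc.comp (by fun_prop : Continuous fun w : Vel => (v, w))).measurable
    have e1 : ∀ w, F w * φ w * wedge a b (v - w) (P v - P w)
        = (Real.sqrt (F w) * φ w * ‖v - w‖ ^ (-γ / 2))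
          * (Real.sqrt (F w) * ‖v - w‖ ^ (γ / 2) * wedge a b (v - w) (P v - P w)) := by
      intro w
      -- On the diagonal the wedge vanishes, so the values of the real powers at zero do not matter.
      rcases eq_or_ne (v - w) 0 with h | h
      · rw [h, wedge_zero]; ring
      · have h2 : ‖v - w‖ ^ (-γ / 2) * ‖v - w‖ ^ (γ / 2) = 1 := by
          rw [← Real.rpow_add (norm_pos_iff.2 h), show -γ / 2 + γ / 2 = 0 by ring, Real.rpow_zero]
        calc _ = (Real.sqrt (F w) * Real.sqrt (F w)) * φ w * 1
              * wedge a b (v - w) (P v - P w) := by rw [Real.mul_self_sqrt (hF0 w).le]; ring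
          _ = _ := by rw [← h2]; ring
    have hsq : ∀ (s : ℝ) (w : Vel), (‖v - w‖ ^ (s / 2)) ^ 2 = ‖v - w‖ ^ s := by
      intro s w
      rw [← Real.rpow_mul_natCast (norm_nonneg _)]
      congr 1; push_cast; ring
    simp_rw [e1]
    rw [ENNReal.ofReal_mul (hF0 v).le]
    have hs : Measurable fun w => Real.sqrt (F w) := (Real.continuous_sqrt.comp hFc).measurable
    have cs := ofReal_sq_integral_mul_le
      (f := fun w => Real.sqrt (F w) * φ w * ‖v - w‖ ^ (-γ / 2))
      (h := fun w => Real.sqrt (F w) * ‖v - w‖ ^ (γ / 2) * wedge a b (v - w) (P v - P w))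
      ((hs.mul hφ.measurable).mul (hnm.pow_const _)) ((hs.mul (hnm.pow_const _)).mul hqm)
    have b1 : ∫⁻ w, ENNReal.ofReal ((Real.sqrt (F w) * φ w * ‖v - w‖ ^ (-γ / 2)) ^ 2) ≤ K := by
      refine (lintegral_mono fun w => ENNReal.ofReal_le_ofReal ?_).trans (hK v)
      rw [mul_pow, mul_pow, Real.sq_sqrt (hF0 w).le, hsq]
      have := hF0 w
      gcongr
      exact hφψ w
    have b2 : ENNReal.ofReal (F v) * ∫⁻ w, ENNReal.ofReal
        ((Real.sqrt (F w) * ‖v - w‖ ^ (γ / 2) * wedge a b (v - w) (P v - P w)) ^ 2)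
        = ∫⁻ w, ENNReal.ofReal (H (v, w)) := by
      rw [← lintegral_const_mul' _ _ ENNReal.ofReal_ne_top]
      congr 1 with w
      rw [← ENNReal.ofReal_mul (hF0 v).le, mul_pow, mul_pow, Real.sq_sqrt (hF0 w).le, hsq]
      congr 1
      simp only [hH]
      ring
    rw [← b2, mul_left_comm]
    exact mul_le_mul_right (cs.trans (mul_le_mul_left b1 _)) _
  calc _ ≤ ∫⁻ v, K * ∫⁻ w, ENNReal.ofReal (H (v, w)) := lintegral_mono hpt
    _ = K * ∫⁻ v, ∫⁻ w, ENNReal.ofReal (H (v, w)) :=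
        lintegral_const_mul _ hHm.lintegral_prod_right'
    _ = K * ∫⁻ p, ENNReal.ofReal (H p) := by
        rw [Measure.volume_eq_prod, lintegral_prod _ hHm.aemeasurable]
    _ ≤ K * ∫⁻ p : Vel × Vel, ENNReal.ofReal (‖p.1 - p.2‖ ^ (γ + 2) * xi ε g p.1 p.2) := by
        gcongr with p
        exact wedge_le_xi h0 h1 ha hb hab p.1 p.2
    _ = _ := by
        unfold entropyProduction
        rw [← mul_assoc 2, one_div, ENNReal.mul_inv_cancel (by norm_num) (by norm_num), one_mul]

set_option maxHeartbeats 1000000 in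
/-- Directional control of the score field by the entropy production. -/
theorem lintegral_direction_le (hγ : 0 ≤ γ) (hg : ContDiff ℝ 1 g) (h0 : ∀ v, 0 < g v)
    (h1 : ∀ v, ε * g v < 1) (hε : 0 ≤ ε) (hi : Integrable g)
    (h2 : Integrable fun v => g v * ‖v‖ ^ 2) (hmass : ∫ v, g v = 1)
    {a b μ : Vel} (ha : ‖a‖ = 1) (hb : ‖b‖ = 1) (hab : inner ℝ a b = 0)
    (hmom : ∫ v, g v * inner ℝ v b = 0)
    (hμ : ∫ w, fermiDensity ε g w * inner ℝ (w - μ) a = 0)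
    (hcov : ∫ w, fermiDensity ε g w * (inner ℝ (w - μ) a * inner ℝ (w - μ) b) = 0) {K : ℝ≥0∞}
    (hK : ∀ v, ∫⁻ w, ENNReal.ofReal
      (fermiDensity ε g w * inner ℝ (w - μ) a ^ 2 * ‖v - w‖ ^ (-γ)) ≤ K) :
    ∫⁻ v, ENNReal.ofReal (fermiDensity ε g v
        * ((∫ w, fermiDensity ε g w * inner ℝ (w - μ) a ^ 2) * inner ℝ (scoreField ε g v) b
          + inner ℝ v b) ^ 2)
      ≤ K * (2 * entropyProduction γ ε g) := by
  set F := fermiDensity ε g with hF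
  set P := scoreField ε g with hP
  have hgc := hg.continuous
  have hF0 : ∀ v, 0 < F v := fermiDensity_pos h0 h1
  have hFc : Continuous F := continuous_fermiDensity hg
  have hPc : Continuous P := continuous_scoreField hg h0 h1
  have hFg : ∀ v, F v ≤ g v := fun v => by
    have := h0 v
    have : 0 ≤ ε * g v := by positivity
    simp only [hF, fermiDensity]; nlinarith
  have hba : inner ℝ b a = 0 := by rw [real_inner_comm]; exact hab
  have hdom : Integrable fun w => g w * (1 + ‖w‖ ^ 2) := by
    simp_rw [mul_add, mul_one]; exact hi.add h2
  have hquad : ∀ {f h : Vel → ℝ} (C : ℝ), Continuous f → Continuous h → (∀ w, |f w| ≤ g w) →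
      (∀ w, |h w| ≤ C * (1 + ‖w‖ ^ 2)) → Integrable fun w => f w * h w := by
    intro f h C hf hh hfg hhC
    refine (hdom.const_mul C).mono' (hf.mul hh).aestronglyMeasurable
      (Eventually.of_forall fun w => ?_)
    rw [norm_mul, Real.norm_eq_abs, Real.norm_eq_abs]
    calc |f w| * |h w| ≤ g w * (C * (1 + ‖w‖ ^ 2)) := by
          gcongr
          · exact (h0 w).le
          · exact hfg w
          · exact hhC w
      _ = _ := by ring
  have hFabs : ∀ w, |F w| ≤ g w := fun w => by rw [abs_of_pos (hF0 w)]; exact hFg w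
  have hgabs : ∀ w, |g w| ≤ g w := fun w => by rw [abs_of_pos (h0 w)]
  have hin : ∀ (m w e : Vel), ‖e‖ = 1 → |inner ℝ (w - m) e| ≤ ‖w‖ + ‖m‖ := fun m w e he =>
    (abs_real_inner_le_norm _ _).trans (by rw [he, mul_one]; exact norm_sub_le _ _)
  have hprod : ∀ (v w e : Vel), ‖e‖ = 1 → |inner ℝ (w - μ) a * inner ℝ (v - w) e|
      ≤ (2 * (1 + ‖μ‖) * (1 + ‖v‖)) * (1 + ‖w‖ ^ 2) := by
    intro v w e he
    rw [abs_mul]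
    have h3 := hin μ w a ha
    have h4 : |inner ℝ (v - w) e| ≤ ‖w‖ + ‖v‖ := by
      rw [← abs_neg, ← inner_neg_left, neg_sub]; exact hin v w e he
    have hw := norm_nonneg w
    have hv := norm_nonneg v
    have hm := norm_nonneg μ
    calc |inner ℝ (w - μ) a| * |inner ℝ (v - w) e| ≤ (‖w‖ + ‖μ‖) * (‖w‖ + ‖v‖) := by gcongr
      _ ≤ ((1 + ‖μ‖) * (1 + ‖w‖)) * ((1 + ‖v‖) * (1 + ‖w‖)) := by gcongr <;> nlinarith
      _ = (1 + ‖μ‖) * (1 + ‖v‖) * (1 + ‖w‖) ^ 2 := by ring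
      _ ≤ (1 + ‖μ‖) * (1 + ‖v‖) * (2 * (1 + ‖w‖ ^ 2)) := by
          gcongr; nlinarith [sq_nonneg (‖w‖ - 1)]
      _ = _ := by ring
  obtain ⟨χ, C, hχ, hχc, hχ0, hχ1, hχt, hχd, hχb⟩ := exists_cutoff
  -- Truncation of the linear test function `(w-μ)·a`; the cutoff makes the integration by parts
  -- legitimate.
  set φ : ℕ → Vel → ℝ := fun n w => inner ℝ (w - μ) a * χ n w with hφ
  have hφd : ∀ n, ContDiff ℝ 1 (φ n) := fun n =>
    ((contDiff_id.sub contDiff_const).inner ℝ contDiff_const).mul (hχ n)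
  have hφs : ∀ n, HasCompactSupport (φ n) := fun n => (hχc n).mul_left
  have hφ2 : ∀ n w, φ n w ^ 2 ≤ inner ℝ (w - μ) a ^ 2 := by
    intro n w
    simp only [hφ, mul_pow]
    have : χ n w ^ 2 ≤ 1 := pow_le_one₀ (hχ0 n w) (hχ1 n w)
    nlinarith [sq_nonneg (inner ℝ (w - μ) a)]
  have hφf : ∀ n w e, fderiv ℝ (φ n) w e
      = inner ℝ e a * χ n w + inner ℝ (w - μ) a * fderiv ℝ (χ n) w e := by
    intro n w e
    have hl : HasFDerivAt (fun w : Vel => inner ℝ (w - μ) a) (innerSL ℝ a) w := by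
      have h : (fun w : Vel => inner ℝ (w - μ) a) = fun w => innerSL ℝ a w - inner ℝ μ a := by
        funext w; rw [inner_sub_left, innerSL_apply_apply, real_inner_comm w a]
      rw [h]
      exact (innerSL ℝ a).hasFDerivAt.sub_const _
    have h3 : HasFDerivAt (φ n) _ w :=
      hl.mul (((hχ n).differentiable one_ne_zero) w).hasFDerivAt
    rw [h3.fderiv]
    simp only [add_apply, smul_apply, innerSL_apply_apply, smul_eq_mul]
    rw [real_inner_comm a e]; ring
  set J : ℕ → Vel → ℝ := fun n v => ∫ w, F w * φ n w * wedge a b (v - w) (P v - P w) with hJ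
  have hC1 : ∀ (v : Vel) (e : Vel), ‖e‖ = 1 →
      Tendsto (fun n => ∫ w, F w * φ n w * inner ℝ (v - w) e) atTop
        (𝓝 (∫ w, F w * (inner ℝ (w - μ) a * inner ℝ (v - w) e))) := by
    intro v e he
    have hint : Integrable fun w => F w * (inner ℝ (w - μ) a * inner ℝ (v - w) e) :=
      hquad _ hFc (by fun_prop) hFabs fun w => hprod v w e he
    refine tendsto_integral_of_dominated_convergence
      (fun w => ‖F w * (inner ℝ (w - μ) a * inner ℝ (v - w) e)‖) (fun n => ?_) hint.norm
      (fun n => Eventually.of_forall fun w => ?_) (Eventually.of_forall fun w => ?_)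
    · have := (hφd n).continuous
      exact Continuous.aestronglyMeasurable (by fun_prop)
    · have e1 : F w * φ n w * inner ℝ (v - w) e
          = χ n w * (F w * (inner ℝ (w - μ) a * inner ℝ (v - w) e)) := by simp only [hφ]; ring
      rw [e1, norm_mul, Real.norm_of_nonneg (hχ0 n w)]
      exact mul_le_of_le_one_left (norm_nonneg _) (hχ1 n w)
    · have e1 : ∀ n, F w * φ n w * inner ℝ (v - w) e
          = χ n w * (F w * (inner ℝ (w - μ) a * inner ℝ (v - w) e)) := fun n => by
        simp only [hφ]; ring
      simp_rw [e1]
      simpa using (hχt w).mul_const (F w * (inner ℝ (w - μ) a * inner ℝ (v - w) e))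
  -- As the cutoff is removed, `∇φ` tends to `a`. The derivative along `b` disappears and the one
  -- along `a` becomes 1, leaving the first moments of `g`. Domination uses the uniform bound on
  -- `(1+|w|)|∇χ|`.
  have hC2 : ∀ v : Vel, Tendsto (fun n => ∫ w, g w * (fderiv ℝ (φ n) w b * inner ℝ (v - w) a
      - fderiv ℝ (φ n) w a * inner ℝ (v - w) b)) atTop (𝓝 (∫ w, g w * -inner ℝ (v - w) b)) := by
    intro v
    have hD : ∀ (x y : Vel), ‖x‖ = 1 → ‖y‖ = 1 → ∀ n w,
        |fderiv ℝ (φ n) w x * inner ℝ (v - w) y|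
          ≤ ((1 + (1 + ‖μ‖) * C) * (1 + ‖v‖) * 2) * (1 + ‖w‖ ^ 2) := by
      intro x y hx hy n w
      have h4 : |inner ℝ (v - w) y| ≤ ‖w‖ + ‖v‖ := by
        rw [← abs_neg, ← inner_neg_left, neg_sub]; exact hin v w y hy
      have hw := norm_nonneg w
      have hv := norm_nonneg v
      have hm := norm_nonneg μ
      have h5 := hχb n w x
      rw [hx, mul_one] at h5
      have hC0 : 0 ≤ C := le_trans (by positivity) h5
      have h6 : |fderiv ℝ (φ n) w x| ≤ 1 + (1 + ‖μ‖) * C := by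
        rw [hφf]
        refine (abs_add_le _ _).trans (add_le_add ?_ ?_)
        · rw [abs_mul, abs_of_nonneg (hχ0 n w)]
          have : |inner ℝ x a| ≤ 1 := by
            simpa [hx, ha] using abs_real_inner_le_norm x a
          exact mul_le_one₀ this (hχ0 n w) (hχ1 n w)
        · rw [abs_mul]
          calc |inner ℝ (w - μ) a| * |fderiv ℝ (χ n) w x|
              ≤ ((1 + ‖μ‖) * (1 + ‖w‖)) * |fderiv ℝ (χ n) w x| := by
                gcongr
                exact (hin μ w a ha).trans (by nlinarith)
            _ = (1 + ‖μ‖) * ((1 + ‖w‖) * |fderiv ℝ (χ n) w x|) := by ring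
            _ ≤ _ := by gcongr
      rw [abs_mul]
      calc |fderiv ℝ (φ n) w x| * |inner ℝ (v - w) y|
          ≤ (1 + (1 + ‖μ‖) * C) * (‖w‖ + ‖v‖) := by gcongr
        _ ≤ (1 + (1 + ‖μ‖) * C) * ((1 + ‖v‖) * (2 * (1 + ‖w‖ ^ 2))) := by
            gcongr
            nlinarith [sq_nonneg (‖w‖ - 1), mul_nonneg hv (sq_nonneg ‖w‖)]
        _ = _ := by ring
    refine tendsto_integral_of_dominated_convergence
      (fun w => (2 * ((1 + (1 + ‖μ‖) * C) * (1 + ‖v‖) * 2)) * (g w * (1 + ‖w‖ ^ 2)))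
      (fun n => ?_) (hdom.const_mul _)
      (fun n => Eventually.of_forall fun w => ?_) (Eventually.of_forall fun w => ?_)
    · have hd : ∀ e, Continuous fun w => fderiv ℝ (φ n) w e := fun e =>
        ((hφd n).continuous_fderiv one_ne_zero).clm_apply continuous_const
      have := hd a
      have := hd b
      exact Continuous.aestronglyMeasurable (by fun_prop)
    · rw [norm_mul, Real.norm_of_nonneg (h0 w).le, Real.norm_eq_abs]
      have h5 := (abs_sub _ _).trans (add_le_add (hD b a hb ha n w) (hD a b ha hb n w))
      have := mul_le_mul_of_nonneg_left h5 (h0 w).le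
      linarith
    · have t : ∀ e, Tendsto (fun n => fderiv ℝ (φ n) w e) atTop (𝓝 (inner ℝ e a)) := by
        intro e
        simp_rw [hφf]
        simpa using ((hχt w).const_mul (inner ℝ e a)).add
          ((hχd w e).const_mul (inner ℝ (w - μ) a))
      have := (((t b).mul_const (inner ℝ (v - w) a)).sub
        ((t a).mul_const (inner ℝ (v - w) b))).const_mul (g w)
      simpa [hba, ha] using this
  have hμi : ∀ e : Vel, ‖e‖ = 1 → Integrable fun w => F w * inner ℝ (w - μ) e := fun e he =>
    hquad (1 + ‖μ‖) hFc (by fun_prop) hFabs fun w => (hin μ w e he).trans (by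
      have := norm_nonneg μ
      nlinarith [sq_nonneg (‖w‖ - 1), norm_nonneg w, mul_nonneg this (sq_nonneg ‖w‖)])
  have hcross : ∀ e : Vel, ‖e‖ = 1 →
      Integrable fun w => F w * (inner ℝ (w - μ) a * inner ℝ (w - μ) e) := fun e he =>
    hquad (2 * (1 + ‖μ‖) * (1 + ‖μ‖)) hFc (by fun_prop) hFabs fun w => by
      have := hprod μ w e he
      rwa [← neg_sub w μ, inner_neg_left, mul_neg, abs_neg] at this
  -- Write `v-w = (v-μ) - (w-μ)`: centering at `μ` removes the part that depends on `v`, and a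
  -- covariance remains.
  have hval : ∀ (v e : Vel), ‖e‖ = 1 → ∫ w, F w * (inner ℝ (w - μ) a * inner ℝ (v - w) e)
      = -∫ w, F w * (inner ℝ (w - μ) a * inner ℝ (w - μ) e) := by
    intro v e he
    have e1 : ∀ w, F w * (inner ℝ (w - μ) a * inner ℝ (v - w) e)
        = inner ℝ (v - μ) e * (F w * inner ℝ (w - μ) a)
          - F w * (inner ℝ (w - μ) a * inner ℝ (w - μ) e) := by
      intro w
      rw [show v - w = (v - μ) - (w - μ) by abel, inner_sub_left (v - μ)]; ring
    simp_rw [e1]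
    rw [integral_sub ((hμi a ha).const_mul _) (hcross e he), integral_const_mul, hμ]
    ring
  have hval2 : ∀ v : Vel, ∫ w, g w * -inner ℝ (v - w) b = -inner ℝ v b := by
    intro v
    have hib : Integrable fun w => g w * inner ℝ w b :=
      hquad 1 hgc (by fun_prop) hgabs fun w => by
        have := hin 0 w b hb
        rw [sub_zero, norm_zero] at this
        nlinarith [sq_nonneg (‖w‖ - 1), norm_nonneg w]
    have e1 : ∀ w, g w * -inner ℝ (v - w) b = g w * inner ℝ w b - inner ℝ v b * g w := by
      intro w; rw [inner_sub_left]; ring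
    simp_rw [e1]
    rw [integral_sub hib (hi.const_mul _), integral_const_mul, hmass, hmom]
    ring
  -- The vanishing mixed covariance kills the component of the score along `a`, so only the
  -- component along `b` is left.
  have hlim : ∀ v, Tendsto (fun n => J n v) atTop
      (𝓝 (-((∫ w, F w * inner ℝ (w - μ) a ^ 2) * inner ℝ (P v) b + inner ℝ v b))) := by
    intro v
    have hJe : ∀ n, J n v = _ := fun n => integral_wedge_eq hg h0 h1 hab (hφd n) (hφs n) v
    simp_rw [hJe]
    have := (((hC1 v a ha).const_mul (inner ℝ (P v) b)).sub
      ((hC1 v b hb).const_mul (inner ℝ (P v) a))).add (hC2 v)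
    rw [hval v a ha, hval v b hb, hval2 v, hcov] at this
    convert this using 2
    simp only [← sq]
    ring
  have hqc : Continuous fun p : Vel × Vel => wedge a b (p.1 - p.2) (P p.1 - P p.2) :=
    (continuous_wedge a b).comp (by fun_prop : Continuous fun p : Vel × Vel =>
      (p.1 - p.2, P p.1 - P p.2))
  have hJm : ∀ n, Measurable (J n) := by
    intro n
    have := (hφd n).continuous
    have hc : Continuous fun p : Vel × Vel => F p.2 * φ n p.2
        * wedge a b (p.1 - p.2) (P p.1 - P p.2) := by fun_prop
    exact (hc.measurable.stronglyMeasurable.integral_prod_right' (ν := volume)).measurable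
  -- Fatou's lemma transfers the uniform bound to the limit.
  calc _ = ∫⁻ v, liminf (fun n => ENNReal.ofReal (F v * J n v ^ 2)) atTop := by
        congr 1 with v
        have := (ENNReal.continuous_ofReal.tendsto _).comp (((hlim v).pow 2).const_mul (F v))
        rw [neg_sq] at this
        exact this.liminf_eq.symm
    _ ≤ liminf (fun n => ∫⁻ v, ENNReal.ofReal (F v * J n v ^ 2)) atTop :=
        lintegral_liminf_le fun n =>
          (hFc.measurable.mul ((hJm n).pow_const 2)).ennreal_ofReal
    _ ≤ liminf (fun _ : ℕ => K * (2 * entropyProduction γ ε g)) atTop :=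
        liminf_le_liminf (Eventually.of_forall fun n =>
          lintegral_test_le hγ hg h0 h1 ha hb hab (hφd n).continuous (hφ2 n) hK)
    _ = _ := liminf_const _

end Dissipation

/-! ### Moment and kernel bounds for admissible densities -/

/-- In polar coordinates the surface factor `r²` of dimension three cancels `r⁻²`. This makes the
local part of `|v-w|^{-γ}`, `γ ≤ 1`, square integrable. -/
lemma integrable_truncated_inv_sq :
    Integrable fun z : Vel => (if ‖z‖ < 1 then ‖z‖⁻¹ else 0) ^ 2 := by
  have h := integrable_fun_norm_addHaar (volume : Measure Vel)
    (f := fun y : ℝ => (if y < 1 then y⁻¹ else 0) ^ 2)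
  rw [h]
  have h2 : IntegrableOn (fun y : ℝ => (Ioo (0 : ℝ) 1).indicator (fun _ => (1 : ℝ)) y) (Ioi 0) :=
    ((integrable_indicator_iff measurableSet_Ioo).2
      (integrableOn_const (by simp))).integrableOn
  refine h2.congr_fun (fun y hy => ?_) measurableSet_Ioi
  have hy' : (0 : ℝ) < y := hy
  simp only [finrank_euclideanSpace, Fintype.card_fin, smul_eq_mul, indicator, mem_Ioo, hy',
    true_and]
  split_ifs
  · field_simp
  · simp

/-- The regularity, Pauli bound and normalization of the densities under consideration. -/
structure IsAdmissible (κ ε : ℝ) (g : Vel → ℝ) : Prop where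
  kappa_pos : 0 < κ
  eps_nonneg : 0 ≤ ε
  contDiff : ContDiff ℝ 1 g
  pos : ∀ v, 0 < g v
  pauli : ∀ v, κ ≤ 1 - ε * g v
  integrable : Integrable g
  integrable_energy : Integrable fun v => g v * ‖v‖ ^ 2
  mass : ∫ v, g v = 1
  momentum : ∫ v, g v • v = 0
  energy : ∫ v, g v * ‖v‖ ^ 2 = 3

namespace IsAdmissible

variable {κ ε : ℝ} {g : Vel → ℝ}

lemma lt_one (h : IsAdmissible κ ε g) (v : Vel) : ε * g v < 1 := by
  have := h.pauli v; have := h.kappa_pos; linarith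

lemma density_le (h : IsAdmissible κ ε g) (v : Vel) : fermiDensity ε g v ≤ g v := by
  have := h.pos v
  have := mul_nonneg h.eps_nonneg this.le
  unfold fermiDensity; nlinarith

lemma le_density (h : IsAdmissible κ ε g) (v : Vel) : κ * g v ≤ fermiDensity ε g v := by
  have := mul_le_mul_of_nonneg_left (h.pauli v) (h.pos v).le
  unfold fermiDensity; linarith

lemma density_pos (h : IsAdmissible κ ε g) (v : Vel) : 0 < fermiDensity ε g v :=
  fermiDensity_pos h.pos h.lt_one v

lemma continuous_density (h : IsAdmissible κ ε g) : Continuous (fermiDensity ε g) :=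
  continuous_fermiDensity h.contDiff

lemma integrable_mul (h : IsAdmissible κ ε g) {f q : Vel → ℝ} (C : ℝ) (hf : Continuous f)
    (hq : Continuous q) (hfg : ∀ w, |f w| ≤ g w) (hqC : ∀ w, |q w| ≤ C * (1 + ‖w‖ ^ 2)) :
    Integrable fun w => f w * q w := by
  have hdom : Integrable fun w => g w * (1 + ‖w‖ ^ 2) := by
    simp_rw [mul_add, mul_one]; exact h.integrable.add h.integrable_energy
  refine (hdom.const_mul C).mono' (hf.mul hq).aestronglyMeasurable
    (Eventually.of_forall fun w => ?_)
  rw [norm_mul, Real.norm_eq_abs, Real.norm_eq_abs]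
  calc |f w| * |q w| ≤ g w * (C * (1 + ‖w‖ ^ 2)) := by
        gcongr
        · exact (h.pos w).le
        · exact hfg w
        · exact hqC w
    _ = _ := by ring

lemma abs_density_le (h : IsAdmissible κ ε g) (w : Vel) : |fermiDensity ε g w| ≤ g w := by
  rw [abs_of_pos (h.density_pos w)]; exact h.density_le w

lemma abs_le (h : IsAdmissible κ ε g) (w : Vel) : |g w| ≤ g w := by rw [abs_of_pos (h.pos w)]

end IsAdmissible

lemma abs_inner_mul_inner_le (μ x y w : Vel) : |inner ℝ (w - μ) x * inner ℝ (w - μ) y|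
    ≤ (2 * (1 + ‖μ‖) ^ 2 * ‖x‖ * ‖y‖) * (1 + ‖w‖ ^ 2) := by
  have h1 : ‖w - μ‖ ≤ (1 + ‖μ‖) * (1 + ‖w‖) :=
    (norm_sub_le _ _).trans (by nlinarith [norm_nonneg w, norm_nonneg μ])
  rw [abs_mul]
  calc |inner ℝ (w - μ) x| * |inner ℝ (w - μ) y| ≤ (‖w - μ‖ * ‖x‖) * (‖w - μ‖ * ‖y‖) :=
        mul_le_mul (abs_real_inner_le_norm _ _) (abs_real_inner_le_norm _ _) (abs_nonneg _)
          (by positivity)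
    _ = ‖w - μ‖ ^ 2 * (‖x‖ * ‖y‖) := by ring
    _ ≤ ((1 + ‖μ‖) * (1 + ‖w‖)) ^ 2 * (‖x‖ * ‖y‖) := by gcongr
    _ = (1 + ‖μ‖) ^ 2 * (‖x‖ * ‖y‖) * (1 + ‖w‖) ^ 2 := by ring
    _ ≤ (1 + ‖μ‖) ^ 2 * (‖x‖ * ‖y‖) * (2 * (1 + ‖w‖ ^ 2)) := by
        gcongr; nlinarith [sq_nonneg (‖w‖ - 1)]
    _ = _ := by ring

lemma abs_inner_le_quad (μ x w : Vel) :
    |inner ℝ (w - μ) x| ≤ ((2 + ‖μ‖) * ‖x‖) * (1 + ‖w‖ ^ 2) := by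
  have h1 : ‖w - μ‖ ≤ (2 + ‖μ‖) * (1 + ‖w‖ ^ 2) :=
    (norm_sub_le _ _).trans (by
      nlinarith [norm_nonneg w, norm_nonneg μ, sq_nonneg (‖w‖ - 1),
        mul_nonneg (norm_nonneg μ) (sq_nonneg ‖w‖)])
  calc |inner ℝ (w - μ) x| ≤ ‖w - μ‖ * ‖x‖ := abs_real_inner_le_norm _ _
    _ ≤ (2 + ‖μ‖) * (1 + ‖w‖ ^ 2) * ‖x‖ := by gcongr
    _ = _ := by ring

namespace IsAdmissible

variable {κ ε : ℝ} {g : Vel → ℝ}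

lemma integral_inner_eq_zero (h : IsAdmissible κ ε g) (e : Vel) : ∫ v, g v * inner ℝ v e = 0 := by
  have hi : Integrable fun v => g v • v := by
    have h1 := h.integrable_mul (f := g) (q := fun w => ‖w‖) 1 h.contDiff.continuous
      continuous_norm h.abs_le fun w => by
        rw [abs_norm]; nlinarith [sq_nonneg (‖w‖ - 1), norm_nonneg w]
    refine (integrable_norm_iff (h.contDiff.continuous.smul continuous_id).aestronglyMeasurable).1
      (h1.congr (Eventually.of_forall fun v => ?_))
    simp [norm_smul, abs_of_pos (h.pos v)]
  have h2 := integral_inner (𝕜 := ℝ) hi e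
  rw [h.momentum, inner_zero_right] at h2
  rw [← h2]
  congr 1 with v
  rw [real_inner_smul_right, real_inner_comm]

/-- The second moments of `g` about `μ` in a given direction. -/
lemma integral_inner_sub_sq (h : IsAdmissible κ ε g) (μ e : Vel) :
    ∫ v, g v * inner ℝ (v - μ) e ^ 2 = (∫ v, g v * inner ℝ v e ^ 2) + inner ℝ μ e ^ 2 := by
  have i1 : Integrable fun v => g v * inner ℝ v e ^ 2 := by
    have := h.integrable_mul (f := g) (q := fun w => inner ℝ (w - 0) e * inner ℝ (w - 0) e) _
      h.contDiff.continuous (by fun_prop) h.abs_le (abs_inner_mul_inner_le 0 e e)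
    simpa [← sq] using this
  have i2 : Integrable fun v => g v * inner ℝ v e := by
    have := h.integrable_mul (f := g) (q := fun w => inner ℝ (w - 0) e) _
      h.contDiff.continuous (by fun_prop) h.abs_le (abs_inner_le_quad 0 e)
    simpa using this
  have e1 : ∀ v, g v * inner ℝ (v - μ) e ^ 2 = (g v * inner ℝ v e ^ 2
      - 2 * inner ℝ μ e * (g v * inner ℝ v e)) + inner ℝ μ e ^ 2 * g v := by
    intro v; rw [inner_sub_left]; ring
  have i3 : Integrable fun v => g v * inner ℝ v e ^ 2 - 2 * inner ℝ μ e * (g v * inner ℝ v e) :=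
    i1.sub (i2.const_mul _)
  simp_rw [e1]
  rw [integral_add i3 (h.integrable.const_mul _), integral_sub i1 (i2.const_mul _),
    integral_const_mul, integral_const_mul, h.mass, h.integral_inner_eq_zero]
  ring

lemma integral_inner_sq_le (h : IsAdmissible κ ε g) {e : Vel} (he : ‖e‖ = 1) :
    ∫ v, g v * inner ℝ v e ^ 2 ≤ 3 := by
  rw [← h.energy]
  refine integral_mono_of_nonneg (Eventually.of_forall fun v => ?_) h.integrable_energy
    (Eventually.of_forall fun v => ?_)
  · have := h.pos v; simp only [Pi.zero_apply]; positivity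
  · have h1 : inner ℝ v e ^ 2 ≤ ‖v‖ ^ 2 := by
      rw [sq_le_sq, abs_norm]
      simpa [he] using abs_real_inner_le_norm v e
    exact mul_le_mul_of_nonneg_left h1 (h.pos v).le

/-- `μ` is the mean of `F = g(1-εg)`. Its mass is at least `κ`, and its first moment is at most `∫ g
(1+|w|²)/2 = (1+3)/2 = 2`. -/
lemma exists_centroid (h : IsAdmissible κ ε g) : ∃ μ : Vel, ‖μ‖ ≤ 2 / κ ∧
    ∀ e, ∫ w, fermiDensity ε g w * inner ℝ (w - μ) e = 0 := by
  set F := fermiDensity ε g with hF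
  have hFc := h.continuous_density
  have hκ := h.kappa_pos
  have hFi : Integrable F := by
    simpa using h.integrable_mul (f := F) (q := fun _ => 1) 1 hFc continuous_const h.abs_density_le
      fun w => by rw [abs_one]; nlinarith [sq_nonneg ‖w‖]
  have hn : κ ≤ ∫ w, F w := by
    have := integral_mono (h.integrable.const_mul κ) hFi h.le_density
    rwa [integral_const_mul, h.mass, mul_one] at this
  have hn0 : 0 < ∫ w, F w := hκ.trans_le hn
  have hni : Integrable fun w => F w * ‖w‖ :=
    h.integrable_mul (f := F) (q := fun w => ‖w‖) 1 hFc continuous_norm h.abs_density_le fun w => by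
      rw [abs_norm]; nlinarith [sq_nonneg (‖w‖ - 1), norm_nonneg w]
  have hvi : Integrable fun w => F w • w := by
    refine (integrable_norm_iff (hFc.smul continuous_id).aestronglyMeasurable).1
      (hni.congr (Eventually.of_forall fun v => ?_))
    simp [norm_smul, abs_of_pos (h.density_pos v), F]
  have hb : ‖∫ w, F w • w‖ ≤ 2 := by
    refine (norm_integral_le_integral_norm _).trans ?_
    have h4 : ∫ w, (g w + g w * ‖w‖ ^ 2) / 2 = 2 := by
      rw [integral_div, integral_add h.integrable h.integrable_energy, h.mass, h.energy]; norm_num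
    rw [← h4]
    refine integral_mono hvi.norm ((h.integrable.add h.integrable_energy).div_const 2) fun w => ?_
    simp only [norm_smul, Real.norm_eq_abs]
    calc |F w| * ‖w‖ ≤ g w * ‖w‖ := by gcongr; exact h.abs_density_le w
      _ ≤ _ := by nlinarith [mul_nonneg (h.pos w).le (sq_nonneg (‖w‖ - 1))]
  refine ⟨(∫ w, F w)⁻¹ • ∫ w, F w • w, ?_, fun e => ?_⟩
  · rw [norm_smul, norm_inv, Real.norm_of_nonneg hn0.le, ← div_eq_inv_mul]
    gcongr
  · have h2 := integral_inner (𝕜 := ℝ) hvi e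
    have i2 : Integrable fun w => F w * inner ℝ w e := by
      have := h.integrable_mul (f := F) (q := fun w => inner ℝ (w - 0) e) _
        hFc (by fun_prop) h.abs_density_le (abs_inner_le_quad 0 e)
      simpa using this
    have h3 : ∫ w, F w * inner ℝ w e = inner ℝ e (∫ w, F w • w) := by
      rw [← h2]
      congr 1 with v
      rw [real_inner_smul_right, real_inner_comm]
    simp_rw [inner_sub_left, mul_sub]
    rw [integral_sub i2 (hFi.mul_const _), integral_mul_const, h3, real_inner_smul_left,
      real_inner_comm e]
    field_simp
    ring

end IsAdmissible

/-- Since the bracket is at least 1, the exponent `2(2+γ)` may be lowered to 4, and the constants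
that follow are independent of `γ`. The maximum with 0 covers negative `l`. -/
lemma lintegral_sq_le_of_weightedL2Norm_le {γ l : ℝ} (hγ : 0 ≤ γ) {g : Vel → ℝ}
    (h : weightedL2Norm (2 + γ) g ≤ ENNReal.ofReal l) :
    ∫⁻ v, ENNReal.ofReal (g v ^ 2 * (1 + ‖v‖ ^ 2) ^ 2) ≤ ENNReal.ofReal (max l 0 ^ 2) := by
  unfold weightedL2Norm at h
  have h1 := ENNReal.rpow_le_rpow h (show (0 : ℝ) ≤ 2 by norm_num)
  rw [← ENNReal.rpow_mul] at h1
  norm_num at h1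
  have hl : ENNReal.ofReal l = ENNReal.ofReal (max l 0) := by
    rcases le_total 0 l with hl | hl
    · rw [max_eq_left hl]
    · rw [max_eq_right hl, ENNReal.ofReal_of_nonpos hl, ENNReal.ofReal_zero]
  rw [hl, ← ENNReal.ofReal_pow (le_max_right _ _)] at h1
  refine le_trans (lintegral_mono fun v => ENNReal.ofReal_le_ofReal ?_) h1
  have hb : 1 ≤ bracket v := by
    unfold bracket; rw [Real.one_le_sqrt]; nlinarith [sq_nonneg ‖v‖]
  have hb2 : bracket v ^ (4 : ℝ) = (1 + ‖v‖ ^ 2) ^ 2 := by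
    have : bracket v ^ 2 = 1 + ‖v‖ ^ 2 := Real.sq_sqrt (by positivity)
    rw [← this, ← pow_mul]; norm_cast
  rw [← hb2]
  gcongr
  linarith

/-- Split `|z|^{-γ} ≤ 1 + k(z)`, where `k` is `1/|z|` on the unit ball and zero outside. The regular
part costs `∫ g(1+|w|²) = 4`. In the singular part `pk ≤ p² + k²` with `p = g(1+|w|²)` separates the
`L²` bound from the integral of `k²`, uniformly in `v`. -/
lemma lintegral_kernel_le {κ ε γ L : ℝ} {g : Vel → ℝ} (h : IsAdmissible κ ε g)
    (hγ : γ ∈ Icc (0 : ℝ) 1)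
    (hL : ∫⁻ v, ENNReal.ofReal (g v ^ 2 * (1 + ‖v‖ ^ 2) ^ 2) ≤ ENNReal.ofReal L) (hL0 : 0 ≤ L)
    {μ : Vel} (hμ : ‖μ‖ ≤ 2 / κ) {a : Vel} (ha : ‖a‖ = 1) (v : Vel) :
    ∫⁻ w, ENNReal.ofReal (fermiDensity ε g w * inner ℝ (w - μ) a ^ 2 * ‖v - w‖ ^ (-γ))
      ≤ ENNReal.ofReal (2 * (1 + 2 / κ) ^ 2
        * (4 + (L + ∫ z : Vel, (if ‖z‖ < 1 then ‖z‖⁻¹ else 0) ^ 2))) := by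
  have hκ := h.kappa_pos
  set k : Vel → ℝ := fun z => if ‖z‖ < 1 then ‖z‖⁻¹ else 0 with hk
  have hk0 : ∀ z, 0 ≤ k z := fun z => by simp only [hk]; split_ifs <;> positivity
  set c := 2 * (1 + 2 / κ) ^ 2 with hc
  have hc0 : 0 ≤ c := by positivity
  have hI : 0 ≤ ∫ z : Vel, k z ^ 2 := integral_nonneg fun z => sq_nonneg _
  have hgc := h.contDiff.continuous
  have m1 : Measurable fun w => ENNReal.ofReal (g w * (1 + ‖w‖ ^ 2)) :=
    (Continuous.measurable (by fun_prop)).ennreal_ofReal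
  have m2 : Measurable fun w => ENNReal.ofReal (g w ^ 2 * (1 + ‖w‖ ^ 2) ^ 2) :=
    (Continuous.measurable (by fun_prop)).ennreal_ofReal
  have hpt : ∀ w, ENNReal.ofReal (fermiDensity ε g w * inner ℝ (w - μ) a ^ 2 * ‖v - w‖ ^ (-γ))
      ≤ ENNReal.ofReal c * (ENNReal.ofReal (g w * (1 + ‖w‖ ^ 2))
        + (ENNReal.ofReal (g w ^ 2 * (1 + ‖w‖ ^ 2) ^ 2) + ENNReal.ofReal (k (v - w) ^ 2))) := by
    intro w
    have hg0 := h.pos w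
    rw [← ENNReal.ofReal_add (by positivity) (by positivity),
      ← ENNReal.ofReal_add (by positivity) (by positivity), ← ENNReal.ofReal_mul hc0]
    apply ENNReal.ofReal_le_ofReal
    have h1 : inner ℝ (w - μ) a ^ 2 ≤ c * (1 + ‖w‖ ^ 2) := by
      have := (le_abs_self _).trans (abs_inner_mul_inner_le μ a a w)
      rw [ha, mul_one, mul_one, ← sq] at this
      refine this.trans ?_
      rw [hc]
      gcongr
    have h2 : ‖v - w‖ ^ (-γ) ≤ 1 + k (v - w) := by
      rcases lt_or_ge ‖v - w‖ 1 with h3 | h3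
      · rcases (norm_nonneg (v - w)).eq_or_lt with h4 | h4
        · rw [← h4]
          have : (0 : ℝ) ^ (-γ) ≤ 1 := Real.zero_rpow_le_one _
          linarith [hk0 (v - w)]
        · simp only [hk, h3, if_true]
          rw [Real.rpow_neg h4.le]
          have : ‖v - w‖ ≤ ‖v - w‖ ^ γ := by
            have := Real.rpow_le_rpow_of_exponent_ge h4 h3.le hγ.2
            rwa [Real.rpow_one] at this
          have := inv_anti₀ h4 this
          linarith
      · have := Real.rpow_le_one_of_one_le_of_nonpos h3 (show -γ ≤ 0 by linarith [hγ.1])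
        linarith [hk0 (v - w)]
    calc fermiDensity ε g w * inner ℝ (w - μ) a ^ 2 * ‖v - w‖ ^ (-γ)
        ≤ g w * (c * (1 + ‖w‖ ^ 2)) * (1 + k (v - w)) := by
          gcongr
          exact h.density_le w
      _ = c * (g w * (1 + ‖w‖ ^ 2) + (g w * (1 + ‖w‖ ^ 2)) * k (v - w)) := by ring
      _ ≤ c * (g w * (1 + ‖w‖ ^ 2) + (g w ^ 2 * (1 + ‖w‖ ^ 2) ^ 2 + k (v - w) ^ 2)) := by
          gcongr
          nlinarith [sq_nonneg (g w * (1 + ‖w‖ ^ 2) - k (v - w)), sq_nonneg (k (v - w)),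
            sq_nonneg (g w * (1 + ‖w‖ ^ 2))]
  have i1 : ∫⁻ w, ENNReal.ofReal (g w * (1 + ‖w‖ ^ 2)) = ENNReal.ofReal 4 := by
    rw [← ofReal_integral_eq_lintegral_ofReal]
    · simp_rw [mul_add, mul_one]
      rw [integral_add h.integrable h.integrable_energy, h.mass, h.energy]; norm_num
    · simp_rw [mul_add, mul_one]; exact h.integrable.add h.integrable_energy
    · exact Eventually.of_forall fun w => by
        have := h.pos w; simp only [Pi.zero_apply]; positivity
  have i3 : ∫⁻ w, ENNReal.ofReal (k (v - w) ^ 2) = ENNReal.ofReal (∫ z : Vel, k z ^ 2) := by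
    rw [lintegral_sub_left_eq_self (μ := volume) (fun z => ENNReal.ofReal (k z ^ 2)) v,
      ofReal_integral_eq_lintegral_ofReal integrable_truncated_inv_sq
        (Eventually.of_forall fun z => sq_nonneg _)]
  calc _ ≤ _ := lintegral_mono hpt
    _ = ENNReal.ofReal c * (ENNReal.ofReal 4
        + ((∫⁻ w, ENNReal.ofReal (g w ^ 2 * (1 + ‖w‖ ^ 2) ^ 2))
          + ENNReal.ofReal (∫ z : Vel, k z ^ 2))) := by
        rw [lintegral_const_mul' _ _ ENNReal.ofReal_ne_top, lintegral_add_left m1,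
          lintegral_add_left m2, i1, i3]
    _ ≤ ENNReal.ofReal c * (ENNReal.ofReal 4
        + (ENNReal.ofReal L + ENNReal.ofReal (∫ z : Vel, k z ^ 2))) := by gcongr
    _ = _ := by
        rw [← ENNReal.ofReal_add hL0 hI, ← ENNReal.ofReal_add (by norm_num) (add_nonneg hL0 hI),
          ← ENNReal.ofReal_mul hc0]

/-- In the coordinates of the basis the set lies in a box with sides `2η`, `2R`, `2R`. -/
lemma volume_slab_le (e : OrthonormalBasis (Fin 3) ℝ Vel) (i : Fin 3) {η R : ℝ} (hη : 0 ≤ η)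
    (hR : 0 ≤ R) :
    volume {w : Vel | |inner ℝ w (e i)| < η ∧ ‖w‖ < R} ≤ ENNReal.ofReal (2 * η * (2 * R) ^ 2) := by
  set r : Fin 3 → ℝ := fun j => if j = i then η else R with hr
  have hmp : MeasurePreserving fun w : Vel => WithLp.ofLp (e.repr w) :=
    (PiLp.volume_preserving_ofLp (Fin 3)).comp e.measurePreserving_repr
  have hsub : {w : Vel | |inner ℝ w (e i)| < η ∧ ‖w‖ < R}
      ⊆ (fun w : Vel => WithLp.ofLp (e.repr w)) ⁻¹' (univ.pi fun j => Ioo (-r j) (r j)) := by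
    rintro w ⟨h1, h2⟩ j -
    simp only
    have hj : WithLp.ofLp (e.repr w) j = inner ℝ w (e j) := by
      rw [e.repr_apply_apply, real_inner_comm]
    rw [hj, mem_Ioo, ← abs_lt]
    by_cases hij : j = i
    · subst hij; simpa [hr] using h1
    · simp only [hr, hij, if_false]
      refine lt_of_le_of_lt ?_ h2
      simpa using abs_real_inner_le_norm w (e j)
  refine (measure_mono hsub).trans ?_
  rw [hmp.measure_preimage (MeasurableSet.univ_pi fun j => measurableSet_Ioo).nullMeasurableSet,
    Real.volume_pi_Ioo, ← ENNReal.ofReal_prod_of_nonneg, Fin.prod_univ_three]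
  · apply ENNReal.ofReal_le_ofReal
    fin_cases i <;> simp [hr] <;> exact le_of_eq (by ring)
  · intro j _
    have : 0 ≤ r j := by simp only [hr]; split_ifs <;> assumption
    linarith

/-- Densities with bounded `L²` norm do not concentrate near planes. -/
lemma exists_directional_energy_ge {L : ℝ} (hL0 : 0 ≤ L) : ∃ c₀ : ℝ, 0 < c₀ ∧
    ∀ (κ ε : ℝ) (g : Vel → ℝ), IsAdmissible κ ε g →
      ∫⁻ v, ENNReal.ofReal (g v ^ 2 * (1 + ‖v‖ ^ 2) ^ 2) ≤ ENNReal.ofReal L →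
      ∀ (e : OrthonormalBasis (Fin 3) ℝ Vel) (i : Fin 3), c₀ ≤ ∫ v, g v * inner ℝ v (e i) ^ 2 := by
  -- Chosen so that the slab of half-width `η` and radius 4, of volume at most `128η`, contributes
  -- `(L+1) · 128η = 1/4`.
  set η : ℝ := 1 / (512 * (L + 1)) with hη
  have hη0 : 0 < η := by positivity
  refine ⟨η ^ 2 / 4, by positivity, fun κ ε g h hL e i => ?_⟩
  have hgc := h.contDiff.continuous
  have hsqi : Integrable fun v => g v ^ 2 * (1 + ‖v‖ ^ 2) ^ 2 :=
    (lintegral_ofReal_ne_top_iff_integrable (Continuous.aestronglyMeasurable (by fun_prop))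
      (Eventually.of_forall fun v => by simp only [Pi.zero_apply]; positivity)).1
      (ne_top_of_le_ne_top ENNReal.ofReal_ne_top hL)
  have hsq : ∫ v, g v ^ 2 * (1 + ‖v‖ ^ 2) ^ 2 ≤ L := by
    rw [← ofReal_integral_eq_lintegral_ofReal hsqi
      (Eventually.of_forall fun v => by simp only [Pi.zero_apply]; positivity)] at hL
    exact (ENNReal.ofReal_le_ofReal_iff hL0).1 hL
  set A := {w : Vel | |inner ℝ w (e i)| < η ∧ ‖w‖ < 4} with hA
  have hAm : MeasurableSet A := by
    have c1 : Continuous fun w : Vel => |inner ℝ w (e i)| := by fun_prop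
    have : A = {w | |inner ℝ w (e i)| < η} ∩ {w | ‖w‖ < 4} := rfl
    rw [this]
    exact (measurableSet_lt c1.measurable measurable_const).inter
      (measurableSet_lt measurable_norm measurable_const)
  have hAv := volume_slab_le e i hη0.le (show (0 : ℝ) ≤ 4 by norm_num)
  have hAr : volume.real A ≤ 2 * η * (2 * 4) ^ 2 := by
    rw [Measure.real]
    exact ENNReal.toReal_le_of_le_ofReal (by positivity) hAv
  have hAi : Integrable (A.indicator fun _ => (1 : ℝ)) :=
    (integrable_indicator_iff hAm).2 (integrableOn_const (ne_top_of_le_ne_top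
      ENNReal.ofReal_ne_top hAv))
  have hA1 : ∫ w, A.indicator (fun _ => (1 : ℝ)) w = volume.real A := by
    rw [integral_indicator hAm]; simp
  have i1 : Integrable fun v => g v * inner ℝ v (e i) ^ 2 := by
    have := h.integrable_mul (f := g) (q := fun w => inner ℝ (w - 0) (e i) * inner ℝ (w - 0) (e i)) _
      hgc (by fun_prop) h.abs_le (abs_inner_mul_inner_le 0 (e i) (e i))
    simpa [← sq] using this
  -- On the slab, `g ≤ g²/(4(L+1)) + (L+1)`; off it, either the directional or the total energy
  -- density dominates. Integration gives `1 ≤ 1/4 + 1/4 + X/η² + 3/16`, hence `X ≥ η²/4`.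
  have hpt : ∀ v, g v ≤ 1 / (4 * (L + 1)) * (g v ^ 2 * (1 + ‖v‖ ^ 2) ^ 2)
      + (L + 1) * A.indicator (fun _ => (1 : ℝ)) v + 1 / η ^ 2 * (g v * inner ℝ v (e i) ^ 2)
      + 1 / 16 * (g v * ‖v‖ ^ 2) := by
    intro v
    have hg0 := h.pos v
    have t1 : 0 ≤ 1 / (4 * (L + 1)) * (g v ^ 2 * (1 + ‖v‖ ^ 2) ^ 2) := by positivity
    have t3 : 0 ≤ 1 / η ^ 2 * (g v * inner ℝ v (e i) ^ 2) := by positivity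
    have t4 : 0 ≤ 1 / 16 * (g v * ‖v‖ ^ 2) := by positivity
    by_cases hv : v ∈ A
    · rw [indicator_of_mem hv]
      have e1 : g v ≤ 1 / (4 * (L + 1)) * g v ^ 2 + (L + 1) := by
        have : 1 / (4 * (L + 1)) * g v ^ 2 + (L + 1) - g v
            = 1 / (4 * (L + 1)) * (g v - 2 * (L + 1)) ^ 2 := by field_simp; ring
        have : 0 ≤ 1 / (4 * (L + 1)) * (g v - 2 * (L + 1)) ^ 2 := by positivity
        linarith
      have e2 : 1 / (4 * (L + 1)) * g v ^ 2
          ≤ 1 / (4 * (L + 1)) * (g v ^ 2 * (1 + ‖v‖ ^ 2) ^ 2) := by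
        gcongr
        exact le_mul_of_one_le_right (by positivity)
          (one_le_pow₀ (by nlinarith [sq_nonneg ‖v‖]))
      linarith
    · rw [indicator_of_notMem hv]
      simp only [hA, mem_ofPred_eq, not_and_or, not_lt] at hv
      rcases hv with hv | hv
      · have e1 : η ^ 2 ≤ inner ℝ v (e i) ^ 2 := by
          rw [← sq_abs (inner ℝ v (e i))]; gcongr
        have e2 : g v ≤ 1 / η ^ 2 * (g v * inner ℝ v (e i) ^ 2) := by
          calc g v = 1 / η ^ 2 * (g v * η ^ 2) := by field_simp
            _ ≤ _ := by gcongr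
        linarith
      · have e1 : (4 : ℝ) ^ 2 ≤ ‖v‖ ^ 2 := by gcongr
        have e2 := mul_le_mul_of_nonneg_left e1 hg0.le
        linarith
  have j1 := hsqi.const_mul (1 / (4 * (L + 1)))
  have j2 := hAi.const_mul (L + 1)
  have j3 := i1.const_mul (1 / η ^ 2)
  have j4 := h.integrable_energy.const_mul (1 / 16)
  have j12 : Integrable fun v => 1 / (4 * (L + 1)) * (g v ^ 2 * (1 + ‖v‖ ^ 2) ^ 2)
      + (L + 1) * A.indicator (fun _ => (1 : ℝ)) v := j1.add j2
  have j123 : Integrable fun v => 1 / (4 * (L + 1)) * (g v ^ 2 * (1 + ‖v‖ ^ 2) ^ 2)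
      + (L + 1) * A.indicator (fun _ => (1 : ℝ)) v + 1 / η ^ 2 * (g v * inner ℝ v (e i) ^ 2) :=
    j12.add j3
  have hint := integral_mono h.integrable (j123.add j4) hpt
  simp only [Pi.add_apply] at hint
  rw [h.mass, integral_add j123 j4, integral_add j12 j3, integral_add j1 j2, integral_const_mul,
    integral_const_mul, integral_const_mul, integral_const_mul, h.energy, hA1] at hint
  set X := ∫ v, g v * inner ℝ v (e i) ^ 2 with hX
  have b1 : 1 / (4 * (L + 1)) * ∫ v, g v ^ 2 * (1 + ‖v‖ ^ 2) ^ 2 ≤ 1 / 4 := by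
    calc _ ≤ 1 / (4 * (L + 1)) * (L + 1) := by gcongr; linarith
      _ = 1 / 4 := by field_simp
  have b2 : (L + 1) * volume.real A ≤ 1 / 4 := by
    calc _ ≤ (L + 1) * (2 * η * (2 * 4) ^ 2) := by gcongr
      _ = 1 / 4 := by rw [hη]; field_simp; norm_num
  have b3 : 1 / 4 ≤ 1 / η ^ 2 * X := by linarith
  have := mul_le_mul_of_nonneg_left b3 (sq_nonneg η)
  have e3 : η ^ 2 * (1 / η ^ 2 * X) = X := by field_simp
  linarith

/-! ### Diagonal covariance and the relative Fisher information -/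

/-- An orthonormal basis diagonalizing the covariance of the density `g (1 - ε g)`. -/
lemma IsAdmissible.exists_basis {κ ε : ℝ} {g : Vel → ℝ} (h : IsAdmissible κ ε g) (μ : Vel) :
    ∃ e : OrthonormalBasis (Fin 3) ℝ Vel, ∀ i j, i ≠ j →
      ∫ w, fermiDensity ε g w * (inner ℝ (w - μ) (e i) * inner ℝ (w - μ) (e j)) = 0 := by
  set F := fermiDensity ε g with hF
  set M : Matrix (Fin 3) (Fin 3) ℝ := fun k l => ∫ w, F w * ((w - μ) k * (w - μ) l) with hM
  have hMh : M.IsHermitian := by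
    refine Matrix.IsHermitian.ext fun k l => ?_
    simp only [hM, star_trivial]
    exact integral_congr_ae (Eventually.of_forall fun w => by simp only; ring)
  have hi : ∀ k l, Integrable fun w => F w * ((w - μ) k * (w - μ) l) := by
    intro k l
    have := h.integrable_mul (f := F) (q := fun w =>
        inner ℝ (w - μ) (EuclideanSpace.single k (1 : ℝ))
          * inner ℝ (w - μ) (EuclideanSpace.single l (1 : ℝ))) _
      h.continuous_density (by fun_prop) h.abs_density_le (abs_inner_mul_inner_le μ _ _)
    simpa [EuclideanSpace.inner_single_right] using this
  have hquad : ∀ x y : Vel, ∫ w, F w * (inner ℝ (w - μ) x * inner ℝ (w - μ) y)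
      = ∑ k, x k * (M.mulVec (WithLp.ofLp y)) k := by
    intro x y
    have e1 : ∀ w, F w * (inner ℝ (w - μ) x * inner ℝ (w - μ) y)
        = ∑ k, ∑ l, (x k * y l) * (F w * ((w - μ) k * (w - μ) l)) := by
      intro w
      have e2 : ∀ z : Vel, inner ℝ (w - μ) z = ∑ k, z k * (w - μ) k := fun z => by
        simp [PiLp.inner_apply, mul_comm]
      rw [e2, e2, Finset.sum_mul_sum, Finset.mul_sum]
      refine Finset.sum_congr rfl fun k _ => ?_
      rw [Finset.mul_sum]
      exact Finset.sum_congr rfl fun l _ => by ring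
    simp_rw [e1]
    rw [integral_finsetSum _ fun k _ => integrable_finsetSum _ fun l _ => (hi k l).const_mul _]
    refine Finset.sum_congr rfl fun k _ => ?_
    rw [integral_finsetSum _ fun l _ => (hi k l).const_mul _, Matrix.mulVec, dotProduct,
      Finset.mul_sum]
    refine Finset.sum_congr rfl fun l _ => ?_
    rw [integral_const_mul]
    simp only [hM]
    ring
  -- Eigenvectors of the symmetric covariance matrix; its bilinear form vanishes on distinct members
  -- of the eigenbasis.
  refine ⟨hMh.eigenvectorBasis, fun i j hij => ?_⟩
  rw [hquad, hMh.mulVec_eigenvectorBasis]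
  have h0 : inner ℝ (hMh.eigenvectorBasis i) (hMh.eigenvectorBasis j) = 0 :=
    hMh.eigenvectorBasis.orthonormal.2 hij
  have e3 : inner ℝ (hMh.eigenvectorBasis i) (hMh.eigenvectorBasis j)
      = ∑ k, hMh.eigenvectorBasis i k * hMh.eigenvectorBasis j k := by
    simp [PiLp.inner_apply, mul_comm]
  rw [e3] at h0
  simp only [Pi.smul_apply, smul_eq_mul]
  calc _ = hMh.eigenvalues j * ∑ k, hMh.eigenvectorBasis i k * hMh.eigenvectorBasis j k := by
        rw [Finset.mul_sum]; exact Finset.sum_congr rfl fun k _ => by ring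
    _ = 0 := by rw [h0, mul_zero]

lemma lintegral_ofReal_le_add {f f₁ f₂ : Vel → ℝ} {c₁ c₂ : ℝ} (hc₁ : 0 ≤ c₁) (hc₂ : 0 ≤ c₂)
    (hm : Measurable f₁) (h₁ : ∀ v, 0 ≤ f₁ v) (h₂ : ∀ v, 0 ≤ f₂ v)
    (h : ∀ v, f v ≤ c₁ * f₁ v + c₂ * f₂ v) :
    ∫⁻ v, ENNReal.ofReal (f v) ≤ ENNReal.ofReal c₁ * (∫⁻ v, ENNReal.ofReal (f₁ v))
      + ENNReal.ofReal c₂ * ∫⁻ v, ENNReal.ofReal (f₂ v) := by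
  rw [← lintegral_const_mul' _ _ ENNReal.ofReal_ne_top,
    ← lintegral_const_mul' _ _ ENNReal.ofReal_ne_top,
    ← lintegral_add_left (hm.ennreal_ofReal.const_mul _)]
  refine lintegral_mono fun v => ?_
  rw [← ENNReal.ofReal_mul hc₁, ← ENNReal.ofReal_mul hc₂,
    ← ENNReal.ofReal_add (mul_nonneg hc₁ (h₁ v)) (mul_nonneg hc₂ (h₂ v))]
  exact ENNReal.ofReal_le_ofReal (h v)

/-- From bounds on the off-diagonal quantities `C i ⟨P, e j⟩ + ⟨v, e j⟩`, `i ≠ j`, to isotropic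
control. -/
lemma lintegral_isotropic_le {F : Vel → ℝ} {P : Vel → Vel} {e : OrthonormalBasis (Fin 3) ℝ Vel}
    {C : Fin 3 → ℝ} {c₁ c₂ : ℝ} {S : ℝ≥0∞} (hFc : Continuous F) (hPc : Continuous P)
    (hF0 : ∀ v, 0 < F v) (hc₁ : 0 < c₁) (hC₁ : ∀ i, c₁ ≤ C i) (hC₂ : ∀ i, C i ≤ c₂)
    (hi : ∀ i, Integrable fun v => F v * inner ℝ v (e i) ^ 2)
    (hV₁ : ∀ i, c₁ ≤ ∫ v, F v * inner ℝ v (e i) ^ 2) (hV₂ : ∀ i, ∫ v, F v * inner ℝ v (e i) ^ 2 ≤ 3)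
    (hS : ∀ i j, i ≠ j → ∫⁻ v, ENNReal.ofReal
      (F v * (C i * inner ℝ (P v) (e j) + inner ℝ v (e j)) ^ 2) ≤ S) :
    ∫⁻ v, ENNReal.ofReal (F v * ‖C 2 • P v + v‖ ^ 2)
      ≤ ENNReal.ofReal (2 + 2 * c₂ ^ 2 / c₁ ^ 2 + 24 * c₂ ^ 2 / c₁ ^ 3) * S := by
  set X : Fin 3 → Fin 3 → Vel → ℝ := fun i j v =>
    F v * (C i * inner ℝ (P v) (e j) + inner ℝ v (e j)) ^ 2 with hX
  have hXm : ∀ i j, Measurable (X i j) := fun i j => Continuous.measurable (by fun_prop)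
  have hX0 : ∀ i j v, 0 ≤ X i j v := fun i j v => by have := hF0 v; positivity
  have hCpos : ∀ i, 0 < C i := fun i => hc₁.trans_le (hC₁ i)
  have hsqle : ∀ i, C i ^ 2 ≤ c₂ ^ 2 := fun i => by have := (hCpos i).le; gcongr; exact hC₂ i
  have hc₂ : 0 < c₂ := (hCpos 0).trans_le (hC₂ 0)
  set d := (C 0 - C 2) ^ 2 with hd
  have hd0 : 0 ≤ d := sq_nonneg _
  have hVof : ∀ i, ∫⁻ v, ENNReal.ofReal (F v * inner ℝ v (e i) ^ 2)
      = ENNReal.ofReal (∫ v, F v * inner ℝ v (e i) ^ 2) := fun i =>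
    (ofReal_integral_eq_lintegral_ofReal (hi i) (Eventually.of_forall fun v => by
      have := hF0 v; simp only [Pi.zero_apply]; positivity)).symm
  -- Direction 1 differs from both 0 and 2, so both estimates apply to it. Eliminating `P` through
  -- `C₀(C₂p+q) - C₂(C₀p+q) = (C₀-C₂)q` bounds the spread of the variances, because the energy along
  -- direction 1 is at least `c₁`.
  have hd1 : ENNReal.ofReal (d * c₁) ≤ ENNReal.ofReal (4 * c₂ ^ 2) * S := by
    calc ENNReal.ofReal (d * c₁)
        ≤ ENNReal.ofReal (d * ∫ v, F v * inner ℝ v (e 1) ^ 2) := by gcongr; exact hV₁ 1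
      _ = ∫⁻ v, ENNReal.ofReal (d * (F v * inner ℝ v (e 1) ^ 2)) := by
          rw [ENNReal.ofReal_mul hd0, ← hVof, ← lintegral_const_mul' _ _ ENNReal.ofReal_ne_top]
          congr 1 with v
          rw [ENNReal.ofReal_mul hd0]
      _ ≤ ENNReal.ofReal (2 * c₂ ^ 2) * (∫⁻ v, ENNReal.ofReal (X 2 1 v))
          + ENNReal.ofReal (2 * c₂ ^ 2) * ∫⁻ v, ENNReal.ofReal (X 0 1 v) := by
          refine lintegral_ofReal_le_add (by positivity) (by positivity) (hXm 2 1) (hX0 2 1)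
            (hX0 0 1) fun v => ?_
          have := hF0 v
          simp only [hX, hd]
          generalize inner ℝ (P v) (e 1) = p
          generalize inner ℝ v (e 1) = q
          have e1 : (C 0 - C 2) ^ 2 * q ^ 2 ≤ 2 * (C 0 ^ 2 * (C 2 * p + q) ^ 2)
              + 2 * (C 2 ^ 2 * (C 0 * p + q) ^ 2) := by
            nlinarith [sq_nonneg (C 0 * (C 2 * p + q) + C 2 * (C 0 * p + q))]
          have e2 := mul_le_mul_of_nonneg_right (hsqle 0) (sq_nonneg (C 2 * p + q))
          have e3 := mul_le_mul_of_nonneg_right (hsqle 2) (sq_nonneg (C 0 * p + q))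
          calc (C 0 - C 2) ^ 2 * (F v * q ^ 2) = F v * ((C 0 - C 2) ^ 2 * q ^ 2) := by ring
            _ ≤ F v * (2 * (c₂ ^ 2 * (C 2 * p + q) ^ 2) + 2 * (c₂ ^ 2 * (C 0 * p + q) ^ 2)) := by
                gcongr; linarith
            _ = _ := by ring
      _ ≤ ENNReal.ofReal (2 * c₂ ^ 2) * S + ENNReal.ofReal (2 * c₂ ^ 2) * S := by
          gcongr
          · exact hS 2 1 (by decide)
          · exact hS 0 1 (by decide)
      _ = _ := by
          rw [← add_mul, ← ENNReal.ofReal_add (by positivity) (by positivity)]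
          congr 2; ring
  -- The missing diagonal term: `C₀(C₂p+q) = C₂(C₀p+q) + (C₀-C₂)q`. The first part is an
  -- off-diagonal quantity, and the second is controlled by the spread just bounded and by energy at
  -- most 3.
  have hQ22 : ∫⁻ v, ENNReal.ofReal (X 2 2 v)
      ≤ ENNReal.ofReal (2 * c₂ ^ 2 / c₁ ^ 2 + 24 * c₂ ^ 2 / c₁ ^ 3) * S := by
    calc ∫⁻ v, ENNReal.ofReal (X 2 2 v)
        ≤ ENNReal.ofReal (2 * c₂ ^ 2 / c₁ ^ 2) * (∫⁻ v, ENNReal.ofReal (X 0 2 v))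
          + ENNReal.ofReal (2 * d / c₁ ^ 2) * ∫⁻ v, ENNReal.ofReal (F v * inner ℝ v (e 2) ^ 2) := by
          refine lintegral_ofReal_le_add (by positivity) (by positivity) (hXm 0 2) (hX0 0 2)
            (fun v => by have := hF0 v; positivity) fun v => ?_
          have hF := hF0 v
          simp only [hX, hd]
          generalize inner ℝ (P v) (e 2) = p
          generalize inner ℝ v (e 2) = q
          have h0 := hCpos 0
          have e1 : C 0 ^ 2 * (C 2 * p + q) ^ 2 ≤ 2 * (C 2 ^ 2 * (C 0 * p + q) ^ 2)
              + 2 * ((C 0 - C 2) ^ 2 * q ^ 2) := by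
            nlinarith [sq_nonneg (C 2 * (C 0 * p + q) - (C 0 - C 2) * q)]
          have e2 := mul_le_mul_of_nonneg_right (hsqle 2) (sq_nonneg (C 0 * p + q))
          have e3 : c₁ ^ 2 * (C 2 * p + q) ^ 2 ≤ C 0 ^ 2 * (C 2 * p + q) ^ 2 := by
            gcongr; exact hC₁ 0
          have e4 : (C 2 * p + q) ^ 2 ≤ (2 * (c₂ ^ 2 * (C 0 * p + q) ^ 2)
              + 2 * ((C 0 - C 2) ^ 2 * q ^ 2)) / c₁ ^ 2 := by
            rw [le_div_iff₀ (by positivity)]; linarith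
          calc F v * (C 2 * p + q) ^ 2 ≤ F v * ((2 * (c₂ ^ 2 * (C 0 * p + q) ^ 2)
              + 2 * ((C 0 - C 2) ^ 2 * q ^ 2)) / c₁ ^ 2) := by gcongr
            _ = _ := by ring
      _ ≤ ENNReal.ofReal (2 * c₂ ^ 2 / c₁ ^ 2) * S
          + ENNReal.ofReal (2 * d / c₁ ^ 2) * ENNReal.ofReal 3 := by
          rw [hVof]
          gcongr
          · exact hS 0 2 (by decide)
          · exact hV₂ 2
      _ = ENNReal.ofReal (2 * c₂ ^ 2 / c₁ ^ 2) * S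
          + ENNReal.ofReal (6 / c₁ ^ 3) * ENNReal.ofReal (d * c₁) := by
          rw [← ENNReal.ofReal_mul (by positivity), ← ENNReal.ofReal_mul (by positivity)]
          congr 2
          field_simp
          ring
      _ ≤ ENNReal.ofReal (2 * c₂ ^ 2 / c₁ ^ 2) * S
          + ENNReal.ofReal (6 / c₁ ^ 3) * (ENNReal.ofReal (4 * c₂ ^ 2) * S) := by gcongr
      _ = _ := by
          rw [← mul_assoc, ← ENNReal.ofReal_mul (by positivity), ← add_mul,
            ← ENNReal.ofReal_add (by positivity) (by positivity)]
          congr 2; ring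
  have hsum : ∀ v, ENNReal.ofReal (F v * ‖C 2 • P v + v‖ ^ 2)
      = ENNReal.ofReal (X 2 0 v) + (ENNReal.ofReal (X 2 1 v) + ENNReal.ofReal (X 2 2 v)) := by
    intro v
    rw [← ENNReal.ofReal_add (hX0 2 1 v) (hX0 2 2 v),
      ← ENNReal.ofReal_add (hX0 2 0 v) (add_nonneg (hX0 2 1 v) (hX0 2 2 v)),
      ← e.sum_sq_inner_left, Fin.sum_univ_three]
    simp only [hX, inner_add_left, real_inner_smul_left]
    congr 1; ring
  simp_rw [hsum]
  rw [lintegral_add_left (hXm 2 0).ennreal_ofReal, lintegral_add_left (hXm 2 1).ennreal_ofReal]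
  calc _ ≤ S + (S + ENNReal.ofReal (2 * c₂ ^ 2 / c₁ ^ 2 + 24 * c₂ ^ 2 / c₁ ^ 3) * S) := by
        gcongr
        · exact hS 2 0 (by decide)
        · exact hS 2 1 (by decide)
    _ = _ := by
        rw [add_assoc (2 : ℝ), ENNReal.ofReal_add (p := 2) (by norm_num) (by positivity), add_mul,
          ENNReal.ofReal_ofNat, two_mul S, add_assoc]

/-- The entropy production controls a relative Fisher information. -/
theorem exists_fisher_le {κ L : ℝ} (hκ : 0 < κ) (hL0 : 0 ≤ L) : ∃ C : ℝ, 0 < C ∧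
    ∀ (γ ε : ℝ) (g : Vel → ℝ), γ ∈ Icc (0 : ℝ) 1 → IsAdmissible κ ε g →
      ∫⁻ v, ENNReal.ofReal (g v ^ 2 * (1 + ‖v‖ ^ 2) ^ 2) ≤ ENNReal.ofReal L →
      ∃ β : ℝ, 0 < β ∧ ∫⁻ v, ENNReal.ofReal
        (1 / (4 * β) * (fermiDensity ε g v * ‖(2 * β) • v + scoreField ε g v‖ ^ 2))
          ≤ ENNReal.ofReal C * entropyProduction γ ε g := by
  obtain ⟨c₀, hc₀, hlow⟩ := exists_directional_energy_ge hL0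
  set K : ℝ := 2 * (1 + 2 / κ) ^ 2
    * (4 + (L + ∫ z : Vel, (if ‖z‖ < 1 then ‖z‖⁻¹ else 0) ^ 2)) with hK
  have hK0 : 0 < K := by
    have : 0 ≤ ∫ z : Vel, (if ‖z‖ < 1 then ‖z‖⁻¹ else 0) ^ 2 := integral_nonneg fun z => sq_nonneg _
    positivity
  set c₁ := κ * c₀ with hc₁
  have hc₁0 : 0 < c₁ := by positivity
  -- Variance bounds about the centroid: `κ` times the directional energy from below, total energy
  -- plus `|μ|²` from above.
  set c₂ := 3 + (2 / κ) ^ 2 with hc₂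
  set Γ := 2 + 2 * c₂ ^ 2 / c₁ ^ 2 + 24 * c₂ ^ 2 / c₁ ^ 3 with hΓ
  have hΓ0 : 0 < Γ := by positivity
  refine ⟨1 / (2 * c₁) * (Γ * (K * 2)), by positivity, fun γ ε g hγ h hL => ?_⟩
  obtain ⟨μ, hμ, hcen⟩ := h.exists_centroid
  obtain ⟨e, he⟩ := h.exists_basis μ
  have hgc := h.contDiff.continuous
  have hFc := h.continuous_density
  have hnorm : ∀ i, ‖e i‖ = 1 := fun i => e.orthonormal.1 i
  set F := fermiDensity ε g with hF
  set P := scoreField ε g with hP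
  set C : Fin 3 → ℝ := fun i => ∫ w, F w * inner ℝ (w - μ) (e i) ^ 2 with hC
  have hsqi : ∀ (f : Vel → ℝ), Continuous f → (∀ v, |f v| ≤ g v) → ∀ (m x : Vel),
      Integrable fun w => f w * inner ℝ (w - m) x ^ 2 := by
    intro f hf hfg m x
    have := h.integrable_mul (f := f) (q := fun w => inner ℝ (w - m) x * inner ℝ (w - m) x) _
      hf (by fun_prop) hfg (abs_inner_mul_inner_le m x x)
    simpa [← sq] using this
  have hlow' : ∀ m i, c₁ ≤ ∫ w, F w * inner ℝ (w - m) (e i) ^ 2 := by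
    intro m i
    have h1 := integral_mono ((hsqi g hgc h.abs_le m (e i)).const_mul κ)
      (hsqi F hFc h.abs_density_le m (e i)) (fun w => by
        simp only
        rw [← mul_assoc]
        exact mul_le_mul_of_nonneg_right (h.le_density w) (sq_nonneg _))
    rw [integral_const_mul, h.integral_inner_sub_sq] at h1
    refine le_trans ?_ h1
    rw [hc₁]
    gcongr
    have := hlow κ ε g h hL e i
    linarith [sq_nonneg (inner ℝ m (e i))]
  have hup : ∀ m i, ∫ w, F w * inner ℝ (w - m) (e i) ^ 2 ≤ 3 + inner ℝ m (e i) ^ 2 := by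
    intro m i
    have h1 := integral_mono (hsqi F hFc h.abs_density_le m (e i)) (hsqi g hgc h.abs_le m (e i))
      (fun w => mul_le_mul_of_nonneg_right (h.density_le w) (sq_nonneg _))
    rw [h.integral_inner_sub_sq] at h1
    linarith [h.integral_inner_sq_le (hnorm i)]
  have hC₁ : ∀ i, c₁ ≤ C i := fun i => hlow' μ i
  have hC₂ : ∀ i, C i ≤ c₂ := fun i => (hup μ i).trans (by
    have : |inner ℝ μ (e i)| ≤ 2 / κ := by
      refine (abs_real_inner_le_norm _ _).trans ?_
      rw [hnorm, mul_one]; exact hμ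
    rw [hc₂, ← sq_abs]
    gcongr)
  have hS : ∀ i j, i ≠ j → ∫⁻ v, ENNReal.ofReal
      (F v * (C i * inner ℝ (P v) (e j) + inner ℝ v (e j)) ^ 2)
        ≤ ENNReal.ofReal K * (2 * entropyProduction γ ε g) := fun i j hij =>
    lintegral_direction_le hγ.1 h.contDiff h.pos h.lt_one h.eps_nonneg h.integrable
      h.integrable_energy h.mass (hnorm i) (hnorm j) (e.orthonormal.2 hij)
      (h.integral_inner_eq_zero _) (hcen _) (he i j hij)
      (lintegral_kernel_le h hγ hL hL0 hμ (hnorm i))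
  have iso := lintegral_isotropic_le hFc (continuous_scoreField h.contDiff h.pos h.lt_one)
    h.density_pos hc₁0 hC₁ hC₂
    (fun i => by simpa using hsqi F hFc h.abs_density_le 0 (e i))
    (fun i => by simpa using hlow' 0 i) (fun i => by simpa using hup 0 i) hS
  have hC20 : 0 < C 2 := hc₁0.trans_le (hC₁ 2)
  -- With `2β = 1/C₂` one has `C₂P + v = C₂(P + 2βv)`, so the temperature of the Gaussian is read
  -- off from the variance along one basis vector.
  refine ⟨1 / (2 * C 2), by positivity, ?_⟩
  have hpt : ∀ v, ENNReal.ofReal (1 / (4 * (1 / (2 * C 2)))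
      * (F v * ‖(2 * (1 / (2 * C 2))) • v + P v‖ ^ 2))
      ≤ ENNReal.ofReal (1 / (2 * c₁)) * ENNReal.ofReal (F v * ‖C 2 • P v + v‖ ^ 2) := by
    intro v
    have hF0 := h.density_pos v
    rw [← ENNReal.ofReal_mul (by positivity)]
    apply ENNReal.ofReal_le_ofReal
    have e1 : C 2 • P v + v = C 2 • ((2 * (1 / (2 * C 2))) • v + P v) := by
      rw [smul_add, smul_smul, show C 2 * (2 * (1 / (2 * C 2))) = 1 by field_simp, one_smul,
        add_comm]
    rw [e1, norm_smul, mul_pow, Real.norm_of_nonneg hC20.le]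
    have hN := sq_nonneg ‖(2 * (1 / (2 * C 2))) • v + P v‖
    generalize ‖(2 * (1 / (2 * C 2))) • v + P v‖ ^ 2 = N at hN ⊢
    have h1 : 1 ≤ C 2 / c₁ := (one_le_div hc₁0).2 (hC₁ 2)
    calc 1 / (4 * (1 / (2 * C 2))) * (F v * N) = C 2 / 2 * (F v * N) * 1 := by field_simp; ring
      _ ≤ C 2 / 2 * (F v * N) * (C 2 / c₁) := by gcongr
      _ = _ := by field_simp
  calc _ ≤ _ := lintegral_mono hpt
    _ = ENNReal.ofReal (1 / (2 * c₁)) * ∫⁻ v, ENNReal.ofReal (F v * ‖C 2 • P v + v‖ ^ 2) :=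
        lintegral_const_mul' _ _ ENNReal.ofReal_ne_top
    _ ≤ ENNReal.ofReal (1 / (2 * c₁)) * (ENNReal.ofReal Γ
          * (ENNReal.ofReal K * (2 * entropyProduction γ ε g))) := by gcongr
    _ = _ := by
        rw [ENNReal.ofReal_mul (p := 1 / (2 * c₁)) (by positivity), ENNReal.ofReal_mul hΓ0.le,
          ENNReal.ofReal_mul hK0.le, ENNReal.ofReal_ofNat]
        ring

/-! ### Scaling and the Fermi-Dirac parameters -/

section Scaling

variable {s : ℝ}

lemma integral_comp_smul_vel (hs : 0 < s) (f : Vel → ℝ) :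
    ∫ v, f (s • v) = (s ^ 3)⁻¹ * ∫ v, f v := by
  rw [Measure.integral_comp_smul]
  simp only [finrank_euclideanSpace, Fintype.card_fin, smul_eq_mul]
  rw [abs_of_pos (by positivity)]

lemma integral_comp_smul_mul_sq (hs : 0 < s) (f : Vel → ℝ) :
    ∫ v, f (s • v) * ‖v‖ ^ 2 = (s ^ 5)⁻¹ * ∫ v, f v * ‖v‖ ^ 2 := by
  have e : ∀ v : Vel, f (s • v) * ‖v‖ ^ 2 = (s ^ 2)⁻¹ * (f (s • v) * ‖s • v‖ ^ 2) := by
    intro v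
    rw [norm_smul, Real.norm_of_nonneg hs.le]
    field_simp
  simp_rw [e]
  rw [integral_const_mul, integral_comp_smul_vel hs fun v => f v * ‖v‖ ^ 2]
  field_simp

lemma integrable_comp_smul_mul_sq (hs : 0 < s) {f : Vel → ℝ}
    (hf : Integrable fun v => f v * ‖v‖ ^ 2) : Integrable fun v => f (s • v) * ‖v‖ ^ 2 := by
  refine ((hf.comp_smul hs.ne').const_mul (s ^ 2)⁻¹).congr (Eventually.of_forall fun v => ?_)
  simp only [norm_smul, Real.norm_of_nonneg hs.le]
  field_simp

end Scaling

lemma integral_even_smul_eq_zero {f : Vel → ℝ} (hf : ∀ v, f (-v) = f v) : ∫ v, f v • v = 0 := by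
  have h := integral_neg_eq_self (fun v : Vel => f v • v) volume
  simp only [hf, smul_neg, integral_neg] at h
  have h2 : (2 : ℝ) • ∫ v, f v • v = 0 := by
    rw [two_smul]; nth_rewrite 1 [← h]; exact neg_add_cancel _
  exact (smul_eq_zero.1 h2).resolve_left two_ne_zero

/-- The pointwise estimate comparing a strongly degenerate Fermi-Dirac profile with a density
obeying a strict Pauli bound. -/
lemma fermiDirac_sub_mul_le {κ Λ G : ℝ} (hκ : 0 ≤ κ) (hG0 : 0 ≤ G) (hG1 : G ≤ 1 - κ) (hΛ : 0 ≤ Λ)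
    (v : Vel) :
    (fermiDirac 1 (Real.exp Λ) 1 v - G) * (‖v‖ ^ 2 - Λ)
      ≤ (if ‖v‖ ^ 2 ≤ 2 * Λ then 1 else 0) + Real.exp (-(1 / 4) * ‖v‖ ^ 2)
        - κ * (if ‖v‖ ^ 2 < Λ / 2 then Λ / 2 else 0) := by
  have hn : fermiDirac 1 (Real.exp Λ) 1 v
      = Real.exp (Λ - ‖v‖ ^ 2) / (1 + Real.exp (Λ - ‖v‖ ^ 2)) := by
    unfold fermiDirac
    rw [one_mul, ← Real.exp_add]
    ring_nf
  rw [hn]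
  have hx0 := sq_nonneg ‖v‖
  generalize ‖v‖ ^ 2 = x at hx0 ⊢
  have hE := Real.exp_pos (Λ - x)
  have hq := Real.exp_pos (-(1 / 4) * x)
  have hye : ∀ y : ℝ, y * Real.exp (-y) ≤ 1 := fun y => by
    have h1 := Real.add_one_le_exp y
    have h2 := mul_le_mul_of_nonneg_right (show y ≤ Real.exp y by linarith) (Real.exp_pos (-y)).le
    rwa [← Real.exp_add, add_neg_cancel, Real.exp_zero] at h2
  -- Inside `|v|² ≤ Λ` the profile is 1 up to `e^{-(Λ-x)}` while `G ≤ 1-κ`, which yields the gain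
  -- `κ(Λ-x)` with an error at most 1.
  rcases le_or_gt x Λ with h | h
  · rw [if_pos (by linarith)]
    have h1 : 1 - Real.exp (Λ - x) / (1 + Real.exp (Λ - x)) ≤ Real.exp (-(Λ - x)) := by
      rw [Real.exp_neg]
      have : 1 - Real.exp (Λ - x) / (1 + Real.exp (Λ - x)) = (1 + Real.exp (Λ - x))⁻¹ := by
        field_simp; ring
      rw [this]
      exact inv_anti₀ hE (by linarith)
    have h2 : κ * (if x < Λ / 2 then Λ / 2 else 0) ≤ κ * (Λ - x) := by
      gcongr
      split_ifs <;> linarith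
    have h3 := mul_le_mul_of_nonneg_right
      (show G - Real.exp (Λ - x) / (1 + Real.exp (Λ - x)) ≤ Real.exp (-(Λ - x)) - κ by linarith)
      (show 0 ≤ Λ - x by linarith)
    have h4 := hye (Λ - x)
    nlinarith
  · rw [if_neg (show ¬ x < Λ / 2 by linarith), mul_zero, sub_zero]
    have h1 : Real.exp (Λ - x) / (1 + Real.exp (Λ - x)) ≤ Real.exp (-(x - Λ)) := by
      rw [neg_sub]
      exact div_le_self hE.le (by linarith)
    have h2 := mul_le_mul_of_nonneg_right
      (show Real.exp (Λ - x) / (1 + Real.exp (Λ - x)) - G ≤ Real.exp (-(x - Λ)) by linarith)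
      (show 0 ≤ x - Λ by linarith)
    refine h2.trans ?_
    -- Outside, the profile is at most `e^{-(x-Λ)}`. Up to `2Λ` the bound `y e^{-y} ≤ 1` suffices;
    -- beyond it `x-Λ > x/2`, which gives the decay `e^{-x/4}`.
    split_ifs with h3
    · linarith [hye (x - Λ)]
    · push Not at h3
      have h4 := hye ((x - Λ) / 2)
      have h5 : (x - Λ) / 2 ≤ Real.exp ((x - Λ) / 2) / 2 := by
        have h6 := Real.add_one_le_exp ((x - Λ) / 4)
        have h7 : Real.exp ((x - Λ) / 2) = Real.exp ((x - Λ) / 4) ^ 2 := by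
          rw [← Real.exp_nat_mul]; congr 1; push_cast; ring
        rw [h7]
        nlinarith [sq_nonneg ((x - Λ) / 4 - 1), sq_nonneg (Real.exp ((x - Λ) / 4) - ((x - Λ) / 4 + 1))]
      have h8 : Real.exp (-(x - Λ)) * Real.exp ((x - Λ) / 2) = Real.exp (-((x - Λ) / 2)) := by
        rw [← Real.exp_add]; congr 1; ring
      have h9 : Real.exp (-((x - Λ) / 2)) ≤ Real.exp (-(1 / 4) * x) :=
        Real.exp_le_exp.2 (by linarith)
      have h10 := mul_le_mul_of_nonneg_left h5 (Real.exp_pos (-(x - Λ))).le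
      linarith

/-- For equal masses, the energy difference is the integral of `(M-G)(|v|²-Λ)`, with `M` the profile
and `Λ = log A`. With `r² = Λ/2` the pointwise estimate bounds it by `8r³ω + J - κr⁵ω`, where `ω` is
the volume of the unit ball. This is negative once `r` is large: the gain from the strict Pauli
bound outgrows the boundary layer. -/
lemma exists_degenerate {κ : ℝ} (hκ : 0 < κ) : ∃ A₁ : ℝ, 1 ≤ A₁ ∧ ∀ A, A₁ ≤ A →
    ∀ G : Vel → ℝ, (∀ v, 0 ≤ G v) → (∀ v, G v ≤ 1 - κ) → Integrable G →
      (Integrable fun v => G v * ‖v‖ ^ 2) → ∫ v, G v = ∫ v, fermiDirac 1 A 1 v →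
      ∫ v, fermiDirac 1 A 1 v * ‖v‖ ^ 2 < ∫ v, G v * ‖v‖ ^ 2 := by
  set J := ∫ v : Vel, Real.exp (-(1 / 4) * ‖v‖ ^ 2) with hJ
  set ω := volume.real (Metric.closedBall (0 : Vel) 1) with hω
  have hJi : Integrable fun v : Vel => Real.exp (-(1 / 4) * ‖v‖ ^ 2) := by
    have := integrable_gauss 1 (show (0 : ℝ) < 1 / 4 by norm_num)
    refine this.congr (Eventually.of_forall fun v => ?_)
    simp [gauss]
  have hJ0 : 0 ≤ J := integral_nonneg fun v => (Real.exp_pos _).le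
  have hω0 : 0 < ω := by
    rw [hω, Measure.real, ENNReal.toReal_pos_iff]
    exact ⟨Metric.measure_closedBall_pos _ _ one_pos, measure_closedBall_lt_top⟩
  have hball : ∀ r : ℝ, 0 ≤ r → volume.real (Metric.closedBall (0 : Vel) r) = r ^ 3 * ω := by
    intro r hr
    rw [hω, Measure.real, Measure.real, Measure.addHaar_closedBall' _ _ hr, ENNReal.toReal_mul,
      ENNReal.toReal_ofReal (by positivity)]
    simp
  -- Ensures `κr² ≥ 9 + J/ω` for `r ≥ r₀`, that is, a gain exceeding `8r³ω + J` by at least `r³ω`.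
  set r₀ := max 1 (Real.sqrt ((9 + J / ω) / κ)) with hr₀
  have hr₀1 : 1 ≤ r₀ := le_max_left _ _
  refine ⟨Real.exp (2 * r₀ ^ 2), Real.one_le_exp (by positivity), ?_⟩
  intro A hA G hG0 hG1 hGi hGe hmass
  have hA0 : 0 < A := (Real.exp_pos _).trans_le hA
  set Λ := Real.log A with hΛ
  have hAΛ : A = Real.exp Λ := (Real.exp_log hA0).symm
  have hΛr : 2 * r₀ ^ 2 ≤ Λ := by rw [hΛ]; exact (Real.le_log_iff_exp_le hA0).2 hA
  have hΛ0 : 0 ≤ Λ := le_trans (by positivity) hΛr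
  set r := Real.sqrt (Λ / 2) with hr
  have hr2 : r ^ 2 = Λ / 2 := Real.sq_sqrt (by positivity)
  have hr0r : r₀ ≤ r := Real.le_sqrt_of_sq_le (by linarith)
  have hr1 : 1 ≤ r := hr₀1.trans hr0r
  have hκr : 9 + J / ω ≤ κ * r ^ 2 := by
    have h1 : Real.sqrt ((9 + J / ω) / κ) ≤ r := (le_max_right _ _).trans hr0r
    have h2 : (9 + J / ω) / κ ≤ r ^ 2 := (Real.sqrt_le_left (by positivity)).1 h1
    rwa [div_le_iff₀' hκ] at h2
  set B₁ := Metric.closedBall (0 : Vel) (2 * r) with hB₁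
  set B₂ := Metric.ball (0 : Vel) r with hB₂
  have e₁ : ∀ v : Vel, (if ‖v‖ ^ 2 ≤ 2 * Λ then (1 : ℝ) else 0) = B₁.indicator (fun _ => 1) v := by
    intro v
    have : ‖v‖ ^ 2 ≤ 2 * Λ ↔ v ∈ B₁ := by
      rw [hB₁, mem_closedBall_zero_iff, show 2 * Λ = (2 * r) ^ 2 by rw [mul_pow, hr2]; ring]
      exact sq_le_sq₀ (norm_nonneg _) (by positivity)
    by_cases hv : v ∈ B₁
    · rw [if_pos (this.2 hv), indicator_of_mem hv]
    · rw [if_neg (mt this.1 hv), indicator_of_notMem hv]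
  have e₂ : ∀ v : Vel, (if ‖v‖ ^ 2 < Λ / 2 then Λ / 2 else 0)
      = B₂.indicator (fun _ => r ^ 2) v := by
    intro v
    have : ‖v‖ ^ 2 < Λ / 2 ↔ v ∈ B₂ := by
      rw [hB₂, mem_ball_zero_iff, ← hr2]
      exact sq_lt_sq₀ (norm_nonneg _) (by positivity)
    by_cases hv : v ∈ B₂
    · rw [if_pos (this.2 hv), indicator_of_mem hv, hr2]
    · rw [if_neg (mt this.1 hv), indicator_of_notMem hv]
  have i₁ : Integrable (B₁.indicator fun _ => (1 : ℝ)) :=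
    (integrable_indicator_iff measurableSet_closedBall).2
      (integrableOn_const measure_closedBall_lt_top.ne)
  have i₂ : Integrable (B₂.indicator fun _ => r ^ 2) :=
    (integrable_indicator_iff measurableSet_ball).2 (integrableOn_const measure_ball_lt_top.ne)
  have v₁ : ∫ v, B₁.indicator (fun _ => (1 : ℝ)) v = 8 * r ^ 3 * ω := by
    rw [integral_indicator measurableSet_closedBall, setIntegral_const, hball _ (by positivity)]
    simp only [smul_eq_mul]; ring
  have v₂ : ∫ v, B₂.indicator (fun _ => r ^ 2) v = r ^ 5 * ω := by
    have : volume.real B₂ = r ^ 3 * ω := by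
      rw [← hball r (by positivity), Measure.real, Measure.real, hB₂,
        Measure.addHaar_closedBall_eq_addHaar_ball]
    rw [integral_indicator measurableSet_ball, setIntegral_const, this]
    simp only [smul_eq_mul]; ring
  have hni := integrable_fermiDirac (b := 1) zero_le_one hA0 one_pos
  have hne := integrable_fermiDirac_mul_sq (b := 1) zero_le_one hA0 one_pos
  have hl : ∫ v, (fermiDirac 1 A 1 v - G v) * (‖v‖ ^ 2 - Λ)
      = (∫ v, fermiDirac 1 A 1 v * ‖v‖ ^ 2) - ∫ v, G v * ‖v‖ ^ 2 := by
    have e : ∀ v, (fermiDirac 1 A 1 v - G v) * (‖v‖ ^ 2 - Λ)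
        = (fermiDirac 1 A 1 v * ‖v‖ ^ 2 - G v * ‖v‖ ^ 2)
          - Λ * (fermiDirac 1 A 1 v - G v) := fun v => by ring
    simp_rw [e]
    have i4 : Integrable fun v => fermiDirac 1 A 1 v * ‖v‖ ^ 2 - G v * ‖v‖ ^ 2 := hne.sub hGe
    have i5 : Integrable fun v => Λ * (fermiDirac 1 A 1 v - G v) := (hni.sub hGi).const_mul Λ
    rw [integral_sub i4 i5, integral_const_mul,
      integral_sub hni hGi, hmass, sub_self, mul_zero, sub_zero]
    exact integral_sub hne hGe
  have hli : Integrable fun v => (fermiDirac 1 A 1 v - G v) * (‖v‖ ^ 2 - Λ) := by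
    have := (hne.sub hGe).sub ((hni.sub hGi).const_mul Λ)
    refine this.congr (Eventually.of_forall fun v => ?_)
    simp only [Pi.sub_apply]; ring
  have i12 : Integrable fun v => B₁.indicator (fun _ => (1 : ℝ)) v
      + Real.exp (-(1 / 4) * ‖v‖ ^ 2) := i₁.add hJi
  have i3 : Integrable fun v => B₁.indicator (fun _ => (1 : ℝ)) v
      + Real.exp (-(1 / 4) * ‖v‖ ^ 2) - κ * B₂.indicator (fun _ => r ^ 2) v :=
    i12.sub (i₂.const_mul κ)
  have hmono := integral_mono hli i3 fun v => by
    have := fermiDirac_sub_mul_le hκ.le (hG0 v) (hG1 v) hΛ0 v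
    rw [e₁, e₂, ← hAΛ] at this
    exact this
  rw [hl, integral_sub i12 (i₂.const_mul κ), integral_add i₁ hJi, integral_const_mul, v₁, v₂,
    ← hJ] at hmono
  have h1 : J < κ * (r ^ 5 * ω) - 8 * r ^ 3 * ω := by
    have h2 := mul_le_mul_of_nonneg_right hκr (show 0 ≤ r ^ 3 * ω by positivity)
    have h3 : (9 + J / ω) * (r ^ 3 * ω) = 8 * r ^ 3 * ω + r ^ 3 * ω + r ^ 3 * J := by
      field_simp; ring
    have h4 : J ≤ r ^ 3 * J := le_mul_of_one_le_left hJ0 (one_le_pow₀ hr1)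
    have h5 : 0 < r ^ 3 * ω := by positivity
    nlinarith
  linarith

section Parameters

lemma integral_gauss_pos {a b : ℝ} (ha : 0 < a) (hb : 0 < b) : 0 < ∫ v, gauss a b v :=
  integral_pos_of_pos (NeZero.ne _) (gauss_pos ha) (integrable_gauss a hb)

lemma integral_gauss_mul_sq_pos {a b : ℝ} (ha : 0 < a) (hb : 0 < b) :
    0 < ∫ v, gauss a b v * ‖v‖ ^ 2 := by
  have h0 : ∀ v, 0 ≤ gauss a b v * ‖v‖ ^ 2 := fun v =>
    mul_nonneg (gauss_pos ha v).le (by positivity)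
  refine lt_of_le_of_ne (integral_nonneg h0) fun h => ?_
  have h2 := (integral_eq_zero_iff_of_nonneg h0 (integrable_gauss_mul_sq a hb)).1 h.symm
  have h3 := Continuous.ae_eq_iff_eq (μ := (volume : Measure Vel))
    ((continuous_gauss a b).mul (by fun_prop)) continuous_zero |>.1 h2
  have h4 := congrFun h3 (EuclideanSpace.single 0 1)
  simp [(gauss_pos (β := b) ha _).ne'] at h4

lemma gauss_smul (a s : ℝ) (v : Vel) : gauss a (s ^ 2) v = gauss a 1 (s • v) := by
  unfold gauss
  rw [norm_smul, mul_pow, Real.norm_eq_abs, sq_abs]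
  congr 2; ring

/-- Up to a dilation by `s = √b` and a factor `1/ε`, the profile depends on `A = εa` alone, so the
problem has one parameter. -/
lemma fermiDirac_smul {ε a : ℝ} (s : ℝ) (hε : ε ≠ 0) (v : Vel) :
    fermiDirac ε a (s ^ 2) v = ε⁻¹ * fermiDirac 1 (ε * a) 1 (s • v) := by
  rw [fermiDirac_eq, fermiDirac_eq, gauss_smul]
  unfold gauss
  have : 1 * (ε * a * Real.exp (-1 * ‖s • v‖ ^ 2)) = ε * (a * Real.exp (-1 * ‖s • v‖ ^ 2)) := by
    ring
  rw [this]
  field_simp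

lemma fermiDirac_neg (ε a b : ℝ) (v : Vel) : fermiDirac ε a b (-v) = fermiDirac ε a b v := by
  unfold fermiDirac; rw [norm_neg]

variable {κ ε : ℝ} {g : Vel → ℝ}

/-- A degenerate Fermi-Dirac profile of unit mass has less energy than an admissible density. -/
lemma IsAdmissible.energy_lt {A₁ : ℝ} (hA₁ : ∀ A, A₁ ≤ A →
      ∀ G : Vel → ℝ, (∀ v, 0 ≤ G v) → (∀ v, G v ≤ 1 - κ) → Integrable G →
      (Integrable fun v => G v * ‖v‖ ^ 2) → ∫ v, G v = ∫ v, fermiDirac 1 A 1 v →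
      ∫ v, fermiDirac 1 A 1 v * ‖v‖ ^ 2 < ∫ v, G v * ‖v‖ ^ 2)
    (h : IsAdmissible κ ε g) (hε : 0 < ε) {A s : ℝ} (hA : A₁ ≤ A) (hs : 0 < s)
    (hmass : ∫ v, fermiDirac 1 A 1 v = ε * s ^ 3) :
    ∫ v, fermiDirac 1 A 1 v * ‖v‖ ^ 2 < 3 * ε * s ^ 5 := by
  have hs' : 0 < s⁻¹ := inv_pos.2 hs
  -- The competitor is `g` dilated by `s` and multiplied by `ε`, so that its mass matches the
  -- normalized profile and it takes values in `[0, 1-κ]`.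
  have h1 := hA₁ A hA (fun v => ε * g (s⁻¹ • v)) (fun v => (mul_pos hε (h.pos _)).le)
    (fun v => by linarith [h.pauli (s⁻¹ • v)]) ((h.integrable.comp_smul hs'.ne').const_mul ε)
    (by
      simp_rw [mul_assoc]
      exact (integrable_comp_smul_mul_sq hs' h.integrable_energy).const_mul ε)
    (by
      rw [integral_const_mul, integral_comp_smul_vel hs' g, h.mass, hmass]
      field_simp)
  simp_rw [mul_assoc] at h1
  rw [integral_const_mul, integral_comp_smul_mul_sq hs' g, h.energy] at h1
  refine h1.trans_eq ?_
  field_simp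

/-- Uniform bound on the inverse temperature of the Fermi-Dirac statistics. -/
theorem exists_param_le (hκ : 0 < κ) : ∃ B : ℝ, 0 < B ∧ ∀ (ε : ℝ) (g : Vel → ℝ),
    IsAdmissible κ ε g → ∀ a b, IsFermiDiracParams ε a b → b ≤ B := by
  obtain ⟨A₁, hA₁1, hA₁⟩ := exists_degenerate hκ
  set J₀ := ∫ v, gauss 1 1 v with hJ₀
  set J₂ := ∫ v, gauss 1 1 v * ‖v‖ ^ 2 with hJ₂
  have hJ₀0 : 0 < J₀ := integral_gauss_pos one_pos one_pos
  have hJ₂0 : 0 < J₂ := integral_gauss_mul_sq_pos one_pos one_pos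
  refine ⟨J₂ / (3 * J₀) * (1 + A₁), by positivity, fun ε g h a b hab => ?_⟩
  obtain ⟨ha, hb, hM1, -, hM3⟩ := hab
  have hε := h.eps_nonneg
  set s := Real.sqrt b with hs
  have hs0 : 0 < s := Real.sqrt_pos.2 hb
  have hsb : b = s ^ 2 := (Real.sq_sqrt hb.le).symm
  -- Otherwise the profile would be so degenerate that its energy is strictly below 3.
  have hA : ε * a ≤ A₁ := by
    by_contra! hlt
    have hε0 : 0 < ε := by
      rcases hε.eq_or_lt with rfl | h0
      · rw [zero_mul] at hlt; linarith
      · exact h0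
    rw [hsb] at hM1 hM3
    simp_rw [fermiDirac_smul s hε0.ne'] at hM1 hM3
    simp_rw [mul_assoc] at hM3
    rw [integral_const_mul, integral_comp_smul_vel hs0 (fermiDirac 1 (ε * a) 1)] at hM1
    rw [integral_const_mul, integral_comp_smul_mul_sq hs0 (fermiDirac 1 (ε * a) 1)] at hM3
    have h1 : ∫ v, fermiDirac 1 (ε * a) 1 v = ε * s ^ 3 := by
      field_simp at hM1; linarith
    have h2 := h.energy_lt hA₁ hε0 hlt.le hs0 h1
    have h3 : ∫ v, fermiDirac 1 (ε * a) 1 v * ‖v‖ ^ 2 = 3 * ε * s ^ 5 := by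
      field_simp at hM3; linarith
    linarith
  -- The profile lies between `N/(1+A₁)` and `N`, for `N` its Gaussian. So `N` has mass at most
  -- `1+A₁` and energy at least 3, and its energy per mass is `J₂/(J₀ b)`; this bounds `b`.
  have hga : ∀ v, gauss a b v = a * gauss 1 1 (s • v) := by
    intro v; rw [hsb, gauss_smul]; unfold gauss; ring
  have g0 : ∫ v, gauss a b v = a * ((s ^ 3)⁻¹ * J₀) := by
    simp_rw [hga]; rw [integral_const_mul, integral_comp_smul_vel hs0]
  have g2 : ∫ v, gauss a b v * ‖v‖ ^ 2 = a * ((s ^ 5)⁻¹ * J₂) := by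
    simp_rw [hga, mul_assoc]; rw [integral_const_mul, integral_comp_smul_mul_sq hs0]
  have h3 : 3 ≤ a * ((s ^ 5)⁻¹ * J₂) := by
    rw [← hM3, ← g2]
    exact integral_mono (integrable_fermiDirac_mul_sq hε ha hb) (integrable_gauss_mul_sq a hb)
      fun v => mul_le_mul_of_nonneg_right (fermiDirac_le_gauss hε ha v) (by positivity)
  have h1 : a * ((s ^ 3)⁻¹ * J₀) ≤ 1 + A₁ := by
    have hi : ∫ v, (1 + A₁) * fermiDirac ε a b v = 1 + A₁ := by
      rw [integral_const_mul, hM1, mul_one]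
    rw [← g0, ← hi]
    refine integral_mono (integrable_gauss a hb) ((integrable_fermiDirac hε ha hb).const_mul _)
      fun v => ?_
    have hN := gauss_pos (β := b) ha v
    have hNa : gauss a b v ≤ a := by
      unfold gauss
      refine mul_le_of_le_one_right ha.le (Real.exp_le_one_iff.2 ?_)
      nlinarith [mul_nonneg hb.le (sq_nonneg ‖v‖)]
    rw [fermiDirac_eq, mul_div_assoc', le_div_iff₀ (by positivity), mul_comm]
    gcongr
    exact (mul_le_mul_of_nonneg_left hNa hε).trans hA
  have h5 : 3 * s ^ 2 ≤ (a * (s ^ 3)⁻¹) * J₂ := by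
    have := mul_le_mul_of_nonneg_right h3 (sq_nonneg s)
    refine this.trans_eq ?_
    field_simp
  have h6 : a * (s ^ 3)⁻¹ ≤ (1 + A₁) / J₀ := by
    rw [le_div_iff₀ hJ₀0]; linarith
  have h7 := mul_le_mul_of_nonneg_right h6 hJ₂0.le
  have h8 : J₂ / (3 * J₀) * (1 + A₁) = (1 + A₁) / J₀ * J₂ / 3 := by field_simp
  rw [h8, hsb]
  linarith

/-- Existence of the Fermi-Dirac statistics with the normalization of an admissible density. -/
theorem IsAdmissible.exists_params (h : IsAdmissible κ ε g) :
    ∃ a b : ℝ, IsFermiDiracParams ε a b := by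
  set J₀ := ∫ v, gauss 1 1 v with hJ₀
  set J₂ := ∫ v, gauss 1 1 v * ‖v‖ ^ 2 with hJ₂
  have hJ₀0 : 0 < J₀ := integral_gauss_pos one_pos one_pos
  have hJ₂0 : 0 < J₂ := integral_gauss_mul_sq_pos one_pos one_pos
  rcases h.eps_nonneg.eq_or_lt with rfl | hε
  · set s := Real.sqrt (J₂ / (3 * J₀)) with hs
    have hs0 : 0 < s := Real.sqrt_pos.2 (by positivity)
    have hs2 : s ^ 2 = J₂ / (3 * J₀) := Real.sq_sqrt (by positivity)
    have hga : ∀ v, fermiDirac 0 (s ^ 3 / J₀) (s ^ 2) v = s ^ 3 / J₀ * gauss 1 1 (s • v) := by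
      intro v
      rw [fermiDirac_eq, zero_mul, add_zero, div_one, gauss_smul]; unfold gauss; ring
    refine ⟨s ^ 3 / J₀, s ^ 2, by positivity, by positivity, ?_,
      integral_even_smul_eq_zero (fermiDirac_neg _ _ _), ?_⟩
    · simp_rw [hga]
      rw [integral_const_mul, integral_comp_smul_vel hs0, ← hJ₀]
      field_simp
    · simp_rw [hga, mul_assoc]
      rw [integral_const_mul, integral_comp_smul_mul_sq hs0, ← hJ₂]
      have : s ^ 2 * (3 * J₀) = J₂ := by rw [hs2]; field_simp
      field_simp
      linarith
  · obtain ⟨A₁, hA₁1, hA₁⟩ := exists_degenerate h.kappa_pos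
    set I₀ : ℝ → ℝ := fun A => ∫ v, fermiDirac 1 A 1 v with hI₀
    set I₂ : ℝ → ℝ := fun A => ∫ v, fermiDirac 1 A 1 v * ‖v‖ ^ 2 with hI₂
    have hI₀0 : ∀ A, 0 < A → 0 < I₀ A := fun A hA =>
      integral_pos_of_pos (NeZero.ne _) (fermiDirac_pos zero_le_one hA)
        (integrable_fermiDirac zero_le_one hA one_pos)
    -- The dilation that fixes unit mass for given `A`. Energy 3 then becomes the single equation
    -- `I₂ = 3 I₀ s²`.
    set s : ℝ → ℝ := fun A => (I₀ A / ε) ^ (1 / 3 : ℝ) with hs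
    have hs0 : ∀ A, 0 < A → 0 < s A := fun A hA => by have := hI₀0 A hA; positivity
    have hs3 : ∀ A, 0 < A → s A ^ 3 = I₀ A / ε := fun A hA => by
      have := hI₀0 A hA
      rw [hs, ← Real.rpow_mul_natCast (by positivity)]
      norm_num
    have hgA : ∀ A v, gauss A 1 v = A * gauss 1 1 v := fun A v => by unfold gauss; ring
    -- A threshold for the dilation: when `s ≤ t`, the bounds `I₂ ≥ A J₂/2` and `I₀ ≤ A J₀`, valid
    -- for `A ≤ 1`, give `I₂ ≥ 3 I₀ s²`. The choice of `A₀` below enforces `s ≤ t`.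
    set t := Real.sqrt (J₂ / (6 * J₀)) / 2 with ht
    have ht0 : 0 < t := half_pos (Real.sqrt_pos.2 (by positivity))
    have ht2 : t ^ 2 < J₂ / (6 * J₀) := by
      have h1 : Real.sqrt (J₂ / (6 * J₀)) ^ 2 = J₂ / (6 * J₀) := Real.sq_sqrt (by positivity)
      have h2 : 0 < J₂ / (6 * J₀) := by positivity
      rw [ht, div_pow, h1]; linarith
    set A₀ := min 1 (ε * t ^ 3 / J₀) with hA₀
    have hA₀0 : 0 < A₀ := by positivity
    have hA₀1 : A₀ ≤ 1 := min_le_left _ _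
    have hlow : 0 ≤ I₂ A₀ - 3 * I₀ A₀ * s A₀ ^ 2 := by
      have hn0 : I₀ A₀ ≤ A₀ * J₀ := by
        rw [hJ₀, ← integral_const_mul]
        exact integral_mono (integrable_fermiDirac zero_le_one hA₀0 one_pos)
          ((integrable_gauss 1 one_pos).const_mul A₀) fun v => by
            simp only [← hgA]; exact fermiDirac_le_gauss zero_le_one hA₀0 v
      have hn2 : A₀ / 2 * J₂ ≤ I₂ A₀ := by
        rw [hJ₂, ← integral_const_mul]
        refine integral_mono ((integrable_gauss_mul_sq 1 one_pos).const_mul _)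
          (integrable_fermiDirac_mul_sq zero_le_one hA₀0 one_pos) fun v => ?_
        simp only
        rw [← mul_assoc]
        refine mul_le_mul_of_nonneg_right ?_ (sq_nonneg _)
        have hN := gauss_pos (β := 1) hA₀0 v
        have hN1 : gauss A₀ 1 v ≤ 1 := by
          unfold gauss
          refine mul_le_one₀ hA₀1 (Real.exp_pos _).le (Real.exp_le_one_iff.2 ?_)
          nlinarith [sq_nonneg ‖v‖]
        rw [fermiDirac_eq, le_div_iff₀ (by positivity), div_mul_eq_mul_div, ← hgA]
        nlinarith
      have hst : s A₀ ≤ t := by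
        refine le_of_pow_le_pow_left₀ (n := 3) (by norm_num) ht0.le ?_
        rw [hs3 A₀ hA₀0, div_le_iff₀ hε]
        refine hn0.trans ?_
        have := min_le_right 1 (ε * t ^ 3 / J₀)
        rw [← hA₀, le_div_iff₀ hJ₀0] at this
        linarith
      have hst2 : s A₀ ^ 2 ≤ J₂ / (6 * J₀) :=
        (pow_le_pow_left₀ (hs0 A₀ hA₀0).le hst 2).trans ht2.le
      have h5 : 3 * I₀ A₀ * s A₀ ^ 2 ≤ 3 * (A₀ * J₀) * (J₂ / (6 * J₀)) := by
        have := hI₀0 A₀ hA₀0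
        gcongr
      have h6 : 3 * (A₀ * J₀) * (J₂ / (6 * J₀)) = A₀ / 2 * J₂ := by field_simp; norm_num
      linarith
    have hA₁0 : 0 < A₁ := by linarith
    -- At the degenerate end the existing density `g` has more energy than the profile, which gives
    -- the opposite sign.
    have hhigh : I₂ A₁ - 3 * I₀ A₁ * s A₁ ^ 2 ≤ 0 := by
      have h1 : I₀ A₁ = ε * s A₁ ^ 3 := by rw [hs3 A₁ hA₁0]; field_simp
      have h2 := h.energy_lt hA₁ hε le_rfl (hs0 A₁ hA₁0) h1
      have h3 : 3 * I₀ A₁ * s A₁ ^ 2 = 3 * ε * s A₁ ^ 5 := by rw [h1]; ring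
      rw [h3]
      linarith
    have hcn : ∀ v, ContinuousOn (fun A => fermiDirac 1 A 1 v) (Icc A₀ A₁) := by
      intro v
      unfold fermiDirac
      refine ContinuousOn.div (by fun_prop) (by fun_prop) fun A hA => ?_
      have : 0 < A := hA₀0.trans_le hA.1
      positivity
    have hbn : ∀ A ∈ Icc A₀ A₁, ∀ v, ‖fermiDirac 1 A 1 v‖ ≤ gauss A₁ 1 v := by
      intro A hA v
      have hA0 : 0 < A := hA₀0.trans_le hA.1
      rw [Real.norm_of_nonneg (fermiDirac_pos zero_le_one hA0 v).le]
      refine (fermiDirac_le_gauss zero_le_one hA0 v).trans ?_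
      unfold gauss
      gcongr
      exact hA.2
    have hmn : ∀ A ∈ Icc A₀ A₁, Continuous (fermiDirac 1 A 1) := fun A hA =>
      continuous_fermiDirac zero_le_one (hA₀0.trans_le hA.1)
    have hc0 : ContinuousOn I₀ (Icc A₀ A₁) :=
      continuousOn_of_dominated (fun A hA => (hmn A hA).aestronglyMeasurable)
        (fun A hA => Eventually.of_forall (hbn A hA)) (integrable_gauss A₁ one_pos)
        (Eventually.of_forall hcn)
    have hc2 : ContinuousOn I₂ (Icc A₀ A₁) :=
      continuousOn_of_dominated (bound := fun v => gauss A₁ 1 v * ‖v‖ ^ 2)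
        (fun A hA => ((hmn A hA).mul (by fun_prop)).aestronglyMeasurable)
        (fun A hA => Eventually.of_forall fun v => by
          rw [norm_mul, Real.norm_of_nonneg (sq_nonneg ‖v‖)]
          exact mul_le_mul_of_nonneg_right (hbn A hA v) (sq_nonneg _))
        (integrable_gauss_mul_sq A₁ one_pos)
        (Eventually.of_forall fun v => (hcn v).mul continuousOn_const)
    have hcs : ContinuousOn s (Icc A₀ A₁) :=
      (hc0.div_const ε).rpow_const fun A _ => Or.inr (by norm_num)
    have hcD : ContinuousOn (fun A => I₂ A - 3 * I₀ A * s A ^ 2) (Icc A₀ A₁) := by fun_prop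
    obtain ⟨A, hA, hD⟩ := intermediate_value_Icc' (hA₀1.trans hA₁1) hcD
      (show (0 : ℝ) ∈ Icc _ _ from ⟨hhigh, hlow⟩)
    have hA0 : 0 < A := hA₀0.trans_le hA.1
    have hsA := hs0 A hA0
    have hIA : I₀ A = ε * s A ^ 3 := by rw [hs3 A hA0]; field_simp
    have hI2A : I₂ A = 3 * ε * s A ^ 5 := by
      have : I₂ A = 3 * I₀ A * s A ^ 2 := by linarith [hD]
      rw [this, hIA]; ring
    have hae : ε * (A / ε) = A := by field_simp
    refine ⟨A / ε, s A ^ 2, by positivity, by positivity, ?_,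
      integral_even_smul_eq_zero (fermiDirac_neg _ _ _), ?_⟩
    · simp_rw [fermiDirac_smul (s A) hε.ne', hae]
      rw [integral_const_mul, integral_comp_smul_vel hsA (fermiDirac 1 A 1)]
      have : ∫ v, fermiDirac 1 A 1 v = ε * s A ^ 3 := hIA
      rw [this]
      field_simp
    · simp_rw [fermiDirac_smul (s A) hε.ne', hae, mul_assoc]
      rw [integral_const_mul, integral_comp_smul_mul_sq hsA (fermiDirac 1 A 1)]
      have : ∫ v, fermiDirac 1 A 1 v * ‖v‖ ^ 2 = 3 * ε * s A ^ 5 := hI2A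
      rw [this]
      field_simp

end Parameters

/-! ### Entropy inequality for admissible densities and conclusion -/

/-- Members of `𝒴_ε(f_in)` satisfying a strict Pauli bound are admissible. -/
lemma MemY.isAdmissible {κ ε : ℝ} {fin g : Vel → ℝ} (hg : MemY ε fin g) (hκ : 0 < κ) (hε : 0 ≤ ε)
    (hfin : IsNormalized fin) (hc : ContDiff ℝ 1 g) (h0 : ∀ v, 0 < g v)
    (hp : ∀ v, κ ≤ 1 - ε * g v) : IsAdmissible κ ε g where
  kappa_pos := hκ
  eps_nonneg := hε
  contDiff := hc
  pos := h0
  pauli := hp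
  integrable := hg.memL1.1
  integrable_energy := by
    have hgc := hc.continuous
    have hm : Continuous fun v => g v * (1 + ‖v‖ ^ 2) := by fun_prop
    have h1 : Integrable fun v => g v * (1 + ‖v‖ ^ 2) := by
      refine (lintegral_ofReal_ne_top_iff_integrable hm.aestronglyMeasurable
        (Eventually.of_forall fun v => mul_nonneg (h0 v).le (by positivity))).1 ?_
      refine ne_of_lt (lt_of_eq_of_lt (lintegral_congr fun v => ?_) hg.memL1.2)
      have h2 : bracket v ^ (2 : ℝ) = 1 + ‖v‖ ^ 2 := by
        rw [Real.rpow_two]; exact Real.sq_sqrt (by positivity)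
      rw [h2, abs_of_pos (h0 v), mul_comm]
    exact (h1.sub hg.memL1.1).congr (Eventually.of_forall fun v => by
      simp only [Pi.sub_apply]; ring)
  mass := hg.mass.trans hfin.mass
  momentum := hg.momentum.trans hfin.momentum
  energy := hg.energy.trans hfin.energy

namespace IsAdmissible

variable {κ ε : ℝ} {g : Vel → ℝ}

lemma contDiff_div (h : IsAdmissible κ ε g) : ContDiff ℝ 1 fun v => g v / (1 - ε * g v) :=
  h.contDiff.div (contDiff_const.sub (contDiff_const.mul h.contDiff)) fun v =>
    (h.kappa_pos.trans_le (h.pauli v)).ne'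

/-- The derivative of `x/(1-εx)` is `(1-εx)⁻²`, so the logarithmic gradient of `g/(1-εg)` is the
field in the entropy production. This links the logarithmic Sobolev inequality to it. -/
lemma inv_smul_gradient_div (h : IsAdmissible κ ε g) (v : Vel) :
    (g v / (1 - ε * g v))⁻¹ • gradient (fun w => g w / (1 - ε * g w)) v = scoreField ε g v := by
  have hp : 0 < 1 - ε * g v := h.kappa_pos.trans_le (h.pauli v)
  have hg0 := h.pos v
  have hd : HasFDerivAt g (fderiv ℝ g v) v :=
    (h.contDiff.differentiable one_ne_zero v).hasFDerivAt
  have h1 := HasDerivAt.comp_hasFDerivAt (h₂ := fun x : ℝ => x / (1 - ε * x))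
    (h₂' := ((1 - ε * g v) ^ 2)⁻¹) v (by
      have := (hasDerivAt_id (g v)).div (((hasDerivAt_id (g v)).const_mul ε).const_sub 1) hp.ne'
      refine this.congr_deriv ?_
      simp only [id]
      field_simp
      ring) hd
  have h2 : gradient (fun w => g w / (1 - ε * g w)) v
      = ((1 - ε * g v) ^ 2)⁻¹ • gradient g v := by
    unfold gradient
    rw [← map_smul]
    exact congrArg _ h1.fderiv
  rw [h2, smul_smul, scoreField]
  congr 1
  field_simp

lemma div_le (h : IsAdmissible κ ε g) (v : Vel) : g v / (1 - ε * g v) ≤ κ⁻¹ * g v := by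
  rw [div_eq_inv_mul]
  exact mul_le_mul_of_nonneg_right (inv_anti₀ h.kappa_pos (h.pauli v)) (h.pos v).le

/-- Logarithmic Sobolev inequality for the Fermi-Dirac relative entropy. -/
lemma relEntropy_le (h : IsAdmissible κ ε g)
    (hl : ε = 0 → Integrable fun v => g v * Real.log (g v)) {a b β : ℝ}
    (hab : IsFermiDiracParams ε a b) (hβ : 0 < β) :
    0 ≤ relEntropy ε g (fermiDirac ε a b) ∧
      ENNReal.ofReal (relEntropy ε g (fermiDirac ε a b)) ≤ ENNReal.ofReal (κ ^ 2)⁻¹ *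
        ∫⁻ v, ENNReal.ofReal
          (1 / (4 * β) * (fermiDensity ε g v * ‖(2 * β) • v + scoreField ε g v‖ ^ 2)) := by
  have hκ := h.kappa_pos
  have hp : ∀ v, 0 < 1 - ε * g v := fun v => hκ.trans_le (h.pauli v)
  obtain ⟨hH, hA⟩ := relEntropy_fermiDirac h.eps_nonneg h.contDiff.continuous.measurable h.pos
    (fun v => by linarith [hp v]) h.integrable h.integrable_energy hl hab h.mass h.energy
  refine ⟨hH, ?_⟩
  set u : Vel → ℝ := fun v => g v / (1 - ε * g v) with hu
  have hu0 : ∀ v, 0 < u v := fun v => div_pos (h.pos v) (hp v)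
  have huc := h.contDiff_div.continuous
  have hui : Integrable u := (h.integrable.const_mul κ⁻¹).mono' huc.aestronglyMeasurable
    (Eventually.of_forall fun v => by rw [Real.norm_of_nonneg (hu0 v).le]; exact h.div_le v)
  have hue : Integrable fun v => u v * ‖v‖ ^ 2 :=
    (h.integrable_energy.const_mul κ⁻¹).mono' (huc.mul (by fun_prop)).aestronglyMeasurable
      (Eventually.of_forall fun v => by
        rw [Real.norm_of_nonneg (mul_nonneg (hu0 v).le (by positivity)), ← mul_assoc]
        exact mul_le_mul_of_nonneg_right (h.div_le v) (by positivity))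
  obtain ⟨A, hA0, hls⟩ := logSobolev hβ h.contDiff_div hu0 hui hue
  refine (hA A β hA0 hβ).trans (hls.trans ?_)
  rw [← lintegral_const_mul' _ _ ENNReal.ofReal_ne_top]
  refine lintegral_mono fun v => ?_
  rw [← ENNReal.ofReal_mul (by positivity), h.inv_smul_gradient_div v]
  refine ENNReal.ofReal_le_ofReal ?_
  -- `u = F/(1-εg)²`, which is the only place where the factor `κ⁻²` arises.
  have h1 : u v ≤ (κ ^ 2)⁻¹ * fermiDensity ε g v := by
    have h2 : κ ^ 2 ≤ (1 - ε * g v) ^ 2 := pow_le_pow_left₀ hκ.le (h.pauli v) 2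
    rw [hu, fermiDensity, inv_mul_eq_div, div_le_div_iff₀ (hp v) (by positivity)]
    calc g v * κ ^ 2 ≤ g v * (1 - ε * g v) ^ 2 := mul_le_mul_of_nonneg_left h2 (h.pos v).le
      _ = _ := by ring
  calc 1 / (4 * β) * u v * ‖(2 * β) • v + scoreField ε g v‖ ^ 2
      ≤ 1 / (4 * β) * ((κ ^ 2)⁻¹ * fermiDensity ε g v) *
        ‖(2 * β) • v + scoreField ε g v‖ ^ 2 := by gcongr
    _ = _ := by ring

end IsAdmissible

end LFD

end

theorem corollary4p5 (κ₀ m l : ℝ) (hκ₀ : 0 < κ₀) :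
    ∃ C₀ : ℝ, 0 < C₀ ∧
      ∀ (γ ε₀ ε : ℝ) (fin g : LFD.Vel → ℝ),
        γ ∈ Set.Icc (0 : ℝ) 1 →
        ε ∈ Set.Icc (0 : ℝ) ε₀ →
        LFD.IsInitialDatum ε₀ fin →
        LFD.IsNormalized fin →
        LFD.MemY ε fin g →
        LFD.MemL2 (2 + γ) g →
        ContDiff ℝ 1 g →
        (∀ v, 0 < g v) →
        (∀ v, κ₀ ≤ 1 - ε * g v) →
        LFD.moment (2 + γ) g ≤ ENNReal.ofReal m →
        LFD.weightedL2Norm (2 + γ) g ≤ ENNReal.ofReal l →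
        (∃ a b : ℝ, LFD.IsFermiDiracParams ε a b) ∧
        ∀ a b : ℝ, LFD.IsFermiDiracParams ε a b →
          ENNReal.ofReal
              (C₀ * (b - 12 * ε ^ 2 / κ₀ ^ 4 *
                max (LFD.supNorm g ^ 2) (LFD.supNorm (LFD.fermiDirac ε a b) ^ 2)) *
                LFD.relEntropy ε g (LFD.fermiDirac ε a b))
            ≤ LFD.entropyProduction γ ε g := by
  obtain ⟨C, hC, hfisher⟩ := LFD.exists_fisher_le hκ₀ (sq_nonneg (max l 0))
  obtain ⟨B, hB, hb⟩ := LFD.exists_param_le hκ₀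
  -- `κ₀²/C` is the constant in `D ≥ (κ₀²/C) H`; dividing by `B` makes room for the bracket, which
  -- is at most `b ≤ B`.
  refine ⟨κ₀ ^ 2 / (C * B), by positivity, ?_⟩
  intro γ ε₀ ε fin g hγ hε _ hfin hY _ hc h0 hp _ hl2
  have h := hY.isAdmissible hκ₀ hε.1 hfin hc h0 hp
  refine ⟨h.exists_params, fun a b hab => ?_⟩
  obtain ⟨β, hβ, hD⟩ := hfisher γ ε g hγ h (LFD.lintegral_sq_le_of_weightedL2Norm_le hγ.1 hl2)
  obtain ⟨hH, hle⟩ := h.relEntropy_le (fun h => (hY.entropy_classical h).1) hab hβ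
  set H := LFD.relEntropy ε g (LFD.fermiDirac ε a b)
  -- The correction only lowers the left side, so it is dropped; this needs `H ≥ 0`.
  have hcorr : 0 ≤ 12 * ε ^ 2 / κ₀ ^ 4 *
      max (LFD.supNorm g ^ 2) (LFD.supNorm (LFD.fermiDirac ε a b) ^ 2) :=
    mul_nonneg (by positivity) (le_max_of_le_left (sq_nonneg _))
  have hbB := hb ε g h a b hab
  have hle2 : ENNReal.ofReal H ≤ ENNReal.ofReal (C / κ₀ ^ 2) * LFD.entropyProduction γ ε g := by
    refine (hle.trans (mul_le_mul_right hD _)).trans_eq ?_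
    rw [← mul_assoc, ← ENNReal.ofReal_mul (by positivity), div_eq_inv_mul]
  calc _ ≤ ENNReal.ofReal (κ₀ ^ 2 / C * H) := by
        refine ENNReal.ofReal_le_ofReal (mul_le_mul_of_nonneg_right ?_ hH)
        calc _ ≤ κ₀ ^ 2 / (C * B) * B := by gcongr; linarith
          _ = κ₀ ^ 2 / C := by field_simp
    _ = ENNReal.ofReal (κ₀ ^ 2 / C) * ENNReal.ofReal H := ENNReal.ofReal_mul (by positivity)
    _ ≤ ENNReal.ofReal (κ₀ ^ 2 / C) *
        (ENNReal.ofReal (C / κ₀ ^ 2) * LFD.entropyProduction γ ε g) := mul_le_mul_right hle2 _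
    _ = LFD.entropyProduction γ ε g := by
        rw [← mul_assoc, ← ENNReal.ofReal_mul (by positivity)]
        have : κ₀ ^ 2 / C * (C / κ₀ ^ 2) = 1 := by field_simp
        rw [this, ENNReal.ofReal_one, one_mul]
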